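/- **Setting.** Let $w_i=(x_i,y_i,\delta_i)$, $i\ge 1$, be i.i.d., where $\delta_i\in\{0,1\}$ indicates whether $y_i$ is observed. The response is missing at random: $\Pr(\delta_i=1\mid x_i,y_i)=\pi(\phi_0;x_i)$, where $\pi(\phi;x)\in(0,1)$, $\phi\in\mathbb R^q$, is a known parametric model that is differentiable in $\phi$. The target $\theta_0\in\mathbb R^k$ satisfies $E\,U(\theta_0;x,y)=0$ for an $\mathbb R^k$-valued estimating function $U$. Put $\zeta=(\phi,\theta)$, $\zeta_0=(\phi_0,\theta_0)$, $p=q+k\ge1$, let $Z\subset\mathbb R^p$ be the parameter space, with $\zeta_0$ in its interior, and let $$u(\zeta;w)=\begin{pmatrix}\big\{\frac{\delta}{\pi(\phi;x)}-\frac{1-\delta}{1-\pi(\phi;x)}\big\}\frac{\partial\pi(\phi;x)}{\partial\phi}\\[2pt] \frac{\delta}{\pi(\phi;x)}U(\theta;x,y)\end{pmatrix},\qquad U_n(\zeta)=\frac1n\sum_{i=1}^n u(\zeta;w_i),$$ $\eta(\zeta)=E\,U_n(\zeta)$ (integrable for $\zeta\in Z$), $\Sigma(\zeta)=\mathrm{Var}\{\sqrt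 n\,U_n(\zeta)\}$, $A(\zeta)=\partial\eta(\zeta)/\partial\zeta$. Let $N_n=N_n(\zeta_0)$ be the open ball with centre $\zeta_0$ and radius $r_n$, where $r_n\to0$ and $r_n\sqrt n\to\infty$. "W.p.→1" means with probability tending to one as $n\to\infty$, and conditions on $N_n$ are for all large $n$. **Conditions.** - (C1) $\sup_{\zeta\in Z}\|U_n(\zeta)-\eta(\zeta)\|\to0$ in probability. - (C2) W.p.→1, $U_n$ is continuous on $Z$ and has exactly one zero $\hat\zeta$ in $Z$. - (C3) $\zeta_0$ is the only root of $\eta(\zeta)=0$ in $Z$. - (C4) W.p.→1, $U_n$ is continuously differentiable on $N_n$ and all second partial derivatives exist (are finite) there; the Jacobian of $U_n$ converges uniformly on $N_n$, in probability, to a non-random non-singular limit. - (C5) For $\zeta\in N_n$, $\Sigma(\zeta)$ is finite and positive definite, and $\sqrt m\{U_m(\zeta)-\eta(\zeta)\}\to N(0,\Sigma(\zeta))$ in distribution as $m\to\infty$. - (C6) The prior density of $\eta$ (possibly flat) is positive and Lipschitz on the (measurable) parameter space $H$ of $\eta$, a neighbourhood of $0$. - (C7) The symmetric variance estimators $\hat\Sigma(\zeta)$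 satisfy $\hat\Sigma(\zeta)-\Sigma(\zeta)\to0$ in probability, uniformly on $N_n$. - (C8) On $N_n$, $|\Sigma(\zeta)|^{-1}$ is Lipschitz, and $|x'\Sigma(\zeta_1)^{-1}x-x'\Sigma(\zeta_2)^{-1}x|\le C(x)\|\zeta_1-\zeta_2\|$ for all $x\in\mathbb R^p$, where $C$ is locally Lipschitz and does not depend on $n$. - (C9) W.p.→1, $U_n$ is one-to-one on $N_n$; $\eta$ is one-to-one and Lipschitz on $N_n$. **Two-step method.** (1) Draw $\eta^*\sim N(0,\hat\Sigma/n)$, where $\hat\Sigma=\hat\Sigma(\hat\zeta)$. (2) Let $\zeta^*\in Z$ be a solution of $U_n(\zeta)=\eta^*$, measurably chosen, the one in $N_n$ if there is one; draws for which there is no solution are discarded. The conditional law of $\zeta^*$ given the data is the approximate posterior $p(\zeta\mid U_n=0)=p(\zeta\mid\hat\zeta)$; its density is taken in the version that is continuous on $N_n$. **Theorem.** Assume (C1)–(C9) and put $\mathrm{Var}(\hat\zeta)=n^{-1}A(\zeta_0)^{-1}\Sigma(\zeta_0)A'(\zeta_0)^{-1}$, the Taylor linearization variance. Let $\phi_{m,V}$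 be the density of $N(m,V)$. 1. The posterior of $\eta$ given $U_n=0$, for the likelihood $U_n\mid\eta\sim N(\eta,\Sigma(\hat\zeta)/n)$ and the prior in (C6), has total variation distance to $N(0,\hat\Sigma/n)$ that tends to $0$ in probability. 2. $p(\zeta\mid\hat\zeta)\to\phi_{\hat\zeta,\mathrm{Var}(\hat\zeta)}(\zeta)$: the total variation distance between $p(\cdot\mid\hat\zeta)$ and $N(\hat\zeta,\mathrm{Var}(\hat\zeta))$ tends to $0$ in probability, also if $\eta^*$ is drawn from the posterior in 1 instead of $N(0,\hat\Sigma/n)$; and for every $K$, $$\sup_{\|\zeta-\hat\zeta\|\le K/\sqrt n}\Big|\frac{p(\zeta\mid\hat\zeta)}{\phi_{\hat\zeta,\mathrm{Var}(\hat\zeta)}(\zeta)}-1\Big|\to0\quad\text{in probability.}$$ 3. $\displaystyle\int_{N_n(\zeta_0)}\phi_{\hat\zeta,\mathrm{Var}(\hat\zeta)}(\zeta)\,d\zeta\to1$ in probability. 4. For $\alpha\in(0,1)$ let $C_n=\{\zeta:(\zeta-\hat\zeta)'\mathrm{Var}(\hat\zeta)^{-1}(\zeta-\hat\zeta)\le\chi^2_{p}(1-\alpha)\}$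 be the frequentist confidence region, with $\chi^2_p(1-\alpha)$ the $1-\alpha$ quantile of the chi-square distribution with $p$ degrees of freedom, and let $C_n^*=\{\zeta:p(\zeta\mid\hat\zeta)\ge k^*\}$ be the highest posterior density region, with $k^*$ the largest $k$ for which this set has posterior probability (at least) $1-\alpha$. Then $\Pr(\zeta_0\in C_n)\to1-\alpha$ and $\Pr(\zeta_0\in C_n^*)\to1-\alpha$; the posterior probabilities of $C_n$ and of $C_n^*$ tend to $1-\alpha$ in probability; and $\mathrm{vol}(C_n\,\triangle\,C_n^*)/\mathrm{vol}(C_n)\to0$ in probability. -/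

import Mathlib

open MeasureTheory ProbabilityTheory Filter Topology
open scoped ENNReal Matrix

noncomputable section

namespace BayesPS

/-! ### Normal densities and convergence in probability -/

/-- The quadratic form `x' S x`. -/
def quadForm {ι : Type*} [Fintype ι] (S : Matrix ι ι ℝ) (x : EuclideanSpace ℝ ι) : ℝ :=
  x.ofLp ⬝ᵥ (S *ᵥ x.ofLp)

/-- The density at `x` of the normal distribution with mean `m` and (positive definite)
variance matrix `S`. -/
def normalDensity {ι : Type*} [Fintype ι] [DecidableEq ι] (m : EuclideanSpace ℝ ι)
    (S : Matrix ι ι ℝ) (x : EuclideanSpace ℝ ι) : ℝ :=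
  (Real.sqrt ((2 * Real.pi) ^ Fintype.card ι * S.det))⁻¹ *
    Real.exp (-(1 / 2) * quadForm S⁻¹ (x - m))

/-- The event `A n` has probability tending to one (`P` of the complement tends to zero; for a set
that is not measurable, `P` is the outer measure). -/
def WithProbToOne {Ω : Type*} [MeasurableSpace Ω] (P : Measure Ω) (A : ℕ → Ω → Prop) : Prop :=
  Tendsto (fun n => P {ω | ¬ A n ω}) atTop (𝓝 0)

/-- `x n` tends to the constant `c` in probability. -/
def TendsInProb {Ω : Type*} [MeasurableSpace Ω] (P : Measure Ω) (x : ℕ → Ω → ℝ) (c : ℝ) : Prop :=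
  ∀ ε : ℝ, 0 < ε → WithProbToOne P (fun n ω => |x n ω - c| < ε)

/-- Total variation distance of two finite measures (half the `L¹` distance of the densities, for
probability measures that have densities). -/
def tvDist {E : Type*} [MeasurableSpace E] (μ ν : Measure E) : ℝ≥0∞ :=
  ⨆ (B : Set E) (_ : MeasurableSet B), ENNReal.ofReal |μ.real B - ν.real B|

/-! ### Propensity score model and joint estimating equations -/

/-- The space of `ζ = (φ, θ)`, with `φ ∈ ℝ^q` and `θ ∈ ℝ^k`. -/
abbrev Par (q k : ℕ) := EuclideanSpace ℝ (Fin q ⊕ Fin k)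

/-- The component `φ` of `ζ = (φ, θ)`. -/
def Par.phi {q k : ℕ} (ζ : Par q k) : EuclideanSpace ℝ (Fin q) :=
  WithLp.toLp 2 (fun i => ζ (Sum.inl i))

/-- The component `θ` of `ζ = (φ, θ)`. -/
def Par.theta {q k : ℕ} (ζ : Par q k) : EuclideanSpace ℝ (Fin k) :=
  WithLp.toLp 2 (fun j => ζ (Sum.inr j))

/-- A parametric response model `π(φ; x)`, an estimating function `U(θ; x, y)` for the target
parameter, and a parameter space for `ζ = (φ, θ)`. -/
structure Model (𝒳 𝒴 : Type*) [MeasurableSpace 𝒳] [MeasurableSpace 𝒴] (q k : ℕ) where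
  prob : EuclideanSpace ℝ (Fin q) → 𝒳 → ℝ
  est : EuclideanSpace ℝ (Fin k) → 𝒳 → 𝒴 → EuclideanSpace ℝ (Fin k)
  space : Set (Par q k)
  measurable_prob : ∀ φ, Measurable (prob φ)
  measurable_est : ∀ θ, Measurable (fun w : 𝒳 × 𝒴 => est θ w.1 w.2)
  prob_mem : ∀ ζ ∈ space, ∀ x, prob ζ.phi x ∈ Set.Ioo (0 : ℝ) 1
  differentiable_prob : ∀ ζ ∈ space, ∀ x, DifferentiableAt ℝ (fun φ => prob φ x) ζ.phi

section

variable {𝒳 𝒴 Ω : Type*} [MeasurableSpace 𝒳] [MeasurableSpace 𝒴] [MeasurableSpace Ω] {q k : ℕ}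

/-- The contribution of one unit `(x, y, δ)` to the joint estimating function: the score
`{δ / π - (1 - δ) / (1 - π)} ∂π/∂φ` of the response model, stacked over `(δ / π) U(θ; x, y)`. -/
def Model.unitFun (M : Model 𝒳 𝒴 q k) (ζ : Par q k) (w : 𝒳 × 𝒴 × Bool) : Par q k :=
  let δ : ℝ := if w.2.2 then 1 else 0
  let p : ℝ := M.prob ζ.phi w.1
  WithLp.toLp 2 (Sum.elim
    (fun i => (δ / p - (1 - δ) / (1 - p)) * gradient (fun φ => M.prob φ w.1) ζ.phi i)
    (fun j => δ / p * M.est ζ.theta w.1 w.2.1 j))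

/-- The joint estimating function `U_n(ζ) = n⁻¹ ∑ (unit contributions)`. -/
def Model.Un (M : Model 𝒳 𝒴 q k) (W : ℕ → Ω → 𝒳 × 𝒴 × Bool) (n : ℕ) (ω : Ω) (ζ : Par q k) :
    Par q k :=
  (n : ℝ)⁻¹ • ∑ i ∈ Finset.range n, M.unitFun ζ (W i ω)

/-- `η(ζ) = E U_n(ζ)`, the mean of one contribution. -/
def Model.eta (M : Model 𝒳 𝒴 q k) (P : Measure Ω) (W : ℕ → Ω → 𝒳 × 𝒴 × Bool) (ζ : Par q k) :
    Par q k :=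
  ∫ ω, M.unitFun ζ (W 0 ω) ∂P

/-- `Σ(ζ) = Var {√n U_n(ζ)}`, the covariance matrix of one contribution. -/
def Model.Sig (M : Model 𝒳 𝒴 q k) (P : Measure Ω) (W : ℕ → Ω → 𝒳 × 𝒴 × Bool) (ζ : Par q k) :
    Matrix (Fin q ⊕ Fin k) (Fin q ⊕ Fin k) ℝ :=
  Matrix.of fun a b =>
    cov[fun ω => M.unitFun ζ (W 0 ω) a, fun ω => M.unitFun ζ (W 0 ω) b; P]

/-- The Jacobian matrix `A(ζ) = ∂η(ζ)/∂ζ`. -/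
def Model.A (M : Model 𝒳 𝒴 q k) (P : Measure Ω) (W : ℕ → Ω → 𝒳 × 𝒴 × Bool) (ζ : Par q k) :
    Matrix (Fin q ⊕ Fin k) (Fin q ⊕ Fin k) ℝ :=
  Matrix.of fun a b => (fderiv ℝ (M.eta P W) ζ (EuclideanSpace.single b 1)) a

/-- The Taylor linearization variance of the estimator,
`Var(ζ̂) = n⁻¹ A(ζ₀)⁻¹ Σ(ζ₀) A'(ζ₀)⁻¹`. -/
def Model.varHat (M : Model 𝒳 𝒴 q k) (P : Measure Ω) (W : ℕ → Ω → 𝒳 × 𝒴 × Bool) (ζ₀ : Par q k)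
    (n : ℕ) : Matrix (Fin q ⊕ Fin k) (Fin q ⊕ Fin k) ℝ :=
  (n : ℝ)⁻¹ • ((M.A P W ζ₀)⁻¹ * M.Sig P W ζ₀ * ((M.A P W ζ₀)ᵀ)⁻¹)

/-- The sampling model: `(x_i, y_i, δ_i)` are independent and identically distributed, the response
is missing at random with response probability `π(φ₀; x)`, and `E U(θ₀; x, y) = 0`, where
`ζ₀ = (φ₀, θ₀)`. -/
structure Model.Sampling (M : Model 𝒳 𝒴 q k) (P : Measure Ω) (W : ℕ → Ω → 𝒳 × 𝒴 × Bool)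
    (ζ₀ : Par q k) : Prop where
  measurable : ∀ i, Measurable (W i)
  indep : iIndepFun W P
  ident : ∀ i, IdentDistrib (W i) (W 0) P P
  response : ∀ i,
    P[fun ω => if (W i ω).2.2 then (1 : ℝ) else 0 |
        MeasurableSpace.comap (fun ω => ((W i ω).1, (W i ω).2.1)) inferInstance]
      =ᵐ[P] fun ω => M.prob ζ₀.phi (W i ω).1
  integrable_target : Integrable (fun ω => M.est ζ₀.theta (W 0 ω).1 (W 0 ω).2.1) P
  target : ∫ ω, M.est ζ₀.theta (W 0 ω).1 (W 0 ω).2.1 ∂P = 0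

/-! ### Regularity conditions

`U n ω ζ` stands for `U_n(ζ)`, `Z` for the parameter space and `N n` for the ball `N_n(ζ₀)`. -/

/-- `sup_{ζ ∈ Z} ‖U_n(ζ) - η(ζ)‖ → 0` in probability. -/
def UniformLimit (P : Measure Ω) (U : ℕ → Ω → Par q k → Par q k) (η : Par q k → Par q k)
    (Z : Set (Par q k)) : Prop :=
  ∀ ε : ℝ, 0 < ε → WithProbToOne P (fun n ω => ∀ ζ ∈ Z, ‖U n ω ζ - η ζ‖ < ε)

/-- With probability tending to one, `U_n` is continuous with exactly one zero, namely `ζ̂`. -/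
def UniqueEstimate (P : Measure Ω) (U : ℕ → Ω → Par q k → Par q k) (Z : Set (Par q k))
    (ζhat : ℕ → Ω → Par q k) : Prop :=
  WithProbToOne P (fun n ω => ContinuousOn (U n ω) Z ∧ ζhat n ω ∈ Z ∧ U n ω (ζhat n ω) = 0 ∧
    ∀ ζ ∈ Z, U n ω ζ = 0 → ζ = ζhat n ω)

/-- `η(ζ) = 0` has exactly one root in `Z`, namely `ζ₀`. -/
def UniqueRoot (η : Par q k → Par q k) (Z : Set (Par q k)) (ζ₀ : Par q k) : Prop :=
  ζ₀ ∈ Z ∧ ∀ ζ ∈ Z, η ζ = 0 ↔ ζ = ζ₀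

/-- On `N_n`, with probability tending to one, `U_n` is continuously differentiable and all entries
of its second derivative exist (are finite); its Jacobian converges uniformly, in probability, to a
non-stochastic non-singular limit. -/
def SmoothEquations (P : Measure Ω) (U : ℕ → Ω → Par q k → Par q k) (N : ℕ → Set (Par q k)) :
    Prop :=
  WithProbToOne P (fun n ω => ContDiffOn ℝ 1 (U n ω) (N n)) ∧
  (∃ G : Par q k → (Par q k →L[ℝ] Par q k),
    (∀ᶠ n in atTop, ∀ ζ ∈ N n, (G ζ).det ≠ 0) ∧
    ∀ ε : ℝ, 0 < ε → WithProbToOne P (fun n ω => ∀ ζ ∈ N n, ‖fderiv ℝ (U n ω) ζ - G ζ‖ < ε)) ∧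
  WithProbToOne P (fun n ω => ∀ ζ ∈ N n, ∀ j a b,
    LineDifferentiableAt ℝ
      (fun z => (fderiv ℝ (U n ω) z (EuclideanSpace.single a 1)) j) ζ (EuclideanSpace.single b 1))

/-- For `ζ ∈ N_n`, `√n (U_n(ζ) - η(ζ))` is asymptotically `N(0, Σ(ζ))`, where `Σ(ζ)` is positive
definite and is the (finite) variance of `√n U_n(ζ)`. -/
def Model.AsympNormal (M : Model 𝒳 𝒴 q k) (P : Measure Ω) [IsProbabilityMeasure P]
    (W : ℕ → Ω → 𝒳 × 𝒴 × Bool) (N : ℕ → Set (Par q k)) : Prop :=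
  ∀ᶠ n in atTop, ∀ ζ ∈ N n,
    MemLp (fun ω => M.unitFun ζ (W 0 ω)) 2 P ∧ (M.Sig P W ζ).PosDef ∧
    TendstoInDistribution (fun (m : ℕ) ω => Real.sqrt m • (M.Un W m ω ζ - M.eta P W ζ)) atTop id
      (fun _ => P) (multivariateGaussian 0 (M.Sig P W ζ))

/-- The prior density of `η` is positive and Lipschitz continuous on the parameter space `H` of
`η`, which is a neighbourhood of `0`. The flat prior is allowed. -/
def PriorRegular (prior : Par q k → ℝ) (H : Set (Par q k)) : Prop :=
  MeasurableSet H ∧ H ∈ 𝓝 0 ∧ (∀ e ∈ H, 0 < prior e) ∧ ∃ K, LipschitzOnWith K prior H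

/-- The symmetric matrices `Σ̂(ζ)` are consistent for `Σ(ζ)`, uniformly on `N_n`. -/
def ConsistentVariance (P : Measure Ω)
    (S : Par q k → Matrix (Fin q ⊕ Fin k) (Fin q ⊕ Fin k) ℝ)
    (Shat : ℕ → Ω → Par q k → Matrix (Fin q ⊕ Fin k) (Fin q ⊕ Fin k) ℝ)
    (N : ℕ → Set (Par q k)) : Prop :=
  (∀ n ω ζ, (Shat n ω ζ).IsSymm) ∧
  ∀ ε : ℝ, 0 < ε → WithProbToOne P (fun n ω => ∀ ζ ∈ N n, ∀ a b, |Shat n ω ζ a b - S ζ a b| < ε)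

/-- On `N_n`, `|Σ(ζ)|⁻¹` is Lipschitz and `x' Σ(ζ)⁻¹ x` is Lipschitz with a constant `C(x)` that is
itself locally Lipschitz in `x`. -/
def LipschitzVariance (S : Par q k → Matrix (Fin q ⊕ Fin k) (Fin q ⊕ Fin k) ℝ)
    (N : ℕ → Set (Par q k)) : Prop :=
  (∃ K, ∀ᶠ n in atTop, LipschitzOnWith K (fun ζ => ((S ζ).det)⁻¹) (N n)) ∧
  ∃ C : Par q k → ℝ, LocallyLipschitz C ∧ ∀ᶠ n in atTop, ∀ ζ₁ ∈ N n, ∀ ζ₂ ∈ N n, ∀ x,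
    |quadForm (S ζ₁)⁻¹ x - quadForm (S ζ₂)⁻¹ x| ≤ C x * ‖ζ₁ - ζ₂‖

/-- On `N_n`, `U_n` is one-to-one with probability tending to one, and `η` is one-to-one and
Lipschitz. -/
def OneToOne (P : Measure Ω) (U : ℕ → Ω → Par q k → Par q k) (η : Par q k → Par q k)
    (N : ℕ → Set (Par q k)) : Prop :=
  WithProbToOne P (fun n ω => Set.InjOn (U n ω) (N n)) ∧
  (∀ᶠ n in atTop, Set.InjOn η (N n)) ∧
  ∃ K, ∀ᶠ n in atTop, LipschitzOnWith K η (N n)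

/-! ### Posterior distributions -/

/-- The posterior distribution of `η` given `U_n = 0`, for the likelihood `U_n | η ∼ N(η, S / n)`
and the prior density `prior` on `H`. -/
def etaPosterior (S : Matrix (Fin q ⊕ Fin k) (Fin q ⊕ Fin k) ℝ) (prior : Par q k → ℝ)
    (H : Set (Par q k)) (n : ℕ) : Measure (Par q k) :=
  let m : Measure (Par q k) := (volume.restrict H).withDensity
    (fun e => ENNReal.ofReal (normalDensity e ((n : ℝ)⁻¹ • S) 0 * prior e))
  (m Set.univ)⁻¹ • m

/-- The distribution from which `η*` is drawn: `N(0, Σ̂ / n)`. -/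
def drawLaw (Shat : Matrix (Fin q ⊕ Fin k) (Fin q ⊕ Fin k) ℝ) (n : ℕ) : Measure (Par q k) :=
  multivariateGaussian 0 ((n : ℝ)⁻¹ • Shat)

/-- `solve` solves the equation `Un ζ = e` for `ζ` in the parameter space `Z`, for every `e` for
which there is a solution; if there is one in the neighbourhood `N`, then `solve e` lies there. -/
structure IsSolver (Un : Par q k → Par q k) (Z N : Set (Par q k)) (law : Measure (Par q k))
    (solve : Par q k → Par q k) : Prop where
  mem : ∀ e ∈ Un '' Z, solve e ∈ Z
  eq : ∀ e ∈ Un '' Z, Un (solve e) = e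
  mem_nhd : ∀ e ∈ Un '' (Z ∩ N), solve e ∈ N
  aemeasurable : AEMeasurable solve (law.restrict (Un '' Z))

/-- The distribution of `ζ*` in the two-step method: draw `η*` from `law`, then solve
`Un ζ* = η*`. Draws for which there is no solution in `Z` are discarded. -/
def twoStep (Un : Par q k → Par q k) (Z : Set (Par q k)) (law : Measure (Par q k))
    (solve : Par q k → Par q k) : Measure (Par q k) :=
  (ProbabilityTheory.cond law (Un '' Z)).map solve

/-- `p` is the version of the Lebesgue density of `post` that is continuous on `N`. -/
structure IsDensity (post : Measure (Par q k)) (N : Set (Par q k)) (p : Par q k → ℝ) :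
    Prop where
  measurable : Measurable p
  nonneg : ∀ ζ, 0 ≤ p ζ
  ae_eq : p =ᵐ[volume] fun ζ => (post.rnDeriv volume ζ).toReal
  continuousOn : ContinuousOn p N

/-- The highest posterior density region of content `1 - α`: the set `{p ≥ k}` for the largest `k`
for which it has posterior probability (at least) `1 - α`. -/
def hpdRegion (post : Measure (Par q k)) (p : Par q k → ℝ) (α : ℝ) : Set (Par q k) :=
  {ζ | sSup {t : ℝ | 1 - α ≤ post.real {z | t ≤ p z}} ≤ p ζ}

/-- `c` is the `1 - α` quantile of the chi-square distribution with `q + k` degrees of freedom, the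
distribution of `‖x‖²` for a standard normal vector `x`. -/
def IsChiSqQuantile (q k : ℕ) (α c : ℝ) : Prop :=
  (stdGaussian (Par q k)).real {x | ‖x‖ ^ 2 ≤ c} = 1 - α

/-- The frequentist confidence region `{ζ : (ζ - m)' V⁻¹ (ζ - m) ≤ c}`. -/
def waldRegion (m : Par q k) (V : Matrix (Fin q ⊕ Fin k) (Fin q ⊕ Fin k) ℝ) (c : ℝ) :
    Set (Par q k) :=
  {ζ | quadForm V⁻¹ (ζ - m) ≤ c}

end

end BayesPS

end

/-!
The argument is a local linearization of the estimating equations, carried out on the shrinking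
balls `N_n(ζ₀)`, whose radius `r n` tends to zero but is large compared with `n^{-1/2}`.

*Frequentist part.* The uniform limit of the Jacobians of `U_n` is continuous at `ζ₀`, so on `N_n`
they converge to one non-singular linear map `G` (`SmoothEquations.exists_limit`), and `U_n` is
there, up to a small relative error, the affine map with slope `G`. Chebyshev's inequality gives
`U_n(ζ₀) = o(r_n)`; hence a quantitative inverse function theorem shows that `U_n` attains on `N_n`
all values up to the order `r_n`, in particular the value zero, and the unique estimate `ζ̂` lies
close to the centre of `N_n` (`exists_closedBall_subset_image`). Transferring the linear
approximation of `U_n` to its mean shows that `η` has at `ζ₀` the derivative `G`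
(`Model.hasFDerivAt_eta`), so that `G` is the matrix `A(ζ₀)` of the linearization variance. All this
is collected in the structure `Linearized`.

*Bayesian part.* By change of variables the law of `ζ*` has on `N_n` the density
`φ_{0, Σ̂ / n}(U_n(ζ)) |det U_n'(ζ)|`, up to normalization. Replacing `U_n(ζ)` by `G (ζ - ζ̂)`, the
Jacobian by `G` and `Σ̂` by `Σ(ζ₀)` changes the logarithm of this density by at most `ε (1 + Q(ζ))`,
with `Q` the quadratic form in the exponent of the density of `N(ζ̂, Var(ζ̂))`
(`NearNormal`, `Linearized.asympNormalPosterior`). Since `Q` is bounded, with probability close to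
one, under the normal law, this relative approximation yields convergence in total variation,
uniform convergence of the density ratio on ellipsoids, and consistency. Moreover the superlevel
sets of the posterior density are squeezed between ellipsoids `{Q ≤ c ± 3 δ}`
(`AsympNormalPosterior.hpdRegion_bounds`), which gives the content and the volume of the highest
posterior density region. The posterior of `η` is close to the normal law of the draw because the
prior is nearly constant where the likelihood is concentrated (`etaPosterior_tvLe`).

*Coverage.* The Wald statistic `Q(ζ₀)` differs by a small relative error from the quadratic form
`n U_n(ζ₀)' Σ(ζ₀)⁻¹ U_n(ζ₀)`, which is asymptotically chi-square by the central limit condition at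
`ζ₀`; both regions contain `ζ₀` if `Q(ζ₀) ≤ c - 3 δ` and omit it if `Q(ζ₀) > c + 3 δ`, with
probability tending to one.

Convergence in probability is expressed throughout by the filter `inProb P` on `ℕ × Ω`, along which
an event holds eventually if its probability tends to one.
-/

namespace BayesPS

/-! ### The filter of events of probability tending to one -/

/-- The filter on `ℕ × Ω` of the (sequences of) events whose probability tends to one. -/
def inProb {Ω : Type*} [MeasurableSpace Ω] (P : Measure Ω) : Filter (ℕ × Ω) where
  sets := {S | Tendsto (fun n => P {ω | (n, ω) ∉ S}) atTop (𝓝 0)}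
  univ_sets := by simp
  sets_of_superset := by
    intro S T hS hST
    exact tendsto_of_tendsto_of_tendsto_of_le_of_le tendsto_const_nhds hS (fun _ => zero_le)
      (fun n => measure_mono fun ω hω h => hω (hST h))
  inter_sets := by
    intro S T hS hT
    have h : Tendsto (fun n => P {ω | (n, ω) ∉ S} + P {ω | (n, ω) ∉ T}) atTop (𝓝 0) := by
      simpa using Tendsto.add (show Tendsto _ _ _ from hS) (show Tendsto _ _ _ from hT)
    refine tendsto_of_tendsto_of_tendsto_of_le_of_le tendsto_const_nhds h (fun _ => zero_le)
      (fun n => le_trans (measure_mono ?_) (measure_union_le _ _))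
    intro ω hω
    simp only [Set.mem_inter_iff, not_and_or, Set.mem_ofPred_eq] at hω
    exact hω

section inProb

variable {Ω : Type*} [MeasurableSpace Ω] {P : Measure Ω}

lemma withProbToOne_iff {A : ℕ → Ω → Prop} :
    WithProbToOne P A ↔ ∀ᶠ z in inProb P, A z.1 z.2 := Iff.rfl

lemma eventually_inProb {A : ℕ × Ω → Prop} :
    (∀ᶠ z in inProb P, A z) ↔ Tendsto (fun n => P {ω | ¬ A (n, ω)}) atTop (𝓝 0) := Iff.rfl

lemma tendsto_fst_inProb : Tendsto Prod.fst (inProb P) (atTop : Filter ℕ) := by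
  refine tendsto_def.2 fun s hs => ?_
  change Tendsto (fun n => P {ω | (n, ω) ∉ Prod.fst ⁻¹' s}) atTop (𝓝 0)
  refine tendsto_const_nhds.congr' ?_
  filter_upwards [hs] with n hn
  simp [hn]

instance [IsProbabilityMeasure P] : (inProb P).NeBot := by
  refine ⟨fun h => ?_⟩
  have h0 : (∅ : Set (ℕ × Ω)) ∈ inProb P := by simp [h]
  have h1 : Tendsto (fun n : ℕ => P {ω | (n, ω) ∉ (∅ : Set (ℕ × Ω))}) atTop (𝓝 0) := h0
  simp only [Set.mem_empty_iff_false, not_false_eq_true, Set.ofPred_true, measure_univ] at h1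
  have h2 := tendsto_nhds_unique tendsto_const_nhds h1
  simp at h2

lemma tendsInProb_iff {x : ℕ → Ω → ℝ} {c : ℝ} :
    TendsInProb P x c ↔ Tendsto (fun z : ℕ × Ω => x z.1 z.2) (inProb P) (𝓝 c) := by
  simp only [Metric.tendsto_nhds, TendsInProb, withProbToOne_iff, Real.dist_eq]

end inProb

/-! ### Total variation -/

/-- The total variation distance of `μ` and `ν` is at most the real number `d`. -/
def TVLe {E : Type*} [MeasurableSpace E] (μ ν : Measure E) (d : ℝ) : Prop :=
  ∀ B, MeasurableSet B → |μ.real B - ν.real B| ≤ d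

section TVLe

variable {E : Type*} [MeasurableSpace E] {μ ν ρ : Measure E} {d e : ℝ}

lemma TVLe.tvDist_le (h : TVLe μ ν d) : tvDist μ ν ≤ ENNReal.ofReal d :=
  iSup₂_le fun B hB => ENNReal.ofReal_le_ofReal (h B hB)

lemma TVLe.symm (h : TVLe μ ν d) : TVLe ν μ d := fun B hB => by
  rw [abs_sub_comm]; exact h B hB

lemma TVLe.trans (h : TVLe μ ν d) (h' : TVLe ν ρ e) : TVLe μ ρ (d + e) := fun B hB =>
  (abs_sub_le _ (ν.real B) _).trans (add_le_add (h B hB) (h' B hB))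

lemma TVLe.mono (h : TVLe μ ν d) (hde : d ≤ e) : TVLe μ ν e := fun B hB => (h B hB).trans hde

/-- Closeness on the subsets of a set that carries almost all the mass of one of two probability
measures implies closeness in total variation. -/
lemma TVLe.of_subset [IsProbabilityMeasure μ] [IsProbabilityMeasure ν] {C : Set E}
    (hC : MeasurableSet C) (h : ∀ B, MeasurableSet B → B ⊆ C → |μ.real B - ν.real B| ≤ d)
    (hν : 1 - e ≤ ν.real C) : TVLe μ ν (2 * d + e) := by
  intro B hB
  have h1 := abs_le.1 (h (B ∩ C) (hB.inter hC) Set.inter_subset_right)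
  have h2 := abs_le.1 (h C hC subset_rfl)
  have hμB := measureReal_inter_add_sdiff (μ := μ) (s := B) hC
  have hνB := measureReal_inter_add_sdiff (μ := ν) (s := B) hC
  have hμC := probReal_compl_eq_one_sub (μ := μ) hC
  have hνC := probReal_compl_eq_one_sub (μ := ν) hC
  have h3 : μ.real (B \ C) ≤ μ.real Cᶜ := measureReal_mono (fun x hx => hx.2)
  have h4 : ν.real (B \ C) ≤ ν.real Cᶜ := measureReal_mono (fun x hx => hx.2)
  have h5 : 0 ≤ μ.real (B \ C) := measureReal_nonneg
  have h6 : 0 ≤ ν.real (B \ C) := measureReal_nonneg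
  rw [abs_le]
  constructor <;> linarith

lemma eventually_tvDist_lt {α : Type*} {l : Filter α} {μ ν : α → Measure E}
    (h : ∀ d : ℝ, 0 < d → ∀ᶠ z in l, TVLe (μ z) (ν z) d) {ε : ℝ≥0∞} (hε : 0 < ε) :
    ∀ᶠ z in l, tvDist (μ z) (ν z) < ε := by
  obtain ⟨d, hd, hdε⟩ := ENNReal.lt_iff_exists_nnreal_btwn.1 hε
  have hd' : (0 : ℝ) < d := by exact_mod_cast hd
  filter_upwards [h d hd'] with z hz
  exact (hz.tvDist_le.trans (by simp)).trans_lt hdε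

end TVLe

/-! ### Quadratic forms -/

section quadForm

variable {ι : Type*} [Fintype ι] {S T : Matrix ι ι ℝ}

@[fun_prop]
lemma continuous_quadForm (S : Matrix ι ι ℝ) : Continuous (quadForm S) := by
  unfold quadForm Matrix.mulVec dotProduct
  fun_prop

lemma quadForm_sub (S T : Matrix ι ι ℝ) (x : EuclideanSpace ℝ ι) :
    quadForm (S - T) x = quadForm S x - quadForm T x := by
  simp [quadForm, Matrix.sub_mulVec, dotProduct_sub]

lemma quadForm_smul (c : ℝ) (S : Matrix ι ι ℝ) (x : EuclideanSpace ℝ ι) :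
    quadForm (c • S) x = c * quadForm S x := by
  simp [quadForm, Matrix.smul_mulVec, dotProduct_smul]

lemma quadForm_smul_right (c : ℝ) (S : Matrix ι ι ℝ) (x : EuclideanSpace ℝ ι) :
    quadForm S (c • x) = c ^ 2 * quadForm S x := by
  simp only [quadForm, WithLp.ofLp_smul, Matrix.mulVec_smul, dotProduct_smul, smul_dotProduct,
    smul_eq_mul]
  ring

lemma quadForm_neg (S : Matrix ι ι ℝ) (x : EuclideanSpace ℝ ι) :
    quadForm S (-x) = quadForm S x := by
  simpa using quadForm_smul_right (-1) S x

@[simp]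
lemma quadForm_zero_right (S : Matrix ι ι ℝ) : quadForm S 0 = 0 := by simp [quadForm]

lemma quadForm_nonneg (hS : S.PosSemidef) (x : EuclideanSpace ℝ ι) : 0 ≤ quadForm S x := by
  simpa [quadForm] using hS.dotProduct_mulVec_nonneg x.ofLp

lemma abs_dotProduct_mulVec_le (S : Matrix ι ι ℝ) (x y : EuclideanSpace ℝ ι) :
    |x.ofLp ⬝ᵥ (S *ᵥ y.ofLp)| ≤ (∑ a, ∑ b, |S a b|) * (‖x‖ * ‖y‖) := by
  simp only [dotProduct, Matrix.mulVec, Finset.mul_sum, Finset.sum_mul]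
  refine (Finset.abs_sum_le_sum_abs _ _).trans (Finset.sum_le_sum fun a _ => ?_)
  refine (Finset.abs_sum_le_sum_abs _ _).trans (Finset.sum_le_sum fun b _ => ?_)
  have h1 : |x a| ≤ ‖x‖ := PiLp.norm_apply_le x a
  have h2 : |y b| ≤ ‖y‖ := PiLp.norm_apply_le y b
  calc |x a * (S a b * y b)| = |S a b| * (|x a| * |y b|) := by
        rw [abs_mul, abs_mul]; ring
    _ ≤ _ := by gcongr

lemma abs_quadForm_le (S : Matrix ι ι ℝ) (x : EuclideanSpace ℝ ι) :
    |quadForm S x| ≤ (∑ a, ∑ b, |S a b|) * ‖x‖ ^ 2 := by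
  rw [pow_two]; exact abs_dotProduct_mulVec_le S x x

lemma abs_quadForm_sub_le (S : Matrix ι ι ℝ) (x y : EuclideanSpace ℝ ι) :
    |quadForm S x - quadForm S y| ≤ (∑ a, ∑ b, |S a b|) * (‖x - y‖ * (‖x‖ + ‖y‖)) := by
  have h : quadForm S x - quadForm S y =
      (x - y).ofLp ⬝ᵥ (S *ᵥ x.ofLp) + y.ofLp ⬝ᵥ (S *ᵥ (x - y).ofLp) := by
    simp only [quadForm, WithLp.ofLp_sub, Matrix.mulVec_sub, dotProduct_sub, sub_dotProduct]
    ring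
  rw [h]
  refine (abs_add_le _ _).trans ((add_le_add (abs_dotProduct_mulVec_le S _ _)
    (abs_dotProduct_mulVec_le S _ _)).trans (le_of_eq ?_))
  ring

/-- A positive definite quadratic form is bounded below by a multiple of `‖x‖²`. -/
lemma exists_le_quadForm (hS : S.PosDef) :
    ∃ κ : ℝ, 0 < κ ∧ ∀ x, κ * ‖x‖ ^ 2 ≤ quadForm S x := by
  have hpos : ∀ x : EuclideanSpace ℝ ι, x ≠ 0 → 0 < quadForm S x := fun x hx => by
    simpa [quadForm] using hS.dotProduct_mulVec_pos (x := x.ofLp) (by simpa using hx)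
  rcases (Metric.sphere (0 : EuclideanSpace ℝ ι) 1).eq_empty_or_nonempty with he | hne
  · refine ⟨1, one_pos, fun x => ?_⟩
    have hx : x = 0 := by
      by_contra hx
      have : ‖x‖⁻¹ • x ∈ Metric.sphere (0 : EuclideanSpace ℝ ι) 1 := by
        simp [norm_smul, hx]
      rw [he] at this
      exact this
    simp [hx]
  · obtain ⟨u, hu, hmin⟩ := (isCompact_sphere (0 : EuclideanSpace ℝ ι) 1).exists_isMinOn hne
      (continuous_quadForm S).continuousOn
    refine ⟨quadForm S u, hpos u (by rintro rfl; simp at hu), fun x => ?_⟩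
    rcases eq_or_ne x 0 with rfl | hx
    · simp
    · have h1 : ‖x‖⁻¹ • x ∈ Metric.sphere (0 : EuclideanSpace ℝ ι) 1 := by
        simp [norm_smul, hx]
      have h2 : quadForm S u ≤ quadForm S (‖x‖⁻¹ • x) := hmin h1
      have h3 : (0 : ℝ) < ‖x‖ ^ 2 := by positivity
      rw [quadForm_smul_right, inv_pow, inv_mul_eq_div, le_div_iff₀ h3] at h2
      exact h2

lemma posDef_of_le_quadForm (hS : S.IsSymm) {κ : ℝ} (hκ : 0 < κ)
    (h : ∀ x, κ * ‖x‖ ^ 2 ≤ quadForm S x) : S.PosDef := by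
  refine Matrix.PosDef.of_dotProduct_mulVec_pos (by simpa [Matrix.IsHermitian] using hS.eq) ?_
  intro x hx
  have h1 := h (WithLp.toLp 2 x)
  have h2 : 0 < ‖(WithLp.toLp 2 x : EuclideanSpace ℝ ι)‖ := by simpa using hx
  have h3 : 0 < κ * ‖(WithLp.toLp 2 x : EuclideanSpace ℝ ι)‖ ^ 2 := by positivity
  simpa [quadForm] using h3.trans_le h1

lemma tendsto_sum_abs_sub (S₀ : Matrix ι ι ℝ) :
    Tendsto (fun S : Matrix ι ι ℝ => ∑ a, ∑ b, |(S - S₀) a b|) (𝓝 S₀) (𝓝 0) := by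
  have h : Continuous (fun S : Matrix ι ι ℝ => ∑ a, ∑ b, |(S - S₀) a b|) := by
    simp only [Matrix.sub_apply]
    fun_prop
  simpa using h.tendsto S₀

/-- Quadratic forms depend continuously on the matrix, uniformly relative to `‖x‖²`. -/
lemma eventually_abs_quadForm_sub_le (S₀ : Matrix ι ι ℝ) {ε : ℝ} (hε : 0 < ε) :
    ∀ᶠ S in 𝓝 S₀, ∀ x, |quadForm S x - quadForm S₀ x| ≤ ε * ‖x‖ ^ 2 := by
  filter_upwards [(tendsto_sum_abs_sub S₀).eventually (gt_mem_nhds hε)] with S hS x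
  rw [← quadForm_sub]
  exact (abs_quadForm_le _ x).trans (by gcongr)

lemma eventually_posDef (hS : S.PosDef) : ∀ᶠ T in 𝓝 S, T.IsSymm → T.PosDef := by
  obtain ⟨κ, hκ, h⟩ := exists_le_quadForm hS
  filter_upwards [eventually_abs_quadForm_sub_le S (half_pos hκ)] with T hT hsymm
  refine posDef_of_le_quadForm hsymm (half_pos hκ) fun x => ?_
  have h1 := h x
  have h2 := (abs_le.1 (hT x)).1
  linarith

/-- A symmetric matrix is determined by its quadratic form, continuously. -/
lemma tendsto_of_tendsto_quadForm [DecidableEq ι] {α : Type*} {l : Filter α}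
    {M : α → Matrix ι ι ℝ} {M₀ : Matrix ι ι ℝ} (hM : ∀ᶠ z in l, (M z).IsSymm) (hM₀ : M₀.IsSymm)
    (h : ∀ x, Tendsto (fun z => quadForm (M z) x) l (𝓝 (quadForm M₀ x))) :
    Tendsto M l (𝓝 M₀) := by
  have key : ∀ N : Matrix ι ι ℝ, N.IsSymm → ∀ a b, N a b = (1 / 2) *
      (quadForm N (EuclideanSpace.single a 1 + EuclideanSpace.single b 1)
        - quadForm N (EuclideanSpace.single a 1) - quadForm N (EuclideanSpace.single b 1)) := by
    intro N hN a b
    have := hN.apply a b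
    simp only [quadForm, WithLp.ofLp_add, PiLp.ofLp_single, Matrix.mulVec_add,
      Matrix.mulVec_single_one, add_dotProduct, dotProduct_add, single_dotProduct, one_mul,
      Matrix.col_apply]
    rw [this]; ring
  refine tendsto_pi_nhds.2 fun a => tendsto_pi_nhds.2 fun b => ?_
  rw [key M₀ hM₀ a b]
  refine Tendsto.congr' ?_ ((((h _).sub (h _)).sub (h _)).const_mul _)
  filter_upwards [hM] with z hz
  exact (key _ hz a b).symm

end quadForm

section inverse

variable {ι : Type*} [Fintype ι] [DecidableEq ι] {S : Matrix ι ι ℝ}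

lemma continuousAt_matrix_inv (hS : S.det ≠ 0) :
    ContinuousAt (fun T : Matrix ι ι ℝ => T⁻¹) S := by
  simp only [Matrix.inv_def, Ring.inverse_eq_inv']
  have h1 : ContinuousAt (fun T : Matrix ι ι ℝ => T.det) S :=
    (Continuous.matrix_det continuous_id).continuousAt
  exact (h1.inv₀ hS).smul (Continuous.matrix_adjugate continuous_id).continuousAt

/-- The form `x' S⁻¹ x` is continuous in `S`, uniformly in `x` and in the relative sense. -/
lemma eventually_abs_quadForm_inv_sub_le (hS : S.PosDef) {ε : ℝ} (hε : 0 < ε) :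
    ∀ᶠ T in 𝓝 S, ∀ x, |quadForm T⁻¹ x - quadForm S⁻¹ x| ≤ ε * quadForm S⁻¹ x := by
  obtain ⟨κ, hκ, h⟩ := exists_le_quadForm hS.inv
  filter_upwards [(continuousAt_matrix_inv hS.det_pos.ne').eventually
    (eventually_abs_quadForm_sub_le S⁻¹ (mul_pos hε hκ))] with T hT x
  refine (hT x).trans ?_
  rw [mul_assoc]
  exact mul_le_mul_of_nonneg_left (h x) hε.le

end inverse

/-! ### Normal distributions -/

section Gaussian

variable {ι : Type*} [Fintype ι]

lemma stdGaussian_eq_withDensity :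
    stdGaussian (EuclideanSpace ℝ ι) = volume.withDensity (fun x =>
      ENNReal.ofReal ((√((2 * Real.pi) ^ Fintype.card ι))⁻¹ * Real.exp (-(1 / 2) * ‖x‖ ^ 2))) := by
  set f : EuclideanSpace ℝ ι → ℝ := fun x =>
    (√((2 * Real.pi) ^ Fintype.card ι))⁻¹ * Real.exp (-(1 / 2) * ‖x‖ ^ 2) with hf
  have hf0 : ∀ x, 0 ≤ f x := fun x => by positivity
  have hfm : Measurable f := by fun_prop
  have hint : Integrable f := by
    refine Integrable.const_mul ?_ _
    have h := GaussianFourier.integral_rexp_neg_mul_sq_norm (V := EuclideanSpace ℝ ι)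
      (b := 1 / 2) (by norm_num)
    -- the integral of a function that is not integrable would be zero
    by_contra hcon
    rw [integral_undef hcon] at h
    exact (Real.rpow_pos_of_pos (by positivity) _).ne h
  have hfin := isFiniteMeasure_withDensity_ofReal hint.2
  refine Measure.ext_of_charFun ?_
  ext t
  rw [charFun_stdGaussian, charFun_apply, integral_withDensity_eq_integral_toReal_smul
    (by fun_prop) (Eventually.of_forall fun _ => ENNReal.ofReal_lt_top)]
  have h := GaussianFourier.integral_cexp_neg_mul_sq_norm_add (V := EuclideanSpace ℝ ι)
    (b := 1 / 2) (by norm_num) Complex.I t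
  have h2 : ∀ x : EuclideanSpace ℝ ι, (ENNReal.ofReal (f x)).toReal •
      Complex.exp (inner ℝ x t * Complex.I) = ((√((2 * Real.pi) ^ Fintype.card ι))⁻¹ : ℝ) *
      Complex.exp (-(1 / 2) * ‖x‖ ^ 2 + Complex.I * inner ℝ t x) := by
    intro x
    rw [ENNReal.toReal_ofReal (hf0 x), Complex.real_smul, Complex.exp_add, hf]
    push_cast
    rw [real_inner_comm, mul_comm Complex.I]
    ring
  rw [integral_congr_ae (Eventually.of_forall h2), integral_const_mul, h, finrank_euclideanSpace]
  have h3 : ((√((2 * Real.pi) ^ Fintype.card ι))⁻¹ : ℝ) *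
      ((Real.pi : ℂ) / (1 / 2)) ^ ((Fintype.card ι : ℂ) / 2) = 1 := by
    have h4 : ((Real.pi : ℂ) / (1 / 2)) ^ ((Fintype.card ι : ℂ) / 2)
        = ((√((2 * Real.pi) ^ Fintype.card ι) : ℝ) : ℂ) := by
      rw [Real.sqrt_eq_rpow, ← Real.rpow_natCast, ← Real.rpow_mul (by positivity),
        Complex.ofReal_cpow (by positivity)]
      push_cast
      congr 1 <;> ring
    rw [h4, ← Complex.ofReal_mul, inv_mul_cancel₀ (by positivity), Complex.ofReal_one]
  rw [← mul_assoc, h3, one_mul, Complex.I_sq]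
  congr 1
  ring

lemma stdGaussian_ac : stdGaussian (EuclideanSpace ℝ ι) ≪ volume := by
  rw [stdGaussian_eq_withDensity]
  exact withDensity_absolutelyContinuous _ _

lemma ac_stdGaussian : (volume : Measure (EuclideanSpace ℝ ι)) ≪ stdGaussian _ := by
  rw [stdGaussian_eq_withDensity]
  exact withDensity_absolutelyContinuous' (by fun_prop) (Eventually.of_forall fun x =>
    (ENNReal.ofReal_pos.2 (by positivity)).ne')

variable (ι) in
/-- The distribution function of `‖x‖²` for a standard normal vector `x`: the chi-square
distribution function. -/
noncomputable def chiSqCDF (s : ℝ) : ℝ :=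
  (stdGaussian (EuclideanSpace ℝ ι)).real {x | ‖x‖ ^ 2 ≤ s}

lemma measurableSet_norm_sq_le (s : ℝ) :
    MeasurableSet {x : EuclideanSpace ℝ ι | ‖x‖ ^ 2 ≤ s} :=
  (isClosed_le (by fun_prop) continuous_const).measurableSet

lemma chiSqCDF_eq_integral (s : ℝ) : chiSqCDF ι s =
    ∫ x, {x : EuclideanSpace ℝ ι | ‖x‖ ^ 2 ≤ s}.indicator 1 x ∂stdGaussian _ := by
  rw [integral_indicator_one (measurableSet_norm_sq_le s), chiSqCDF]

lemma chiSqCDF_mono : Monotone (chiSqCDF ι) := fun _ _ hst =>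
  measureReal_mono fun _ hx => le_trans hx hst

lemma stdGaussian_norm_sq_eq [Nonempty ι] (s : ℝ) :
    stdGaussian (EuclideanSpace ℝ ι) {x | ‖x‖ ^ 2 = s} = 0 := by
  refine stdGaussian_ac (measure_mono_null ?_
    (Measure.addHaar_sphere volume (0 : EuclideanSpace ℝ ι) (√s)))
  intro x (hx : ‖x‖ ^ 2 = s)
  simp [← hx]

lemma continuous_chiSqCDF [Nonempty ι] : Continuous (chiSqCDF ι) := by
  refine continuous_iff_continuousAt.2 fun s => ?_
  rw [funext (chiSqCDF_eq_integral (ι := ι))]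
  refine continuousAt_of_dominated (bound := fun _ => 1) ?_ ?_ (integrable_const _) ?_
  · exact Eventually.of_forall fun t =>
      ((measurable_one.indicator (measurableSet_norm_sq_le t)).aestronglyMeasurable)
  · refine Eventually.of_forall fun t => Eventually.of_forall fun x => ?_
    exact (norm_indicator_le_norm_self _ _).trans (by simp)
  · have h : ∀ᵐ x ∂stdGaussian (EuclideanSpace ℝ ι), ‖x‖ ^ 2 ≠ s := by
      rw [ae_iff]
      simpa using stdGaussian_norm_sq_eq s
    filter_upwards [h] with x hx
    rcases lt_or_gt_of_ne hx with hlt | hgt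
    · refine ContinuousAt.congr (continuousAt_const (y := (1 : ℝ))) ?_
      filter_upwards [lt_mem_nhds hlt] with t ht
      simp [Set.indicator, ht.le]
    · refine ContinuousAt.congr (continuousAt_const (y := (0 : ℝ))) ?_
      filter_upwards [gt_mem_nhds hgt] with t ht
      simp [Set.indicator, not_le.2 ht]

variable (ι) in
lemma tendsto_chiSqCDF_atTop : Tendsto (chiSqCDF ι) atTop (𝓝 1) := by
  have hm : Measurable fun x : EuclideanSpace ℝ ι => ‖x‖ ^ 2 := by fun_prop
  have := Measure.isProbabilityMeasure_map (μ := stdGaussian (EuclideanSpace ℝ ι)) hm.aemeasurable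
  have h := tendsto_cdf_atTop ((stdGaussian (EuclideanSpace ℝ ι)).map (fun x => ‖x‖ ^ 2))
  refine h.congr fun s => ?_
  rw [cdf_eq_real, measureReal_def, Measure.map_apply hm measurableSet_Iic]
  rfl

lemma chiSqCDF_zero [Nonempty ι] : chiSqCDF ι 0 = 0 := by
  have h := stdGaussian_norm_sq_eq (ι := ι) 0
  have h2 : {x : EuclideanSpace ℝ ι | ‖x‖ ^ 2 ≤ 0} = {x | ‖x‖ ^ 2 = 0} := by
    ext x
    exact ⟨fun hx => le_antisymm hx (by positivity), fun hx => le_of_eq hx⟩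
  rw [chiSqCDF, h2, measureReal_def, h, ENNReal.toReal_zero]

lemma chiSqCDF_lt [Nonempty ι] {s t : ℝ} (hs : 0 ≤ s) (hst : s < t) :
    chiSqCDF ι s < chiSqCDF ι t := by
  set O := {x : EuclideanSpace ℝ ι | s < ‖x‖ ^ 2 ∧ ‖x‖ ^ 2 < t} with hO
  have hcont : Continuous fun x : EuclideanSpace ℝ ι => ‖x‖ ^ 2 := by fun_prop
  have hopen : IsOpen O :=
    (isOpen_lt continuous_const hcont).inter (isOpen_lt hcont continuous_const)
  have hne : O.Nonempty := by
    obtain ⟨x, hx⟩ := exists_norm_eq (EuclideanSpace ℝ ι) (Real.sqrt_nonneg ((s + t) / 2))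
    refine ⟨x, ?_⟩
    rw [hO, Set.mem_ofPred_eq, hx, Real.sq_sqrt (by linarith)]
    constructor <;> linarith
  have hpos : stdGaussian _ O ≠ 0 := fun h => (hopen.measure_pos volume hne).ne' (ac_stdGaussian h)
  have hpos' : 0 < (stdGaussian _).real O := ENNReal.toReal_pos hpos (measure_ne_top _ _)
  have hdisj : Disjoint {x : EuclideanSpace ℝ ι | ‖x‖ ^ 2 ≤ s} O :=
    Set.disjoint_left.2 fun x hx hx' => not_lt.2 hx hx'.1
  have h := measureReal_union (μ := stdGaussian (EuclideanSpace ℝ ι)) hdisj hopen.measurableSet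
  have hsub : {x : EuclideanSpace ℝ ι | ‖x‖ ^ 2 ≤ s} ∪ O ⊆ {x | ‖x‖ ^ 2 ≤ t} := by
    rintro x (hx | hx)
    · exact le_trans hx hst.le
    · exact hx.2.le
  have h2 := measureReal_mono (μ := stdGaussian (EuclideanSpace ℝ ι)) hsub
  rw [h] at h2
  unfold chiSqCDF
  linarith

open scoped MatrixOrder

variable [DecidableEq ι] {S : Matrix ι ι ℝ}

lemma det_toEuclideanCLM (R : Matrix ι ι ℝ) :
    (Matrix.toEuclideanCLM (𝕜 := ℝ) R).det = R.det := by
  rw [ContinuousLinearMap.det, Matrix.coe_toEuclideanCLM_eq_toEuclideanLin]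
  change LinearMap.det (Matrix.toLpLin 2 2 R) = _
  rw [Matrix.toLpLin_eq_toLin, LinearMap.det_toLin]

lemma det_sqrt_sq (hS : S.PosSemidef) : (CFC.sqrt S).det ^ 2 = S.det := by
  rw [pow_two, ← Matrix.det_mul, CFC.sqrt_mul_sqrt_self S hS.nonneg]

lemma quadForm_inv_sqrt (hS : S.PosDef) (x : EuclideanSpace ℝ ι) :
    quadForm S⁻¹ (Matrix.toEuclideanCLM (𝕜 := ℝ) (CFC.sqrt S) x) = ‖x‖ ^ 2 := by
  set R := CFC.sqrt S with hR
  have hRR : R * R = S := CFC.sqrt_mul_sqrt_self S hS.posSemidef.nonneg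
  have hsymm : Rᵀ = R := by
    have := (CFC.sqrt_nonneg S).isSelfAdjoint.star_eq
    simpa [Matrix.star_eq_conjTranspose] using this
  have hdet : IsUnit R.det := by
    have h1 := det_sqrt_sq hS.posSemidef
    have h2 := hS.det_pos
    refine isUnit_iff_ne_zero.2 fun h => ?_
    rw [← hR, h] at h1
    simp [← h1] at h2
  have hinv : S⁻¹ = R⁻¹ * R⁻¹ := by rw [← hRR, Matrix.mul_inv_rev]
  rw [quadForm, Matrix.ofLp_toEuclideanCLM, Matrix.mulVec_mulVec, hinv, Matrix.mul_assoc,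
    Matrix.nonsing_inv_mul _ hdet, Matrix.mul_one]
  rw [← Matrix.vecMul_transpose, ← Matrix.dotProduct_mulVec, hsymm, Matrix.mulVec_mulVec,
    Matrix.mul_nonsing_inv _ hdet, Matrix.one_mulVec, EuclideanSpace.real_norm_sq_eq]
  simp [dotProduct, pow_two]

/-- Ellipsoids have the chi-square probabilities. -/
lemma multivariateGaussian_quadForm_le (hS : S.PosDef) (m : EuclideanSpace ℝ ι) (s : ℝ) :
    (multivariateGaussian m S).real {x | quadForm S⁻¹ (x - m) ≤ s} = chiSqCDF ι s := by
  have hm : MeasurableSet {x : EuclideanSpace ℝ ι | quadForm S⁻¹ (x - m) ≤ s} :=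
    (isClosed_le (by fun_prop) continuous_const).measurableSet
  rw [multivariateGaussian, measureReal_def, Measure.map_apply (by fun_prop) hm, chiSqCDF,
    measureReal_def]
  congr 2
  ext x
  simp [quadForm_inv_sqrt hS]

@[fun_prop]
lemma continuous_normalDensity (m : EuclideanSpace ℝ ι) (S : Matrix ι ι ℝ) :
    Continuous (normalDensity m S) := by
  unfold normalDensity
  fun_prop

lemma normalDensity_pos (hS : S.PosDef) (m x : EuclideanSpace ℝ ι) : 0 < normalDensity m S x := by
  have := hS.det_pos
  unfold normalDensity
  positivity

lemma normalDensity_nonneg (m : EuclideanSpace ℝ ι) (S : Matrix ι ι ℝ) (x : EuclideanSpace ℝ ι) :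
    0 ≤ normalDensity m S x := by
  unfold normalDensity
  positivity

lemma normalDensity_eq (m : EuclideanSpace ℝ ι) (S : Matrix ι ι ℝ) (x : EuclideanSpace ℝ ι) :
    normalDensity m S x = normalDensity m S m * Real.exp (-(1 / 2) * quadForm S⁻¹ (x - m)) := by
  simp [normalDensity]

lemma multivariateGaussian_eq_withDensity (hS : S.PosDef) (m : EuclideanSpace ℝ ι) :
    multivariateGaussian m S =
      volume.withDensity (fun x => ENNReal.ofReal (normalDensity m S x)) := by
  set L := Matrix.toEuclideanCLM (𝕜 := ℝ) (CFC.sqrt S) with hL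
  have hdetL : |L.det| = √S.det := by
    rw [hL, det_toEuclideanCLM, ← det_sqrt_sq hS.posSemidef, Real.sqrt_sq_eq_abs]
  have hdet0 : L.det ≠ 0 := by
    intro h
    rw [h, abs_zero] at hdetL
    exact (Real.sqrt_pos.2 hS.det_pos).ne hdetL
  set T : EuclideanSpace ℝ ι → EuclideanSpace ℝ ι := fun x => m + L x with hT
  let e := L.toContinuousLinearEquivOfDetNeZero hdet0
  have hinj : Function.Injective T := fun x y hxy => by
    have : L x = L y := add_left_cancel hxy
    exact e.injective this
  have hsurj : Function.Surjective T := fun y => by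
    obtain ⟨x, hx⟩ := e.surjective (y - m)
    refine ⟨x, ?_⟩
    change L x = y - m at hx
    simp [hT, hx]
  ext B hB
  have hTm : Measurable T := by fun_prop
  rw [multivariateGaussian, Measure.map_apply hTm hB, stdGaussian_eq_withDensity,
    withDensity_apply _ (hTm hB), withDensity_apply _ hB]
  conv_rhs => rw [← Set.image_preimage_eq B hsurj]
  rw [lintegral_image_eq_lintegral_abs_det_fderiv_mul volume (hTm hB) (f' := fun _ => L)
    (fun x _ => (L.hasFDerivAt.const_add m).hasFDerivWithinAt) hinj.injOn]
  refine lintegral_congr fun x => ?_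
  rw [← ENNReal.ofReal_mul (abs_nonneg _), normalDensity, hdetL]
  congr 1
  simp only [add_sub_cancel_left]
  rw [quadForm_inv_sqrt hS, Real.sqrt_mul (by positivity), mul_inv]
  have := Real.sqrt_pos.2 hS.det_pos
  field_simp

lemma multivariateGaussian_real_apply (hS : S.PosDef) (m : EuclideanSpace ℝ ι) (B : Set _)
    (hB : MeasurableSet B) : (multivariateGaussian m S).real B = ∫ x in B, normalDensity m S x := by
  rw [multivariateGaussian_eq_withDensity hS, measureReal_def, withDensity_apply _ hB,
    integral_eq_lintegral_of_nonneg_ae (Eventually.of_forall (normalDensity_nonneg m S))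
    (by fun_prop)]

end Gaussian

/-! ### Densities that are nearly normal -/

section NearNormal

variable {ι : Type*} [Fintype ι] [DecidableEq ι]

lemma quadForm_smul_inv {S : Matrix ι ι ℝ} (hS : S.det ≠ 0) {c : ℝ} (hc : c ≠ 0)
    (x : EuclideanSpace ℝ ι) : quadForm (c • S)⁻¹ x = c⁻¹ * quadForm S⁻¹ x := by
  have h := Matrix.inv_smul' S (Units.mk0 c hc) (isUnit_iff_ne_zero.2 hS)
  have h2 : (c • S)⁻¹ = c⁻¹ • S⁻¹ := by simpa [Units.smul_def] using h
  rw [h2, quadForm_smul]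

/-- The maximum of a normal density is proportional to the inverse root of the determinant. -/
lemma normalDensity_self_mul_sqrt_det {S T : Matrix ι ι ℝ} (hS : 0 < S.det) (hT : 0 < T.det)
    {c : ℝ} (hc : 0 < c) (m m' : EuclideanSpace ℝ ι) :
    normalDensity m (c • S) m * √S.det = normalDensity m' (c • T) m' * √T.det := by
  have h : ∀ (R : Matrix ι ι ℝ) (m : EuclideanSpace ℝ ι), 0 < R.det →
      normalDensity m (c • R) m * √R.det = (√((2 * Real.pi * c) ^ Fintype.card ι))⁻¹ := by
    intro R m hR
    have h1 : (2 * Real.pi) ^ Fintype.card ι * (c • R).det =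
        (2 * Real.pi * c) ^ Fintype.card ι * R.det := by
      rw [Matrix.det_smul, mul_pow]; ring
    have h2 := Real.sqrt_pos.2 hR
    simp only [normalDensity, sub_self, quadForm_zero_right, mul_zero, Real.exp_zero, mul_one]
    rw [h1, Real.sqrt_mul (by positivity)]
    field_simp
  rw [h S m hS, h T m' hT]

/-- On `N`, the function `g` is close to the density of `N(m, V)`: with `Q` the quadratic form of
that density, `log g` differs from its logarithm by at most `ε (1 + Q)`. -/
def NearNormal (ε : ℝ) (m : EuclideanSpace ℝ ι) (V : Matrix ι ι ℝ) (N : Set (EuclideanSpace ℝ ι))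
    (g : EuclideanSpace ℝ ι → ℝ) : Prop :=
  ∀ x ∈ N,
    normalDensity m V m * Real.exp (-(1 / 2) * quadForm V⁻¹ (x - m)
      - ε * (1 + quadForm V⁻¹ (x - m))) ≤ g x ∧
    g x ≤ normalDensity m V m * Real.exp (-(1 / 2) * quadForm V⁻¹ (x - m)
      + ε * (1 + quadForm V⁻¹ (x - m)))

variable {ε s : ℝ} {m : EuclideanSpace ℝ ι} {V : Matrix ι ι ℝ} {N : Set (EuclideanSpace ℝ ι)}
  {g : EuclideanSpace ℝ ι → ℝ}

lemma NearNormal.le_mul (h : NearNormal ε m V N g) (hε : 0 ≤ ε) {x : EuclideanSpace ℝ ι}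
    (hx : x ∈ N) (hxs : quadForm V⁻¹ (x - m) ≤ s) :
    g x ≤ Real.exp (ε * (1 + s)) * normalDensity m V x := by
  refine (h x hx).2.trans ?_
  rw [normalDensity_eq m V x, Real.exp_add]
  have h1 : Real.exp (ε * (1 + quadForm V⁻¹ (x - m))) ≤ Real.exp (ε * (1 + s)) := by gcongr
  have h2 := normalDensity_nonneg m V m
  calc _ = Real.exp (ε * (1 + quadForm V⁻¹ (x - m))) * (normalDensity m V m *
        Real.exp (-(1 / 2) * quadForm V⁻¹ (x - m))) := by ring
    _ ≤ _ := by gcongr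

lemma NearNormal.normalDensity_le_mul (h : NearNormal ε m V N g) (hε : 0 ≤ ε)
    {x : EuclideanSpace ℝ ι} (hx : x ∈ N) (hxs : quadForm V⁻¹ (x - m) ≤ s) :
    normalDensity m V x ≤ Real.exp (ε * (1 + s)) * g x := by
  have h0 := (h x hx).1
  have h2 := normalDensity_nonneg m V m
  have h1 : Real.exp (ε * (1 + quadForm V⁻¹ (x - m))) ≤ Real.exp (ε * (1 + s)) := by gcongr
  have hg : 0 ≤ g x := le_trans (by positivity) h0
  calc normalDensity m V x = Real.exp (ε * (1 + quadForm V⁻¹ (x - m))) *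
        (normalDensity m V m * Real.exp (-(1 / 2) * quadForm V⁻¹ (x - m)
          - ε * (1 + quadForm V⁻¹ (x - m)))) := by
        rw [normalDensity_eq m V x, Real.exp_sub]
        field_simp
    _ ≤ _ := by gcongr

/-- On an ellipsoid, a nearly normal density has a ratio to the normal density close to one. -/
lemma NearNormal.abs_div_sub_one_le (h : NearNormal ε m V N g) (hV : V.PosDef) (hε : 0 ≤ ε)
    {x : EuclideanSpace ℝ ι} (hx : x ∈ N) (hxs : quadForm V⁻¹ (x - m) ≤ s) :
    |g x / normalDensity m V x - 1| ≤ Real.exp (ε * (1 + s)) - 1 := by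
  have h1 := h.le_mul hε hx hxs
  have h2 := h.normalDensity_le_mul hε hx hxs
  have hpos := normalDensity_pos hV m x
  have h3 : g x / normalDensity m V x ≤ Real.exp (ε * (1 + s)) := by
    rwa [div_le_iff₀ hpos]
  have h4 : 1 ≤ Real.exp (ε * (1 + s)) * (g x / normalDensity m V x) := by
    rw [← mul_div_assoc, le_div_iff₀ hpos, one_mul]
    exact h2
  have h5 : 0 < Real.exp (ε * (1 + s)) := Real.exp_pos _
  set y := g x / normalDensity m V x
  set t := Real.exp (ε * (1 + s))
  rw [abs_le]
  refine ⟨?_, by linarith⟩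
  -- `y ≥ 1 / t ≥ 2 - t`
  have h6 : t⁻¹ ≤ y := by
    rw [inv_le_iff_one_le_mul₀ h5, mul_comm]; exact h4
  have h7 : 2 - t ≤ t⁻¹ := by
    rw [← one_div, le_div_iff₀ h5]
    nlinarith [sq_nonneg (t - 1)]
  linarith

lemma measure_le_of_density_le {E : Type*} [MeasurableSpace E] {κ μ ν : Measure E} {B : Set E}
    (hB : MeasurableSet B) {f g : E → ℝ} {c : ℝ} (hc : 0 ≤ c)
    (hμ : μ B = ∫⁻ x in B, ENNReal.ofReal (f x) ∂κ)
    (hν : ν B = ∫⁻ x in B, ENNReal.ofReal (g x) ∂κ) (h : ∀ x ∈ B, f x ≤ c * g x) :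
    μ B ≤ ENNReal.ofReal c * ν B := by
  rw [hμ, hν, ← lintegral_const_mul' _ _ ENNReal.ofReal_ne_top]
  refine setLIntegral_mono' hB fun x hx => ?_
  rw [← ENNReal.ofReal_mul hc]
  exact ENNReal.ofReal_le_ofReal (h x hx)

/-- A probability measure with a nearly normal density on a large ellipsoid is close to the normal
distribution in total variation. -/
lemma NearNormal.tvLe (h : NearNormal ε m V N g) (hV : V.PosDef) (hε : 0 ≤ ε)
    (hs : 0 ≤ s) (hsN : ∀ x, quadForm V⁻¹ (x - m) ≤ s → x ∈ N) {μ : Measure (EuclideanSpace ℝ ι)}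
    [IsProbabilityMeasure μ]
    (hμ : ∀ B, MeasurableSet B → B ⊆ N → μ B = ∫⁻ x in B, ENNReal.ofReal (g x)) :
    TVLe μ (multivariateGaussian m V)
      (2 * (Real.exp (ε * (1 + s)) - 1) + (1 - chiSqCDF ι s)) := by
  set ν := multivariateGaussian m V with hν
  have hC : MeasurableSet {x : EuclideanSpace ℝ ι | quadForm V⁻¹ (x - m) ≤ s} :=
    (isClosed_le (by fun_prop) continuous_const).measurableSet
  refine TVLe.of_subset hC ?_ (by rw [multivariateGaussian_quadForm_le hV]; linarith)
  intro B hB hBC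
  have hμB := hμ B hB fun x hx => hsN x (hBC hx)
  have hνB : ν B = ∫⁻ x in B, ENNReal.ofReal (normalDensity m V x) := by
    rw [hν, multivariateGaussian_eq_withDensity hV, withDensity_apply _ hB]
  have ht : 0 < Real.exp (ε * (1 + s)) := Real.exp_pos _
  have h1 := measure_le_of_density_le hB ht.le hμB hνB
    fun x hx => h.le_mul hε (hsN x (hBC hx)) (hBC hx)
  have h2 := measure_le_of_density_le hB ht.le hνB hμB
    fun x hx => h.normalDensity_le_mul hε (hsN x (hBC hx)) (hBC hx)
  have h3 : μ.real B ≤ Real.exp (ε * (1 + s)) * ν.real B := by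
    have := ENNReal.toReal_mono (by finiteness) h1
    rwa [ENNReal.toReal_mul, ENNReal.toReal_ofReal ht.le] at this
  have h4 : ν.real B ≤ Real.exp (ε * (1 + s)) * μ.real B := by
    have := ENNReal.toReal_mono (by finiteness) h2
    rwa [ENNReal.toReal_mul, ENNReal.toReal_ofReal ht.le] at this
  have h5 : μ.real B ≤ 1 := measureReal_le_one
  have h6 : ν.real B ≤ 1 := measureReal_le_one
  have h7 : 0 ≤ μ.real B := measureReal_nonneg
  have h8 : 0 ≤ ν.real B := measureReal_nonneg
  have ht1 : 1 ≤ Real.exp (ε * (1 + s)) := Real.one_le_exp (by positivity)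
  set t := Real.exp (ε * (1 + s))
  rw [abs_le]
  constructor <;> nlinarith

/-- Normal distributions depend continuously on their variance matrix, in total variation and
uniformly over rescalings. -/
lemma eventually_tvLe_multivariateGaussian {S₀ : Matrix ι ι ℝ} (hS₀ : S₀.PosDef) {d : ℝ}
    (hd : 0 < d) : ∀ᶠ S in 𝓝 S₀, S.IsSymm → ∀ c : ℝ, 0 < c →
      TVLe (multivariateGaussian 0 (c • S)) (multivariateGaussian 0 (c • S₀)) d := by
  obtain ⟨s, hs, hs0⟩ := (((tendsto_chiSqCDF_atTop ι).eventually
    (lt_mem_nhds (show 1 - d / 2 < 1 by linarith))).and (eventually_ge_atTop 0)).exists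
  have hlim : Tendsto (fun ε : ℝ => Real.exp (ε * (1 + s)) - 1) (𝓝[>] 0) (𝓝 0) := by
    have : Continuous (fun ε : ℝ => Real.exp (ε * (1 + s)) - 1) := by fun_prop
    simpa using (this.tendsto 0).mono_left nhdsWithin_le_nhds
  obtain ⟨ε, hεd, hε⟩ := ((hlim.eventually (gt_mem_nhds (show 0 < d / 4 by linarith))).and
    self_mem_nhdsWithin).exists
  replace hε : 0 < ε := hε
  have hdet0 := hS₀.det_pos
  have hdet : Tendsto (fun S : Matrix ι ι ℝ => √S₀.det / √S.det) (𝓝 S₀) (𝓝 1) := by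
    have h1 : Tendsto (fun S : Matrix ι ι ℝ => √S.det) (𝓝 S₀) (𝓝 √S₀.det) :=
      ((Continuous.matrix_det continuous_id).sqrt).tendsto S₀
    have h2 := (Real.sqrt_pos.2 hdet0).ne'
    have h3 := (tendsto_const_nhds (x := √S₀.det)).div h1 h2
    rwa [div_self h2] at h3
  filter_upwards [eventually_posDef hS₀, eventually_abs_quadForm_inv_sub_le hS₀ hε,
    hdet.eventually (lt_mem_nhds (show Real.exp (-ε) < 1 by simpa using hε)),
    hdet.eventually (gt_mem_nhds (show 1 < Real.exp ε by simpa using hε))]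
    with S hS hq hd1 hd2 hsymm c hc
  replace hS := hS hsymm
  have hcS : (c • S).PosDef := hS.smul hc
  have hcS₀ : (c • S₀).PosDef := hS₀.smul hc
  have hnear : NearNormal ε 0 (c • S₀) Set.univ (normalDensity 0 (c • S)) := by
    intro x _
    have h0 := normalDensity_self_mul_sqrt_det hS.det_pos hdet0 hc 0 0
    have hsq := Real.sqrt_pos.2 hS.det_pos
    have h1 : normalDensity 0 (c • S) 0 = normalDensity 0 (c • S₀) 0 * (√S₀.det / √S.det) := by
      rw [mul_div_assoc', ← h0]
      field_simp
    have h2 := normalDensity_pos hcS₀ 0 0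
    have h3 := abs_le.1 (hq x)
    have hci : 0 < c⁻¹ := inv_pos.2 hc
    have h4 : 0 ≤ quadForm S₀⁻¹ x := quadForm_nonneg hS₀.inv.posSemidef x
    rw [normalDensity_eq 0 (c • S) x, h1, sub_zero, quadForm_smul_inv hdet0.ne' hc.ne',
      quadForm_smul_inv hS.det_pos.ne' hc.ne', mul_assoc]
    set q := quadForm S⁻¹ x
    set q₀ := quadForm S₀⁻¹ x
    have h5 : c⁻¹ * q ≤ c⁻¹ * q₀ + ε * (c⁻¹ * q₀) := by
      have := mul_le_mul_of_nonneg_left (show q ≤ q₀ + ε * q₀ by linarith) hci.le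
      linarith
    have h6 : c⁻¹ * q₀ - ε * (c⁻¹ * q₀) ≤ c⁻¹ * q := by
      have := mul_le_mul_of_nonneg_left (show q₀ - ε * q₀ ≤ q by linarith) hci.le
      linarith
    have h7 : 0 ≤ ε * (c⁻¹ * q₀) := by positivity
    constructor
    · refine mul_le_mul_of_nonneg_left ?_ h2.le
      rw [show -(1 / 2) * (c⁻¹ * q₀) - ε * (1 + c⁻¹ * q₀) =
        -ε + (-(1 / 2) * (c⁻¹ * q₀) - ε * (c⁻¹ * q₀)) by ring, Real.exp_add]
      refine mul_le_mul hd1.le (Real.exp_le_exp.2 ?_) (Real.exp_pos _).le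
        ((Real.exp_pos _).trans hd1).le
      linarith
    · refine mul_le_mul_of_nonneg_left ?_ h2.le
      rw [show -(1 / 2) * (c⁻¹ * q₀) + ε * (1 + c⁻¹ * q₀) =
        ε + (-(1 / 2) * (c⁻¹ * q₀) + ε * (c⁻¹ * q₀)) by ring, Real.exp_add]
      refine mul_le_mul hd2.le (Real.exp_le_exp.2 ?_) (Real.exp_pos _).le (Real.exp_pos _).le
      linarith
  refine (hnear.tvLe hcS₀ hε.le hs0 (fun x _ => Set.mem_univ x) fun B hB _ => ?_).mono
    (by linarith)
  rw [multivariateGaussian_eq_withDensity hcS, withDensity_apply _ hB]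

end NearNormal

/-! ### Mean square error of the estimating function -/

section MeanSquare

variable {𝒳 𝒴 Ω : Type*} [MeasurableSpace 𝒳] [MeasurableSpace 𝒴] [MeasurableSpace Ω] {q k : ℕ}
  {P : Measure Ω} {M : Model 𝒳 𝒴 q k} {W : ℕ → Ω → 𝒳 × 𝒴 × Bool} {ζ₀ ζ : Par q k}

/-- The gradient of the response probability is measurable in the covariate, as a limit of
difference quotients. -/
lemma Model.measurable_gradient_prob (M : Model 𝒳 𝒴 q k) (hζ : ζ ∈ M.space) (i : Fin q) :
    Measurable fun x => gradient (fun φ => M.prob φ x) ζ.phi i := by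
  set u : EuclideanSpace ℝ (Fin q) := EuclideanSpace.single i 1
  have hlim : Tendsto (fun n : ℕ => ((n : ℝ) + 1)⁻¹) atTop (𝓝[≠] 0) := by
    refine tendsto_nhdsWithin_iff.2 ⟨?_, Eventually.of_forall fun n => ?_⟩
    · simpa [one_div] using tendsto_one_div_add_atTop_nhds_zero_nat (𝕜 := ℝ)
    · exact inv_ne_zero (by positivity : (n : ℝ) + 1 ≠ 0)
  refine measurable_of_tendsto_metrizable (f := fun (n : ℕ) x =>
    (((n : ℝ) + 1)⁻¹)⁻¹ • (M.prob (ζ.phi + ((n : ℝ) + 1)⁻¹ • u) x - M.prob ζ.phi x)) ?_ ?_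
  · intro n
    have h1 := M.measurable_prob (ζ.phi + ((n : ℝ) + 1)⁻¹ • u)
    have h2 := M.measurable_prob ζ.phi
    fun_prop
  · refine tendsto_pi_nhds.2 fun x => ?_
    have hd := M.differentiable_prob ζ hζ x
    have h1 := (hd.hasFDerivAt.hasLineDerivAt u).tendsto_slope_zero.comp hlim
    have h2 : gradient (fun φ => M.prob φ x) ζ.phi i =
        fderiv ℝ (fun φ => M.prob φ x) ζ.phi u := by
      have h3 := hd.hasGradientAt.hasFDerivAt.fderiv
      have h4 : inner ℝ (gradient (fun φ => M.prob φ x) ζ.phi) u =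
          gradient (fun φ => M.prob φ x) ζ.phi i := by
        rw [EuclideanSpace.inner_single_right]
        simp
      rw [h3, ← h4, InnerProductSpace.toDual_apply_apply]
    rw [h2]
    exact h1

lemma Model.measurable_unitFun (M : Model 𝒳 𝒴 q k) (hζ : ζ ∈ M.space) :
    Measurable (M.unitFun ζ) := by
  have hδ : Measurable fun w : 𝒳 × 𝒴 × Bool => if w.2.2 then (1 : ℝ) else 0 :=
    Measurable.ite (measurableSet_eq_fun (by fun_prop) measurable_const) measurable_const
      measurable_const
  have hp : Measurable fun w : 𝒳 × 𝒴 × Bool => M.prob ζ.phi w.1 :=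
    (M.measurable_prob _).comp measurable_fst
  unfold Model.unitFun
  refine (MeasurableEquiv.toLp 2 _).measurable.comp (measurable_pi_lambda _ fun a => ?_)
  rcases a with i | j
  · exact ((hδ.div hp).sub ((measurable_const.sub hδ).div (measurable_const.sub hp))).mul
      ((M.measurable_gradient_prob hζ i).comp measurable_fst)
  · have h : Measurable fun w : 𝒳 × 𝒴 × Bool => M.est ζ.theta w.1 w.2.1 :=
      (M.measurable_est ζ.theta).comp
        (g := fun w : 𝒳 × 𝒴 => M.est ζ.theta w.1 w.2) (by fun_prop :
          Measurable fun w : 𝒳 × 𝒴 × Bool => (w.1, w.2.1))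
    exact (hδ.div hp).mul (by fun_prop)

variable [IsProbabilityMeasure P]

/-- `n E ‖U_n(ζ) - η(ζ)‖²` is the trace of `Σ(ζ)`. -/
lemma Model.integral_norm_sq_Un_sub_eta (hW : M.Sampling P W ζ₀) (hζ : ζ ∈ M.space)
    (hmem : MemLp (fun ω => M.unitFun ζ (W 0 ω)) 2 P) {n : ℕ} (hn : n ≠ 0) :
    Integrable (fun ω => ‖M.Un W n ω ζ - M.eta P W ζ‖ ^ 2) P ∧
    ∫ ω, ‖M.Un W n ω ζ - M.eta P W ζ‖ ^ 2 ∂P = (n : ℝ)⁻¹ * (M.Sig P W ζ).trace := by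
  have hmeas := M.measurable_unitFun hζ
  set X : (Fin q ⊕ Fin k) → ℕ → Ω → ℝ := fun a i ω => M.unitFun ζ (W i ω) a with hX
  have hcoord : ∀ a, Measurable fun w => M.unitFun ζ w a := fun a => by fun_prop
  have hid : ∀ a i, IdentDistrib (X a i) (X a 0) P P := fun a i =>
    (hW.ident i).comp (hcoord a)
  have hX0 : ∀ a, MemLp (X a 0) 2 P := fun a => hmem.eval_piLp a
  have hXi : ∀ a i, MemLp (X a i) 2 P := fun a i => (hid a i).memLp_iff.2 (hX0 a)
  have hvar : ∀ a, Var[fun ω => M.Un W n ω ζ a; P] = (n : ℝ)⁻¹ * M.Sig P W ζ a a := by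
    intro a
    have h1 : (fun ω => M.Un W n ω ζ a) = fun ω => (n : ℝ)⁻¹ * (∑ i ∈ Finset.range n, X a i) ω := by
      ext ω
      simp [Model.Un, hX]
    have hind : Set.Pairwise ↑(Finset.range n) fun i j => IndepFun (X a i) (X a j) P :=
      fun i _ j _ hij => (hW.indep.indepFun hij).comp (hcoord a) (hcoord a)
    rw [h1, variance_const_mul, IndepFun.variance_sum (fun i _ => hXi a i) hind,
      Finset.sum_congr rfl fun i _ => (hid a i).variance_eq, Finset.sum_const, Finset.card_range,
      nsmul_eq_mul]
    have h2 : M.Sig P W ζ a a = Var[X a 0; P] := by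
      simp only [Model.Sig, Matrix.of_apply]
      exact covariance_self (hX0 a).aemeasurable
    rw [h2]
    have : (n : ℝ) ≠ 0 := by exact_mod_cast hn
    field_simp
  have hmean : ∀ a, ∫ ω, M.Un W n ω ζ a ∂P = M.eta P W ζ a := by
    intro a
    have h1 : (fun ω => M.Un W n ω ζ a) = fun ω => (n : ℝ)⁻¹ * ∑ i ∈ Finset.range n, X a i ω := by
      ext ω
      simp [Model.Un, hX]
    have h2 : M.eta P W ζ a = ∫ ω, X a 0 ω ∂P := by
      unfold Model.eta
      exact eval_integral_piLp (fun a => (hX0 a).integrable one_le_two) a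
    rw [h1, integral_const_mul, integral_finsetSum _ fun i _ => (hXi a i).integrable one_le_two,
      Finset.sum_congr rfl fun i _ => (hid a i).integral_eq, Finset.sum_const, Finset.card_range,
      nsmul_eq_mul, h2]
    have : (n : ℝ) ≠ 0 := by exact_mod_cast hn
    field_simp
  have hUmem : ∀ a, MemLp (fun ω => M.Un W n ω ζ a) 2 P := by
    intro a
    have h1 : (fun ω => M.Un W n ω ζ a) = fun ω => (n : ℝ)⁻¹ * ∑ i ∈ Finset.range n, X a i ω := by
      ext ω
      simp [Model.Un, hX]
    rw [h1]
    exact (memLp_finsetSum _ fun i _ => hXi a i).const_mul _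
  have hexp : ∀ ω, ‖M.Un W n ω ζ - M.eta P W ζ‖ ^ 2 =
      ∑ a, (M.Un W n ω ζ a - M.eta P W ζ a) ^ 2 := fun ω => by
    rw [EuclideanSpace.real_norm_sq_eq]
    rfl
  have hint : ∀ a, Integrable (fun ω => (M.Un W n ω ζ a - M.eta P W ζ a) ^ 2) P := fun a =>
    ((hUmem a).sub (memLp_const _)).integrable_sq
  refine ⟨?_, ?_⟩
  · simp_rw [hexp]
    exact integrable_finsetSum _ fun a _ => hint a
  · simp_rw [hexp]
    rw [integral_finsetSum _ fun a _ => hint a, Matrix.trace, Finset.mul_sum]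
    refine Finset.sum_congr rfl fun a _ => ?_
    rw [Matrix.diag_apply, ← hvar a, variance_eq_integral (hUmem a).aemeasurable, hmean a]

/-- Chebyshev's inequality for the estimating function. -/
lemma Model.measure_le_norm_Un_sub_eta (hW : M.Sampling P W ζ₀) (hζ : ζ ∈ M.space)
    (hmem : MemLp (fun ω => M.unitFun ζ (W 0 ω)) 2 P) {n : ℕ} (hn : n ≠ 0) {T s : ℝ} (hs : 0 < s)
    (hT : (M.Sig P W ζ).trace ≤ T) :
    P {ω | s ≤ ‖M.Un W n ω ζ - M.eta P W ζ‖} ≤ ENNReal.ofReal (T / (n * s ^ 2)) := by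
  obtain ⟨h1, h2⟩ := M.integral_norm_sq_Un_sub_eta hW hζ hmem hn
  have h3 := mul_meas_ge_le_integral_of_nonneg
    (Eventually.of_forall fun ω => by positivity) h1 (s ^ 2)
  rw [h2] at h3
  have hn' : (0 : ℝ) < n := by positivity
  have h4 : {ω | s ≤ ‖M.Un W n ω ζ - M.eta P W ζ‖} ⊆
      {ω | s ^ 2 ≤ ‖M.Un W n ω ζ - M.eta P W ζ‖ ^ 2} := fun ω (hω : s ≤ _) =>
    pow_le_pow_left₀ hs.le hω 2
  refine (measure_mono h4).trans ?_
  rw [← ofReal_measureReal]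
  refine ENNReal.ofReal_le_ofReal ?_
  rw [le_div_iff₀ (by positivity)]
  have h5 : n * ((n : ℝ)⁻¹ * (M.Sig P W ζ).trace) = (M.Sig P W ζ).trace := by field_simp
  nlinarith

end MeanSquare

/-! ### Local linearization of the estimating equations -/

section Local

variable {𝒳 𝒴 Ω : Type*} [MeasurableSpace 𝒳] [MeasurableSpace 𝒴] [MeasurableSpace Ω] {q k : ℕ}
  {P : Measure Ω} {ζ₀ : Par q k} {r : ℕ → ℝ}

lemma eventually_radius_pos (hr' : Tendsto (fun n : ℕ => r n * √n) atTop atTop) :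
    ∀ᶠ n in atTop, 0 < r n := by
  filter_upwards [hr'.eventually_gt_atTop 0] with n hn
  exact pos_of_mul_pos_left hn (Real.sqrt_nonneg _)

/-- The Lipschitz condition on the inverse of the variance makes the variance continuous. -/
lemma LipschitzVariance.tendsto {S : Par q k → Matrix (Fin q ⊕ Fin k) (Fin q ⊕ Fin k) ℝ}
    (h : LipschitzVariance S (fun n => Metric.ball ζ₀ (r n)))
    (hpd : ∀ᶠ n in atTop, ∀ ζ ∈ Metric.ball ζ₀ (r n), (S ζ).PosDef)
    (hr : ∀ᶠ n in atTop, 0 < r n) : Tendsto S (𝓝 ζ₀) (𝓝 (S ζ₀)) := by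
  obtain ⟨-, C, -, hC⟩ := h
  obtain ⟨n, hC, hpd, hr⟩ := (hC.and (hpd.and hr)).exists
  have h0 := Metric.mem_ball_self (x := ζ₀) hr
  have hmem : ∀ᶠ ζ in 𝓝 ζ₀, ζ ∈ Metric.ball ζ₀ (r n) := Metric.ball_mem_nhds _ hr
  have hinv : Tendsto (fun ζ => (S ζ)⁻¹) (𝓝 ζ₀) (𝓝 (S ζ₀)⁻¹) := by
    refine tendsto_of_tendsto_quadForm ?_ ?_ fun x => ?_
    · filter_upwards [hmem] with ζ hζ
      simpa [Matrix.IsSymm] using (hpd ζ hζ).inv.isHermitian.eq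
    · simpa [Matrix.IsSymm] using (hpd ζ₀ h0).inv.isHermitian.eq
    · rw [tendsto_iff_dist_tendsto_zero]
      have hlim : Tendsto (fun ζ => C x * ‖ζ - ζ₀‖) (𝓝 ζ₀) (𝓝 0) := by
        have : Continuous fun ζ => C x * ‖ζ - ζ₀‖ := by fun_prop
        simpa using this.tendsto ζ₀
      refine squeeze_zero' (Eventually.of_forall fun _ => dist_nonneg) ?_ hlim
      filter_upwards [hmem] with ζ hζ
      exact hC ζ hζ ζ₀ h0 x
  have hdet : (S ζ₀)⁻¹.det ≠ 0 := (hpd ζ₀ h0).inv.det_pos.ne'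
  have h2 := (continuousAt_matrix_inv hdet).tendsto.comp hinv
  rw [Matrix.nonsing_inv_nonsing_inv _ (isUnit_iff_ne_zero.2 (hpd ζ₀ h0).det_pos.ne')] at h2
  refine h2.congr' ?_
  filter_upwards [hmem] with ζ hζ
  exact Matrix.nonsing_inv_nonsing_inv _ (isUnit_iff_ne_zero.2 (hpd ζ hζ).det_pos.ne')

/-- The Jacobian converges, uniformly on the shrinking neighbourhoods, to one non-singular linear
map: a uniform limit of continuous Jacobians is continuous at `ζ₀`. -/
lemma SmoothEquations.exists_limit [IsProbabilityMeasure P] {U : ℕ → Ω → Par q k → Par q k}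
    (h : SmoothEquations P U (fun n => Metric.ball ζ₀ (r n))) (hr : Tendsto r atTop (𝓝 0))
    (hr0 : ∀ᶠ n in atTop, 0 < r n) :
    ∃ G : Par q k →L[ℝ] Par q k, G.det ≠ 0 ∧ ∀ ε : ℝ, 0 < ε → ∀ᶠ z in inProb P,
      ∀ ζ ∈ Metric.ball ζ₀ (r z.1), ‖fderiv ℝ (U z.1 z.2) ζ - G‖ < ε := by
  obtain ⟨hC1, ⟨G, hdet, hG⟩, -⟩ := h
  rw [withProbToOne_iff] at hC1
  obtain ⟨n, hdet, hrn⟩ := (hdet.and hr0).exists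
  refine ⟨G ζ₀, hdet ζ₀ (Metric.mem_ball_self hrn), fun ε hε => ?_⟩
  have hε4 : 0 < ε / 4 := by positivity
  have hcont : ∀ᶠ ζ in 𝓝 ζ₀, ‖G ζ - G ζ₀‖ < 3 * (ε / 4) := by
    obtain ⟨z, hz1, hz2, hz3⟩ := (hC1.and ((withProbToOne_iff.1 (hG _ hε4)).and
      (tendsto_fst_inProb.eventually hr0))).exists
    have h1 := hz1.continuousOn_fderiv_of_isOpen Metric.isOpen_ball le_rfl
    have h2 := (h1.continuousAt (Metric.ball_mem_nhds ζ₀ hz3)).eventually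
      (Metric.ball_mem_nhds _ hε4)
    filter_upwards [h2, Metric.ball_mem_nhds ζ₀ hz3] with ζ hζ1 hζ2
    have h3 := hz2 ζ hζ2
    have h4 := hz2 ζ₀ (Metric.mem_ball_self hz3)
    rw [dist_eq_norm] at hζ1
    rw [norm_sub_rev] at h3
    calc ‖G ζ - G ζ₀‖ = ‖(G ζ - fderiv ℝ (U z.1 z.2) ζ) + (fderiv ℝ (U z.1 z.2) ζ -
          fderiv ℝ (U z.1 z.2) ζ₀) + (fderiv ℝ (U z.1 z.2) ζ₀ - G ζ₀)‖ := by congr 1; abel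
      _ ≤ _ := norm_add₃_le
      _ < 3 * (ε / 4) := by linarith
  obtain ⟨δ, hδ, hball⟩ := Metric.eventually_nhds_iff_ball.1 hcont
  filter_upwards [withProbToOne_iff.1 (hG _ hε4),
    tendsto_fst_inProb.eventually (hr.eventually (gt_mem_nhds hδ))] with z hz1 hz2 ζ hζ
  have h3 := hz1 ζ hζ
  have h4 := hball ζ (Metric.ball_subset_ball hz2.le hζ)
  calc ‖fderiv ℝ (U z.1 z.2) ζ - G ζ₀‖
      ≤ ‖fderiv ℝ (U z.1 z.2) ζ - G ζ‖ + ‖G ζ - G ζ₀‖ := norm_sub_le_norm_sub_add_norm_sub _ _ _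
    _ < ε := by linarith

lemma eventually_approximatesLinearOn {U : ℕ → Ω → Par q k → Par q k}
    (h : SmoothEquations P U (fun n => Metric.ball ζ₀ (r n))) {G : Par q k →L[ℝ] Par q k}
    (hG : ∀ ε : ℝ, 0 < ε → ∀ᶠ z in inProb P,
      ∀ ζ ∈ Metric.ball ζ₀ (r z.1), ‖fderiv ℝ (U z.1 z.2) ζ - G‖ < ε)
    {c : NNReal} (hc : 0 < c) : ∀ᶠ z in inProb P,
      ApproximatesLinearOn (U z.1 z.2) G (Metric.ball ζ₀ (r z.1)) c := by
  filter_upwards [withProbToOne_iff.1 h.1, hG c hc] with z hz1 hz2 x hx y hy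
  refine (convex_ball ζ₀ (r z.1)).norm_image_sub_le_of_norm_fderiv_le' (fun ζ hζ => ?_)
    (fun ζ hζ => (hz2 ζ hζ).le) hy hx
  exact (hz1.contDiffAt (Metric.isOpen_ball.mem_nhds hζ)).differentiableAt one_ne_zero

/-- If `U` is nearly linear around `ζ₀` and nearly vanishes there, then all small values are
attained near `ζ₀`. -/
lemma exists_closedBall_subset_image (hdim : 0 < q + k) {G : Par q k →L[ℝ] Par q k}
    (hG : G.det ≠ 0) {U : ℕ × Ω → Par q k → Par q k}
    (hU : ∀ c : NNReal, 0 < c → ∀ᶠ z in inProb P,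
      ApproximatesLinearOn (U z) G (Metric.ball ζ₀ (r z.1)) c)
    (hU0 : ∀ ε : ℝ, 0 < ε → ∀ᶠ z in inProb P, ‖U z ζ₀‖ ≤ ε * r z.1)
    (hr0 : ∀ᶠ n in atTop, 0 < r n) :
    ∃ κ : ℝ, 0 < κ ∧ ∀ ρ : ℝ, 0 < ρ → ρ < 1 → ∀ᶠ z in inProb P,
      Metric.closedBall 0 (κ * ρ * r z.1) ⊆ U z '' Metric.closedBall ζ₀ (ρ * r z.1) := by
  let e := G.toContinuousLinearEquivOfDetNeZero hG
  have hne : Nonempty (Fin q ⊕ Fin k) := by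
    rw [← Fintype.card_pos_iff]
    simpa using hdim
  have hnt : Nontrivial (Par q k) := inferInstance
  set A := e.toNonlinearRightInverse
  have heG : (e : Par q k →L[ℝ] Par q k) = G := by ext; simp [e]
  have hA : 0 < A.nnnorm := by
    change 0 < ‖(e.symm : Par q k →L[ℝ] Par q k)‖₊
    exact e.nnnorm_symm_pos
  have hA' : (0 : ℝ) < (A.nnnorm : ℝ)⁻¹ := inv_pos.2 hA
  set a : ℝ := (A.nnnorm : ℝ)⁻¹ with ha
  refine ⟨a / 4, by positivity, fun ρ hρ hρ1 => ?_⟩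
  filter_upwards [hU (A.nnnorm⁻¹ / 2) (by positivity), hU0 (a / 4 * ρ) (by positivity),
    tendsto_fst_inProb.eventually hr0] with z hz1 hz2 hz3 y hy
  rw [← heG] at hz1
  have hρr : 0 < ρ * r z.1 := by positivity
  refine hz1.surjOn_closedBall_of_nonlinearRightInverse A hρr.le ?_ ?_
  · exact Metric.closedBall_subset_ball (by nlinarith)
  · rw [mem_closedBall_zero_iff] at hy
    rw [mem_closedBall_iff_norm]
    have h1 : ((A.nnnorm : ℝ)⁻¹ - ((A.nnnorm⁻¹ / 2 : NNReal) : ℝ)) * (ρ * r z.1) =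
        a / 2 * (ρ * r z.1) := by
      push_cast
      rw [← ha]; ring
    rw [h1]
    calc ‖y - U z ζ₀‖ ≤ ‖y‖ + ‖U z ζ₀‖ := norm_sub_le _ _
      _ ≤ _ := by linarith

variable [IsProbabilityMeasure P] {M : Model 𝒳 𝒴 q k} {W : ℕ → Ω → 𝒳 × 𝒴 × Bool}

/-- On the scale `r_n`, which is large compared with `n^{-1/2}`, the estimating function at `ζ₀`
is negligible. -/
lemma Model.eventually_norm_Un_le (hW : M.Sampling P W ζ₀) (hζ : ζ₀ ∈ M.space)
    (heta : M.eta P W ζ₀ = 0) (hmem : MemLp (fun ω => M.unitFun ζ₀ (W 0 ω)) 2 P)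
    (hr' : Tendsto (fun n : ℕ => r n * √n) atTop atTop) {ε : ℝ} (hε : 0 < ε) :
    ∀ᶠ z in inProb P, ‖M.Un W z.1 z.2 ζ₀‖ ≤ ε * r z.1 := by
  rw [eventually_inProb]
  have hlim : Tendsto (fun n : ℕ => ENNReal.ofReal
      ((M.Sig P W ζ₀).trace / ε ^ 2 * ((r n * √n) ^ 2)⁻¹)) atTop (𝓝 0) := by
    have h1 : Tendsto (fun n : ℕ => ((r n * √n) ^ 2)⁻¹) atTop (𝓝 0) :=
      (tendsto_pow_atTop (by norm_num)).comp hr' |>.inv_tendsto_atTop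
    simpa using ENNReal.tendsto_ofReal (h1.const_mul ((M.Sig P W ζ₀).trace / ε ^ 2))
  refine tendsto_of_tendsto_of_tendsto_of_le_of_le' tendsto_const_nhds hlim
    (Eventually.of_forall fun _ => zero_le) ?_
  filter_upwards [eventually_radius_pos hr', eventually_ne_atTop 0] with n hn hn0
  have h := M.measure_le_norm_Un_sub_eta hW hζ hmem hn0 (mul_pos hε hn) le_rfl
  rw [heta] at h
  simp only [sub_zero] at h
  refine (measure_mono fun ω (hω : ¬ _) => (not_le.1 hω).le).trans (h.trans (le_of_eq ?_))
  have h2 : (√(n : ℝ)) ^ 2 = n := Real.sq_sqrt (Nat.cast_nonneg n)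
  congr 1
  rw [mul_pow, mul_pow, h2]
  have : (n : ℝ) ≠ 0 := by exact_mod_cast hn0
  field_simp

/-- The mean function `η` is differentiable at `ζ₀`, with the limit of the Jacobians as derivative.
An increment `h` is compared with the random function `U_n`, where `n` is the last index with
`‖h‖ < r n`: for this `n` the random error `n^{-1/2}` is negligible compared with `‖h‖`. -/
lemma Model.hasFDerivAt_eta (hW : M.Sampling P W ζ₀) (hint : M.space ∈ 𝓝 ζ₀)
    (hr : Tendsto r atTop (𝓝 0)) (hr' : Tendsto (fun n : ℕ => r n * √n) atTop atTop)
    (hmem : ∀ᶠ n in atTop, ∀ ζ ∈ Metric.ball ζ₀ (r n),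
      MemLp (fun ω => M.unitFun ζ (W 0 ω)) 2 P)
    (hSig : Tendsto (M.Sig P W) (𝓝 ζ₀) (𝓝 (M.Sig P W ζ₀))) {G : Par q k →L[ℝ] Par q k}
    (hU : ∀ c : NNReal, 0 < c → ∀ᶠ z in inProb P,
      ApproximatesLinearOn (M.Un W z.1 z.2) G (Metric.ball ζ₀ (r z.1)) c) :
    HasFDerivAt (M.eta P W) G ζ₀ := by
  rw [hasFDerivAt_iff_isLittleO_nhds_zero, Asymptotics.isLittleO_iff]
  intro ε hε
  -- a bound on the variances near `ζ₀`
  have htr : ∀ᶠ ζ in 𝓝 ζ₀, (M.Sig P W ζ).trace ≤ |(M.Sig P W ζ₀).trace| + 1 := by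
    have hc : Continuous fun S : Matrix (Fin q ⊕ Fin k) (Fin q ⊕ Fin k) ℝ => S.trace :=
      Continuous.matrix_trace continuous_id
    have h1 := ((hc.tendsto _).comp hSig).eventually
      (gt_mem_nhds (show (M.Sig P W ζ₀).trace < |(M.Sig P W ζ₀).trace| + 1 by
        linarith [le_abs_self (M.Sig P W ζ₀).trace]))
    filter_upwards [h1] with ζ hζ using hζ.le
  set T : ℝ := |(M.Sig P W ζ₀).trace| + 1 with hT
  have hTpos : 0 < T := by positivity
  obtain ⟨δ, hδ, hball⟩ := Metric.eventually_nhds_iff_ball.1 (htr.and hint)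
  have hlin : ∀ᶠ n in atTop, P {ω | ¬ ApproximatesLinearOn (M.Un W n ω) G
      (Metric.ball ζ₀ (r n)) (Real.toNNReal (ε / 2))} < ENNReal.ofReal (1 / 4) :=
    (eventually_inProb.1 (hU _ (by simpa using hε))).eventually
      (gt_mem_nhds (by simp))
  -- the constant `128 T` makes each of the two Chebyshev bounds below at most `1 / 4`
  obtain ⟨n₁, hn₁⟩ := eventually_atTop.1 (hlin.and (hmem.and
    ((hr.eventually (gt_mem_nhds hδ)).and ((hr'.eventually_ge_atTop (√(128 * T) / ε)).and
      ((eventually_radius_pos hr').and (eventually_ge_atTop 1))))))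
  have hr₁ : 0 < r n₁ := (hn₁ n₁ le_rfl).2.2.2.2.1
  filter_upwards [Metric.ball_mem_nhds (0 : Par q k) hr₁] with h hh
  rw [mem_ball_zero_iff] at hh
  rcases eq_or_ne h 0 with rfl | hh0
  · simp
  have hhpos : 0 < ‖h‖ := norm_pos_iff.2 hh0
  -- the last index `n` with `‖h‖ < r n`
  obtain ⟨n, hn, hrn, hrn'⟩ : ∃ n, n₁ ≤ n ∧ ‖h‖ < r n ∧ r (n + 1) ≤ ‖h‖ := by
    by_contra! hcon
    have hall : ∀ m, n₁ ≤ m → ‖h‖ < r m := fun m hm => by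
      induction m, hm using Nat.le_induction with
      | base => exact hh
      | succ m hm ih => exact hcon m hm ih
    obtain ⟨m, hm1, hm2⟩ := ((hr.eventually (gt_mem_nhds hhpos)).and
      (eventually_ge_atTop n₁)).exists
    exact lt_asymm hm1 (hall m hm2)
  obtain ⟨hP, hmemn, hrδ, -, hrpos, hn1⟩ := hn₁ n hn
  have hbig := (hn₁ (n + 1) (by omega)).2.2.2.1
  have hn0 : n ≠ 0 := by omega
  have hn1' : (1 : ℝ) ≤ n := by exact_mod_cast hn1
  have hnh : 64 * T / ε ^ 2 ≤ n * ‖h‖ ^ 2 := by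
    have h1 : √(128 * T) / ε ≤ ‖h‖ * √((n + 1 : ℕ) : ℝ) :=
      hbig.trans (by gcongr)
    have h2 := pow_le_pow_left₀ (by positivity) h1 2
    rw [div_pow, Real.sq_sqrt (by positivity), mul_pow, Real.sq_sqrt (by positivity)] at h2
    push_cast at h2
    have h3 : ‖h‖ ^ 2 * ((n : ℝ) + 1) ≤ 2 * (n * ‖h‖ ^ 2) := by
      nlinarith [sq_nonneg ‖h‖]
    have h4 : 64 * T / ε ^ 2 = 128 * T / ε ^ 2 / 2 := by ring
    linarith
  have hcheb : ∀ ζ ∈ Metric.ball ζ₀ (r n),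
      P {ω | ε / 4 * ‖h‖ ≤ ‖M.Un W n ω ζ - M.eta P W ζ‖} ≤ ENNReal.ofReal (1 / 4) := by
    intro ζ hζ
    obtain ⟨hζT, hζZ⟩ := hball ζ (Metric.ball_subset_ball hrδ.le hζ)
    refine (M.measure_le_norm_Un_sub_eta hW hζZ (hmemn ζ hζ) hn0 (by positivity) hζT).trans
      (ENNReal.ofReal_le_ofReal ?_)
    rw [div_le_iff₀ (by positivity)]
    rw [div_le_iff₀ (by positivity)] at hnh
    nlinarith
  have hmem1 : ζ₀ + h ∈ Metric.ball ζ₀ (r n) := by simpa using hrn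
  have hmem0 : ζ₀ ∈ Metric.ball ζ₀ (r n) := Metric.mem_ball_self hrpos
  -- the three bad events do not cover the sample space
  obtain ⟨ω, hω⟩ : ∃ ω, ω ∉ ({ω | ¬ ApproximatesLinearOn (M.Un W n ω) G
      (Metric.ball ζ₀ (r n)) (Real.toNNReal (ε / 2))} ∪
      {ω | ε / 4 * ‖h‖ ≤ ‖M.Un W n ω (ζ₀ + h) - M.eta P W (ζ₀ + h)‖}) ∪
      {ω | ε / 4 * ‖h‖ ≤ ‖M.Un W n ω ζ₀ - M.eta P W ζ₀‖} := by
    rw [← Set.ne_univ_iff_exists_notMem]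
    intro huniv
    have h1 := measure_union_le (μ := P) ({ω | ¬ ApproximatesLinearOn (M.Un W n ω) G
      (Metric.ball ζ₀ (r n)) (Real.toNNReal (ε / 2))} ∪
      {ω | ε / 4 * ‖h‖ ≤ ‖M.Un W n ω (ζ₀ + h) - M.eta P W (ζ₀ + h)‖})
      {ω | ε / 4 * ‖h‖ ≤ ‖M.Un W n ω ζ₀ - M.eta P W ζ₀‖}
    rw [huniv, measure_univ] at h1
    have h2 := h1.trans (add_le_add ((measure_union_le _ _).trans
      (add_le_add hP.le (hcheb _ hmem1))) (hcheb _ hmem0))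
    rw [← ENNReal.ofReal_add (by norm_num) (by norm_num),
      ← ENNReal.ofReal_add (by norm_num) (by norm_num), ENNReal.one_le_ofReal] at h2
    norm_num at h2
  simp only [Set.mem_union, Set.mem_ofPred_eq, not_or, not_not, not_le] at hω
  obtain ⟨⟨h1, h2⟩, h3⟩ := hω
  have h4 := h1 _ hmem1 _ hmem0
  rw [add_sub_cancel_left, Real.coe_toNNReal _ (by positivity)] at h4
  rw [norm_sub_rev] at h2
  calc ‖M.eta P W (ζ₀ + h) - M.eta P W ζ₀ - G h‖
      = ‖(M.eta P W (ζ₀ + h) - M.Un W n ω (ζ₀ + h)) + (M.Un W n ω ζ₀ - M.eta P W ζ₀)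
          + (M.Un W n ω (ζ₀ + h) - M.Un W n ω ζ₀ - G h)‖ := by congr 1; abel
    _ ≤ _ := norm_add₃_le
    _ ≤ ε * ‖h‖ := by linarith

end Local

/-! ### The law of the second step -/

section TwoStep

variable {q k : ℕ} {U : Par q k → Par q k} {Z N : Set (Par q k)} {law law' : Measure (Par q k)}
  {solve : Par q k → Par q k}

lemma IsSolver.of_ac (h : IsSolver U Z N law solve) (hac : law' ≪ law) :
    IsSolver U Z N law' solve where
  mem := h.mem
  eq := h.eq
  mem_nhd := h.mem_nhd
  aemeasurable := h.aemeasurable.mono_ac (hac.restrict _)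

lemma isProbabilityMeasure_twoStep (h : IsSolver U Z N law solve) [IsFiniteMeasure law]
    (hpos : law (U '' Z) ≠ 0) : IsProbabilityMeasure (twoStep U Z law solve) := by
  have := cond_isProbabilityMeasure hpos
  exact Measure.isProbabilityMeasure_map (h.aemeasurable.smul_measure _)

/-- On a set where `U` is one-to-one, the solution `ζ*` lies in `B` exactly when `η*` lies in
`U(B)`. -/
lemma twoStep_apply (h : IsSolver U Z N law solve) (hN : N ⊆ Z) (hinj : Set.InjOn U N)
    {B : Set (Par q k)} (hB : MeasurableSet B) (hBN : B ⊆ N) :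
    twoStep U Z law solve B = (law (U '' Z))⁻¹ * law (U '' B) := by
  rw [twoStep, ProbabilityTheory.cond,
    Measure.map_apply_of_aemeasurable (h.aemeasurable.smul_measure _) hB,
    Measure.smul_apply, smul_eq_mul,
    Measure.restrict_apply₀ (h.aemeasurable.nullMeasurableSet_preimage hB)]
  congr 2
  ext e
  constructor
  · rintro ⟨h1, h2⟩
    exact ⟨solve e, h1, h.eq e h2⟩
  · rintro ⟨ζ, hζ, rfl⟩
    have hmem : U ζ ∈ U '' Z := Set.mem_image_of_mem U (hN (hBN hζ))
    have h1 : solve (U ζ) ∈ N :=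
      h.mem_nhd _ (Set.mem_image_of_mem U ⟨hN (hBN hζ), hBN hζ⟩)
    have h2 : solve (U ζ) = ζ := hinj h1 (hBN hζ) (h.eq _ hmem)
    exact ⟨by rw [Set.mem_preimage, h2]; exact hζ, hmem⟩

/-- The density of `ζ*` on a set where `U` is a diffeomorphism, by change of variables. -/
lemma twoStep_apply_eq_lintegral (h : IsSolver U Z N law solve) [IsFiniteMeasure law] (hN : N ⊆ Z)
    (hinj : Set.InjOn U N) (hdiff : ∀ ζ ∈ N, DifferentiableAt ℝ U ζ) {f : Par q k → ℝ}
    (hlaw : law = volume.withDensity fun e => ENNReal.ofReal (f e))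
    (hpos : law (U '' Z) ≠ 0) {B : Set (Par q k)} (hB : MeasurableSet B) (hBN : B ⊆ N) :
    twoStep U Z law solve B =
      ∫⁻ ζ in B, ENNReal.ofReal (f (U ζ) * |(fderiv ℝ U ζ).det| / law.real (U '' Z)) := by
  have hd : ∀ ζ ∈ B, HasFDerivWithinAt U (fderiv ℝ U ζ) B ζ := fun ζ hζ =>
    (hdiff ζ (hBN hζ)).hasFDerivAt.hasFDerivWithinAt
  have hmeas := measurable_image_of_fderivWithin hB hd (hinj.mono hBN)
  have hpos' : 0 < law.real (U '' Z) := ENNReal.toReal_pos hpos (measure_ne_top _ _)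
  have hinv : (law (U '' Z))⁻¹ = ENNReal.ofReal (law.real (U '' Z))⁻¹ := by
    rw [ENNReal.ofReal_inv_of_pos hpos', ofReal_measureReal]
  have h1 : law (U '' B) = ∫⁻ e in U '' B, ENNReal.ofReal (f e) := by
    conv_lhs => rw [hlaw]
    rw [withDensity_apply _ hmeas]
  rw [twoStep_apply h hN hinj hB hBN, hinv, h1,
    lintegral_image_eq_lintegral_abs_det_fderiv_mul volume hB hd (hinj.mono hBN),
    ← lintegral_const_mul' _ _ ENNReal.ofReal_ne_top]
  refine lintegral_congr fun ζ => ?_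
  rw [← ENNReal.ofReal_mul (abs_nonneg _), ← ENNReal.ofReal_mul (by positivity)]
  congr 1
  field_simp

/-- The continuous version of a density is determined on an open set by the measures of its
subsets. -/
lemma IsDensity.eqOn {post : Measure (Par q k)} [IsFiniteMeasure post] {p g : Par q k → ℝ}
    (h : IsDensity post N p) (hN : IsOpen N) (hg : ContinuousOn g N) (hg0 : ∀ ζ ∈ N, 0 ≤ g ζ)
    (hpost : ∀ B, MeasurableSet B → B ⊆ N → post B = ∫⁻ ζ in B, ENNReal.ofReal (g ζ)) :
    Set.EqOn p g N := by
  have hNm := hN.measurableSet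
  have hgm : AEMeasurable (fun ζ => ENNReal.ofReal (g ζ)) (volume.restrict N) :=
    (hg.aemeasurable hNm).ennreal_ofReal
  have hres : post.restrict N =
      volume.withDensity (N.indicator fun ζ => ENNReal.ofReal (g ζ)) := by
    ext B hB
    rw [Measure.restrict_apply hB, hpost _ (hB.inter hNm) Set.inter_subset_right,
      withDensity_apply _ hB, lintegral_indicator hNm, Measure.restrict_restrict hNm,
      Set.inter_comm]
  have h1 := Measure.rnDeriv_restrict post volume hNm
  rw [hres] at h1
  have h2 := Measure.rnDeriv_withDensity₀ (volume : Measure (Par q k))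
    ((aemeasurable_indicator_iff hNm).2 hgm)
  refine Measure.eqOn_open_of_ae_eq (μ := volume) ?_ hN h.continuousOn hg
  rw [Filter.EventuallyEq, ae_restrict_iff' hNm]
  filter_upwards [h1, h2, h.ae_eq] with ζ h1 h2 h3 hζ
  rw [h1, Set.indicator_of_mem hζ, Set.indicator_of_mem hζ] at h2
  rw [h3, h2, ENNReal.toReal_ofReal (hg0 ζ hζ)]

/-- Outside `N`, a superlevel set of the density is small if `N` carries most of the mass. -/
lemma IsDensity.mul_volume_le {post : Measure (Par q k)} {p : Par q k → ℝ}
    (h : IsDensity post N p) (t : ℝ) :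
    ENNReal.ofReal t * volume ({ζ | t ≤ p ζ} \ N) ≤ post Nᶜ := by
  have hm : MeasurableSet {ζ | t ≤ p ζ} := measurableSet_le measurable_const h.measurable
  calc ENNReal.ofReal t * volume ({ζ | t ≤ p ζ} \ N)
      = ∫⁻ _ in {ζ | t ≤ p ζ} \ N, ENNReal.ofReal t := by rw [setLIntegral_const]
    _ ≤ ∫⁻ ζ in {ζ | t ≤ p ζ} \ N, post.rnDeriv volume ζ := by
        refine setLIntegral_mono_ae (Measure.measurable_rnDeriv _ _).aemeasurable ?_
        filter_upwards [h.ae_eq] with ζ h1 h2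
        have h3 : t ≤ p ζ := h2.1
        rw [h1] at h3
        exact (ENNReal.ofReal_le_ofReal h3).trans ENNReal.ofReal_toReal_le
    _ ≤ post ({ζ | t ≤ p ζ} \ N) := Measure.setLIntegral_rnDeriv_le _
    _ ≤ post Nᶜ := measure_mono fun ζ hζ => hζ.2

end TwoStep

/-! ### The linearization variance -/

section Variance

variable {ι : Type*} [Fintype ι] [DecidableEq ι] {S A : Matrix ι ι ℝ}

lemma sandwich_posDef (hS : S.PosDef) (hA : A.det ≠ 0) : (A⁻¹ * S * Aᵀ⁻¹).PosDef := by
  have hu : IsUnit A⁻¹ := by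
    rw [Matrix.isUnit_iff_isUnit_det, isUnit_iff_ne_zero, Matrix.det_nonsing_inv]
    simpa using hA
  have h := (Matrix.IsUnit.posDef_star_right_conjugate_iff (x := S) hu).2 hS
  rwa [Matrix.star_eq_conjTranspose, Matrix.conjTranspose_eq_transpose_of_trivial,
    Matrix.transpose_nonsing_inv] at h

lemma quadForm_sandwich_inv (hA : A.det ≠ 0) (x : EuclideanSpace ℝ ι) :
    quadForm (A⁻¹ * S * Aᵀ⁻¹)⁻¹ x = quadForm S⁻¹ (WithLp.toLp 2 (A *ᵥ x.ofLp)) := by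
  have hA' : IsUnit A.det := isUnit_iff_ne_zero.2 hA
  have h : (A⁻¹ * S * Aᵀ⁻¹)⁻¹ = Aᵀ * (S⁻¹ * A) := by
    rw [Matrix.mul_inv_rev, Matrix.mul_inv_rev, Matrix.nonsing_inv_nonsing_inv _ hA',
      Matrix.nonsing_inv_nonsing_inv _ (by rwa [Matrix.det_transpose])]
  simp only [quadForm]
  rw [h, ← Matrix.mulVec_mulVec, ← Matrix.mulVec_mulVec, Matrix.dotProduct_mulVec,
    Matrix.vecMul_transpose]

lemma sqrt_det_sandwich (hA : A.det ≠ 0) : √(A⁻¹ * S * Aᵀ⁻¹).det * |A.det| = √S.det := by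
  have h : (A⁻¹ * S * Aᵀ⁻¹).det = S.det / A.det ^ 2 := by
    rw [Matrix.det_mul, Matrix.det_mul, Matrix.det_nonsing_inv, Matrix.det_nonsing_inv,
      Matrix.det_transpose, Ring.inverse_eq_inv']
    field_simp
  rw [h, Real.sqrt_div' _ (by positivity), Real.sqrt_sq_eq_abs,
    div_mul_cancel₀ _ (abs_ne_zero.2 hA)]

omit [DecidableEq ι] in
lemma exists_le_norm {G : EuclideanSpace ℝ ι →L[ℝ] EuclideanSpace ℝ ι}
    (hG : G.det ≠ 0) : ∃ a : ℝ, 0 < a ∧ ∀ t, a * ‖t‖ ≤ ‖G t‖ := by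
  let e' := G.toContinuousLinearEquivOfDetNeZero hG
  refine ⟨((‖(e'.symm : EuclideanSpace ℝ ι →L[ℝ] EuclideanSpace ℝ ι)‖₊ : ℝ) + 1)⁻¹,
    by positivity, fun t => ?_⟩
  have h2 := e'.antilipschitz.le_mul_dist t 0
  rw [map_zero, dist_zero_right, dist_zero_right] at h2
  have h3 : ‖G t‖ = ‖e' t‖ := by simp [e']
  rw [inv_mul_le_iff₀ (by positivity), h3]
  nlinarith [norm_nonneg (e' t)]

omit [DecidableEq ι] in
/-- Under a small relative perturbation of the argument, `x' S⁻¹ x` changes little in the relative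
sense. -/
lemma exists_abs_quadForm_sub_le (hS : S.PosDef)
    {G : EuclideanSpace ℝ ι →L[ℝ] EuclideanSpace ℝ ι} (hG : G.det ≠ 0) {δ : ℝ} (hδ : 0 < δ) :
    ∃ c : NNReal, 0 < c ∧ ∀ e t, ‖e - G t‖ ≤ c * ‖t‖ →
      |quadForm S e - quadForm S (G t)| ≤ δ * quadForm S (G t) := by
  obtain ⟨κ, hκ, h⟩ := exists_le_quadForm hS
  obtain ⟨a, ha, hanti⟩ := exists_le_norm hG
  set K := ∑ a, ∑ b, |S a b| with hK
  have hK0 : 0 ≤ K := Finset.sum_nonneg fun _ _ => Finset.sum_nonneg fun _ _ => abs_nonneg _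
  have hlim : Tendsto (fun c : ℝ => K * (c * (2 * ‖G‖ + c))) (𝓝[>] 0) (𝓝 0) := by
    have : Continuous fun c : ℝ => K * (c * (2 * ‖G‖ + c)) := by fun_prop
    simpa using (this.tendsto 0).mono_left nhdsWithin_le_nhds
  obtain ⟨c, hc1, hc⟩ := ((hlim.eventually (gt_mem_nhds
    (show 0 < δ * κ * a ^ 2 by positivity))).and self_mem_nhdsWithin).exists
  replace hc : 0 < c := hc
  refine ⟨⟨c, hc.le⟩, hc, fun e t het => ?_⟩
  replace het : ‖e - G t‖ ≤ c * ‖t‖ := het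
  have h1 : ‖G t‖ ≤ ‖G‖ * ‖t‖ := G.le_opNorm t
  have h2 : ‖e‖ ≤ (‖G‖ + c) * ‖t‖ := by
    calc ‖e‖ = ‖(e - G t) + G t‖ := by simp
      _ ≤ _ := norm_add_le _ _
      _ ≤ _ := by linarith
  calc |quadForm S e - quadForm S (G t)| ≤ K * (‖e - G t‖ * (‖e‖ + ‖G t‖)) :=
        abs_quadForm_sub_le S _ _
    _ ≤ K * (c * ‖t‖ * ((‖G‖ + c) * ‖t‖ + ‖G‖ * ‖t‖)) := by gcongr
    _ = K * (c * (2 * ‖G‖ + c)) * ‖t‖ ^ 2 := by ring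
    _ ≤ δ * κ * a ^ 2 * ‖t‖ ^ 2 := by gcongr
    _ = δ * (κ * (a * ‖t‖) ^ 2) := by ring
    _ ≤ δ * (κ * ‖G t‖ ^ 2) := by gcongr; exact hanti t
    _ ≤ δ * quadForm S (G t) := by gcongr; exact h _

end Variance

/-! ### Posteriors with nearly normal densities -/

section Posterior

variable {α : Type*} {l : Filter α} {q k : ℕ} {m : α → Par q k}
  {V : α → Matrix (Fin q ⊕ Fin k) (Fin q ⊕ Fin k) ℝ} {N : α → Set (Par q k)}
  {post : α → Measure (Par q k)} {p : α → Par q k → ℝ}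

/-- Along the filter `l`, the posterior `post` has on `N` the density `p`, which is asymptotic to
that of `N(m, V)`, and `N` contains the ellipsoids of that normal distribution. -/
structure AsympNormalPosterior (l : Filter α) (m : α → Par q k)
    (V : α → Matrix (Fin q ⊕ Fin k) (Fin q ⊕ Fin k) ℝ) (N : α → Set (Par q k))
    (post : α → Measure (Par q k)) (p : α → Par q k → ℝ) : Prop where
  posDef : ∀ᶠ z in l, (V z).PosDef
  prob : ∀ᶠ z in l, IsProbabilityMeasure (post z)
  density : ∀ᶠ z in l, IsDensity (post z) (N z) (p z)
  apply : ∀ᶠ z in l, ∀ B, MeasurableSet B → B ⊆ N z →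
    post z B = ∫⁻ x in B, ENNReal.ofReal (p z x)
  near : ∀ ε : ℝ, 0 < ε → ∀ᶠ z in l, NearNormal ε (m z) (V z) (N z) (p z)
  ellipsoid : ∀ s : ℝ, ∀ᶠ z in l, ∀ x, quadForm (V z)⁻¹ (x - m z) ≤ s → x ∈ N z

namespace AsympNormalPosterior

lemma exists_exp_lt (s : ℝ) {d : ℝ} (hd : 0 < d) :
    ∃ ε : ℝ, 0 < ε ∧ Real.exp (ε * (1 + s)) - 1 < d := by
  have hlim : Tendsto (fun ε : ℝ => Real.exp (ε * (1 + s)) - 1) (𝓝[>] 0) (𝓝 0) := by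
    have : Continuous (fun ε : ℝ => Real.exp (ε * (1 + s)) - 1) := by fun_prop
    simpa using (this.tendsto 0).mono_left nhdsWithin_le_nhds
  obtain ⟨ε, hεd, hε⟩ := ((hlim.eventually (gt_mem_nhds hd)).and self_mem_nhdsWithin).exists
  exact ⟨ε, hε, hεd⟩

lemma exists_lt_chiSqCDF {d : ℝ} (hd : 0 < d) :
    ∃ s : ℝ, 0 ≤ s ∧ 1 - d < chiSqCDF (Fin q ⊕ Fin k) s := by
  obtain ⟨s, hs, hs0⟩ := (((tendsto_chiSqCDF_atTop (Fin q ⊕ Fin k)).eventually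
    (lt_mem_nhds (show 1 - d < 1 by linarith))).and (eventually_ge_atTop 0)).exists
  exact ⟨s, hs0, hs⟩

lemma tvLe (h : AsympNormalPosterior l m V N post p) {d : ℝ} (hd : 0 < d) :
    ∀ᶠ z in l, TVLe (post z) (multivariateGaussian (m z) (V z)) d := by
  obtain ⟨s, hs0, hs⟩ := exists_lt_chiSqCDF (q := q) (k := k) (half_pos hd)
  obtain ⟨ε, hε, hεd⟩ := exists_exp_lt s (show 0 < d / 4 by linarith)
  filter_upwards [h.posDef, h.prob, h.apply, h.near ε hε, h.ellipsoid s] with z h1 h2 h3 h4 h5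
  exact (h4.tvLe h1 hε.le hs0 h5 h3).mono (by linarith)

lemma abs_div_sub_one_lt (h : AsympNormalPosterior l m V N post p) (s : ℝ) {d : ℝ} (hd : 0 < d) :
    ∀ᶠ z in l, ∀ x, quadForm (V z)⁻¹ (x - m z) ≤ s →
      |p z x / normalDensity (m z) (V z) x - 1| < d := by
  obtain ⟨ε, hε, hεd⟩ := exists_exp_lt s hd
  filter_upwards [h.posDef, h.near ε hε, h.ellipsoid s] with z h1 h4 h5 x hx
  exact (h4.abs_div_sub_one_le h1 hε.le (h5 x hx) hx).trans_lt hεd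

lemma tendsto_normal_nhd (h : AsympNormalPosterior l m V N post p) :
    Tendsto (fun z => (multivariateGaussian (m z) (V z)).real (N z)) l (𝓝 1) := by
  refine tendsto_order.2 ⟨fun a ha => ?_, fun a ha => Eventually.of_forall fun z =>
    measureReal_le_one.trans_lt ha⟩
  obtain ⟨s, hs0, hs⟩ := exists_lt_chiSqCDF (q := q) (k := k) (sub_pos.2 ha)
  filter_upwards [h.posDef, h.ellipsoid s] with z h1 h2
  calc a < chiSqCDF _ s := by linarith
    _ = (multivariateGaussian (m z) (V z)).real {x | quadForm (V z)⁻¹ (x - m z) ≤ s} :=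
        (multivariateGaussian_quadForm_le h1 _ _).symm
    _ ≤ _ := measureReal_mono h2

lemma measurableSet_ellipsoid (S : Matrix (Fin q ⊕ Fin k) (Fin q ⊕ Fin k) ℝ) (ζ : Par q k)
    (s : ℝ) : MeasurableSet {x | quadForm S (x - ζ) ≤ s} :=
  (isClosed_le (by fun_prop) continuous_const).measurableSet

/-- The posterior probabilities of ellipsoids. -/
lemma abs_ellipsoid_sub_le (h : AsympNormalPosterior l m V N post p) {d : ℝ} (hd : 0 < d) :
    ∀ᶠ z in l, ∀ s, |(post z).real {x | quadForm (V z)⁻¹ (x - m z) ≤ s} -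
      chiSqCDF (Fin q ⊕ Fin k) s| ≤ d := by
  filter_upwards [h.posDef, h.tvLe hd] with z h1 h2 s
  rw [← multivariateGaussian_quadForm_le h1 (m z) s]
  exact h2 _ (measurableSet_ellipsoid _ _ _)

lemma measureReal_compl_nhd_le (h : AsympNormalPosterior l m V N post p) {d : ℝ} (hd : 0 < d) :
    ∀ᶠ z in l, (post z).real (N z)ᶜ ≤ d := by
  obtain ⟨s, hs0, hs⟩ := exists_lt_chiSqCDF (q := q) (k := k) (half_pos hd)
  filter_upwards [h.prob, h.ellipsoid s, h.abs_ellipsoid_sub_le (half_pos hd)] with z h1 h2 h3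
  have h4 := (abs_le.1 (h3 s)).1
  have h5 : (post z).real (N z)ᶜ ≤ (post z).real {x | quadForm (V z)⁻¹ (x - m z) ≤ s}ᶜ :=
    measureReal_mono (Set.compl_subset_compl.2 h2)
  rw [probReal_compl_eq_one_sub (measurableSet_ellipsoid _ _ _)] at h5
  linarith

variable {a c δ : ℝ}

/-- The threshold of the highest posterior density region lies between the values of the normal
density on two ellipsoids close to the confidence ellipsoid, so that this region is, in `N`,
squeezed between two such ellipsoids. -/
lemma hpdRegion_bounds (h : AsympNormalPosterior l m V N post p) (hdim : 0 < q + k)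
    (hc : chiSqCDF (Fin q ⊕ Fin k) c = 1 - a) (hδ : 0 < δ) (hδc : δ < c) :
    ∀ᶠ z in l,
      {x | quadForm (V z)⁻¹ (x - m z) ≤ c - 3 * δ} ⊆ hpdRegion (post z) (p z) a ∧
      hpdRegion (post z) (p z) a ∩ N z ⊆ {x | quadForm (V z)⁻¹ (x - m z) ≤ c + 3 * δ} ∧
      hpdRegion (post z) (p z) a ⊆
        {x | normalDensity (m z) (V z) (m z) * Real.exp (-(1 / 2) * (c + 2 * δ)) ≤ p z x} := by
  have hne : Nonempty (Fin q ⊕ Fin k) := by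
    rw [← Fintype.card_pos_iff]
    simpa using hdim
  have hF1 := chiSqCDF_lt (ι := Fin q ⊕ Fin k) (s := c) (t := c + δ) (by linarith) (by linarith)
  have hF2 := chiSqCDF_lt (ι := Fin q ⊕ Fin k) (s := c - δ) (t := c) (by linarith) (by linarith)
  set F := chiSqCDF (Fin q ⊕ Fin k)
  obtain ⟨ε, hε, hε1, hε2⟩ : ∃ ε : ℝ, 0 < ε ∧ ε < 1 / 2 ∧ ε * (1 + (c + 3 * δ)) ≤ δ / 2 := by
    have hpos : 0 < 1 + (c + 3 * δ) := by linarith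
    refine ⟨min (1 / 4) (δ / 2 / (1 + (c + 3 * δ))), by positivity,
      (min_le_left _ _).trans_lt (by norm_num), ?_⟩
    rw [← le_div_iff₀ hpos]
    exact min_le_right _ _
  filter_upwards [h.posDef, h.prob, h.near ε hε, h.ellipsoid (c + 3 * δ),
    h.abs_ellipsoid_sub_le (show 0 < (F (c + δ) - F c) / 2 by linarith),
    h.abs_ellipsoid_sub_le (show 0 < (F c - F (c - δ)) / 3 by linarith),
    h.measureReal_compl_nhd_le (show 0 < (F c - F (c - δ)) / 3 by linarith)]
    with z hV hprob hnear hell hE1 hE2 hN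
  set Q : Par q k → ℝ := fun x => quadForm (V z)⁻¹ (x - m z) with hQ
  set K : ℝ → ℝ := fun s => normalDensity (m z) (V z) (m z) * Real.exp (-(1 / 2) * s) with hK
  have hφ := normalDensity_pos hV (m z) (m z)
  -- comparison of the level sets of `p` with the ellipsoids
  have hlow : ∀ s ≤ c + 3 * δ, ∀ x, Q x ≤ s → K (s + δ) ≤ p z x := by
    intro s hs x hx
    refine le_trans ?_ (hnear x (hell x (hx.trans hs))).1
    refine mul_le_mul_of_nonneg_left (Real.exp_le_exp.2 ?_) hφ.le
    change -(1 / 2) * (s + δ) ≤ -(1 / 2) * Q x - ε * (1 + Q x)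
    have h1 : ε * (1 + Q x) ≤ ε * (1 + (c + 3 * δ)) := by gcongr; linarith
    linarith
  have hup : ∀ s ≤ c + 3 * δ, ∀ x ∈ N z, s < Q x → p z x < K (s - δ) := by
    intro s hs x hxN hx
    refine lt_of_le_of_lt (hnear x hxN).2 ?_
    refine mul_lt_mul_of_pos_left (Real.exp_lt_exp.2 ?_) hφ
    change -(1 / 2) * Q x + ε * (1 + Q x) < -(1 / 2) * (s - δ)
    have h1 : ε * (1 + s) ≤ ε * (1 + (c + 3 * δ)) := by gcongr
    nlinarith
  set T := {t : ℝ | 1 - a ≤ (post z).real {x | t ≤ p z x}} with hT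
  have hmemT : K (c + 2 * δ) ∈ T := by
    have h1 : (post z).real {x | Q x ≤ c + δ} ≤ (post z).real {x | K (c + 2 * δ) ≤ p z x} := by
      refine measureReal_mono fun x hx => ?_
      have h2 := hlow (c + δ) (by linarith) x hx
      rwa [show c + δ + δ = c + 2 * δ by ring] at h2
    have h2 := (abs_le.1 (hE1 (c + δ))).1
    change 1 - a ≤ _
    linarith
  have hbound : ∀ t ∈ T, t ≤ K (c - 2 * δ) := by
    intro t ht
    by_contra! hcon
    have h1 : {x | t ≤ p z x} ⊆ {x | Q x ≤ c - δ} ∪ (N z)ᶜ := by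
      intro x hx
      by_cases hxN : x ∈ N z
      · left
        by_contra hQx
        have h2 := hup (c - δ) (by linarith) x hxN (not_le.1 hQx)
        rw [show c - δ - δ = c - 2 * δ by ring] at h2
        have h3 : t ≤ p z x := hx
        linarith
      · exact Or.inr hxN
    have h2 := (measureReal_mono (μ := post z) h1).trans (measureReal_union_le _ _)
    have h3 := (abs_le.1 (hE2 (c - δ))).2
    have h4 : 1 - a ≤ (post z).real {x | t ≤ p z x} := ht
    linarith
  have hsup1 : K (c + 2 * δ) ≤ sSup T := le_csSup ⟨_, hbound⟩ hmemT
  have hsup2 : sSup T ≤ K (c - 2 * δ) := csSup_le ⟨_, hmemT⟩ hbound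
  refine ⟨fun x hx => ?_, fun x hx => ?_, fun x hx => hsup1.trans hx⟩
  · have h1 := hlow (c - 3 * δ) (by linarith) x hx
    rw [show c - 3 * δ + δ = c - 2 * δ by ring] at h1
    exact hsup2.trans h1
  · by_contra hQx
    have h1 := hup (c + 3 * δ) le_rfl x hx.2 (not_le.1 hQx)
    rw [show c + 3 * δ - δ = c + 2 * δ by ring] at h1
    have h2 : sSup T ≤ p z x := hx.1
    linarith

lemma exists_chiSqCDF_close (hdim : 0 < q + k) (hc : 0 < c) {d : ℝ} (hd : 0 < d) :
    ∃ δ, 0 < δ ∧ δ < c ∧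
      chiSqCDF (Fin q ⊕ Fin k) (c + 3 * δ) < chiSqCDF (Fin q ⊕ Fin k) c + d ∧
      chiSqCDF (Fin q ⊕ Fin k) c - d < chiSqCDF (Fin q ⊕ Fin k) (c - 3 * δ) := by
  have hne : Nonempty (Fin q ⊕ Fin k) := by
    rw [← Fintype.card_pos_iff]
    simpa using hdim
  have hF := continuous_chiSqCDF (ι := Fin q ⊕ Fin k)
  have h1 : Tendsto (fun δ : ℝ => chiSqCDF (Fin q ⊕ Fin k) (c + 3 * δ)) (𝓝[>] 0)
      (𝓝 (chiSqCDF (Fin q ⊕ Fin k) c)) := by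
    have : Continuous fun δ : ℝ => chiSqCDF (Fin q ⊕ Fin k) (c + 3 * δ) := by fun_prop
    simpa using (this.tendsto 0).mono_left nhdsWithin_le_nhds
  have h2 : Tendsto (fun δ : ℝ => chiSqCDF (Fin q ⊕ Fin k) (c - 3 * δ)) (𝓝[>] 0)
      (𝓝 (chiSqCDF (Fin q ⊕ Fin k) c)) := by
    have : Continuous fun δ : ℝ => chiSqCDF (Fin q ⊕ Fin k) (c - 3 * δ) := by fun_prop
    simpa using (this.tendsto 0).mono_left nhdsWithin_le_nhds
  obtain ⟨δ, h3, h4, h5, h6⟩ := ((h1.eventually (gt_mem_nhds (lt_add_of_pos_right _ hd))).and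
    ((h2.eventually (lt_mem_nhds (sub_lt_self _ hd))).and
      ((show ∀ᶠ δ in 𝓝[>] (0 : ℝ), δ ∈ Set.Ioo 0 c from Ioo_mem_nhdsGT hc).and
        self_mem_nhdsWithin))).exists
  exact ⟨δ, h6, h5.2, h3, h4⟩

/-- The posterior content of the highest posterior density region, which the definition only
bounds below, tends to its nominal value. -/
lemma tendsto_hpdRegion (h : AsympNormalPosterior l m V N post p) (hdim : 0 < q + k)
    (hc0 : 0 < c) (hc : chiSqCDF (Fin q ⊕ Fin k) c = 1 - a) :
    Tendsto (fun z => (post z).real (hpdRegion (post z) (p z) a)) l (𝓝 (1 - a)) := by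
  rw [Metric.tendsto_nhds]
  intro ε hε
  obtain ⟨δ, hδ, hδc, hδ1, hδ2⟩ :=
    exists_chiSqCDF_close hdim hc0 (show 0 < ε / 4 by positivity)
  filter_upwards [h.prob, h.hpdRegion_bounds hdim hc hδ hδc,
    h.abs_ellipsoid_sub_le (show 0 < ε / 4 by positivity),
    h.measureReal_compl_nhd_le (show 0 < ε / 4 by positivity)] with z hprob hb hE hN
  have h1 := (abs_le.1 (hE (c - 3 * δ))).1
  have h2 := (abs_le.1 (hE (c + 3 * δ))).2
  have h3 := measureReal_mono (μ := post z) hb.1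
  have h4 : hpdRegion (post z) (p z) a ⊆
      {x | quadForm (V z)⁻¹ (x - m z) ≤ c + 3 * δ} ∪ (N z)ᶜ := fun x hx => by
    by_cases hxN : x ∈ N z
    · exact Or.inl (hb.2.1 ⟨hx, hxN⟩)
    · exact Or.inr hxN
  have h5 := (measureReal_mono (μ := post z) h4).trans (measureReal_union_le _ _)
  rw [Real.dist_eq, abs_lt]
  constructor <;> linarith

/-- The highest posterior density region differs from the confidence ellipsoid by a relatively
small volume. Volumes are compared through the normal density: near the ellipsoid it is bounded
below, by a multiple of its maximum, and the maximum bounds the volume of the ellipsoid below. -/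
lemma volume_symmDiff_lt (h : AsympNormalPosterior l m V N post p) (hdim : 0 < q + k)
    (ha : a < 1) (hc0 : 0 < c) (hc : chiSqCDF (Fin q ⊕ Fin k) c = 1 - a) {ε : ℝ≥0∞}
    (hε : 0 < ε) :
    ∀ᶠ z in l, volume (symmDiff (hpdRegion (post z) (p z) a) (waldRegion (m z) (V z) c)) <
      ε * volume (waldRegion (m z) (V z) c) := by
  obtain ⟨e, he, heε⟩ := ENNReal.lt_iff_exists_nnreal_btwn.1 hε
  have he' : (0 : ℝ) < e := by exact_mod_cast he
  have ha' : 0 < 1 - a := by linarith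
  have hE : 0 < Real.exp (-(1 / 2) * (c + 3 * c)) := Real.exp_pos _
  obtain ⟨δ, hδ, hδc, hδ1, hδ2⟩ := exists_chiSqCDF_close (d := e * (1 - a) *
    Real.exp (-(1 / 2) * (c + 3 * c)) / 4) hdim hc0 (by positivity)
  set d := e * (1 - a) * Real.exp (-(1 / 2) * (c + 3 * c)) / 4 with hd
  have hd0 : 0 < d := by positivity
  filter_upwards [h.posDef, h.prob, h.density, h.hpdRegion_bounds hdim hc hδ hδc,
    h.measureReal_compl_nhd_le hd0] with z hV hprob hdens hb hN
  have hφ := normalDensity_pos hV (m z) (m z)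
  set φ := normalDensity (m z) (V z) (m z) with hφdef
  set Q : Par q k → ℝ := fun x => quadForm (V z)⁻¹ (x - m z) with hQ
  set κ := φ * Real.exp (-(1 / 2) * (c + 3 * c)) with hκ
  have hκ0 : 0 < κ := by positivity
  set ν := multivariateGaussian (m z) (V z) with hν
  have hνF : ∀ s, ν.real {x | Q x ≤ s} = chiSqCDF (Fin q ⊕ Fin k) s := fun s =>
    multivariateGaussian_quadForm_le hV (m z) s
  have hνB : ∀ B, MeasurableSet B →
      ν B = ∫⁻ x in B, ENNReal.ofReal (normalDensity (m z) (V z) x) := fun B hB => by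
    rw [hν, multivariateGaussian_eq_withDensity hV, withDensity_apply _ hB]
  have hQ0 : ∀ x, 0 ≤ Q x := fun x => quadForm_nonneg hV.inv.posSemidef _
  -- the annulus
  set R : Set (Par q k) := {x | Q x ≤ c + 3 * δ} \ {x | Q x ≤ c - 3 * δ} with hR
  have hRm : MeasurableSet R :=
    (measurableSet_ellipsoid _ _ _).diff (measurableSet_ellipsoid _ _ _)
  have hR1 : ENNReal.ofReal κ * volume R ≤ ENNReal.ofReal (2 * d) := by
    have h1 : ν.real R ≤ 2 * d := by
      have h2 : {x | Q x ≤ c - 3 * δ} ⊆ {x | Q x ≤ c + 3 * δ} := fun x (hx : Q x ≤ _) =>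
        hx.trans (by linarith)
      rw [hR, measureReal_sdiff h2 (measurableSet_ellipsoid _ _ _), hνF, hνF]
      linarith
    calc ENNReal.ofReal κ * volume R = ∫⁻ _ in R, ENNReal.ofReal κ := by rw [setLIntegral_const]
      _ ≤ ∫⁻ x in R, ENNReal.ofReal (normalDensity (m z) (V z) x) := by
          refine setLIntegral_mono' hRm fun x hx => ENNReal.ofReal_le_ofReal ?_
          rw [normalDensity_eq]
          refine mul_le_mul_of_nonneg_left (Real.exp_le_exp.2 ?_) hφ.le
          have h2 : Q x ≤ c + 3 * δ := hx.1
          change _ ≤ -(1 / 2) * Q x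
          linarith
      _ = ν R := (hνB R hRm).symm
      _ = ENNReal.ofReal (ν.real R) := (ofReal_measureReal).symm
      _ ≤ _ := ENNReal.ofReal_le_ofReal h1
  -- the part outside the neighbourhood
  have hO : ENNReal.ofReal κ * volume (hpdRegion (post z) (p z) a \ N z) ≤ ENNReal.ofReal d := by
    have h1 := hdens.mul_volume_le κ
    have h2 : hpdRegion (post z) (p z) a \ N z ⊆ {x | κ ≤ p z x} \ N z := by
      refine Set.sdiff_subset_sdiff_left fun x hx => ?_
      have h3 : φ * Real.exp (-(1 / 2) * (c + 2 * δ)) ≤ p z x := hb.2.2 hx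
      refine le_trans ?_ h3
      refine mul_le_mul_of_nonneg_left (Real.exp_le_exp.2 ?_) hφ.le
      linarith
    refine le_trans (mul_le_mul_right (measure_mono h2) _) (h1.trans ?_)
    rw [← ofReal_measureReal]
    exact ENNReal.ofReal_le_ofReal hN
  have hW : ENNReal.ofReal (1 - a) ≤ ENNReal.ofReal φ * volume (waldRegion (m z) (V z) c) := by
    have hWm : MeasurableSet (waldRegion (m z) (V z) c) := measurableSet_ellipsoid _ _ _
    calc ENNReal.ofReal (1 - a) = ENNReal.ofReal (ν.real (waldRegion (m z) (V z) c)) := by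
          rw [← hc, ← hνF c]; rfl
      _ = ν (waldRegion (m z) (V z) c) := ofReal_measureReal
      _ = ∫⁻ x in waldRegion (m z) (V z) c, ENNReal.ofReal (normalDensity (m z) (V z) x) :=
          hνB _ hWm
      _ ≤ ∫⁻ _ in waldRegion (m z) (V z) c, ENNReal.ofReal φ := by
          refine lintegral_mono fun x => ENNReal.ofReal_le_ofReal ?_
          rw [normalDensity_eq]
          refine mul_le_of_le_one_right hφ.le (Real.exp_le_one_iff.2 ?_)
          have := hQ0 x
          change -(1 / 2) * Q x ≤ 0
          linarith
      _ = _ := by rw [setLIntegral_const]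
  have hsub : symmDiff (hpdRegion (post z) (p z) a) (waldRegion (m z) (V z) c) ⊆
      R ∪ (hpdRegion (post z) (p z) a \ N z) := by
    rintro x (⟨hx1, hx2⟩ | ⟨hx1, hx2⟩)
    · by_cases hxN : x ∈ N z
      · refine Or.inl ⟨hb.2.1 ⟨hx1, hxN⟩, fun hx3 => hx2 ?_⟩
        exact le_trans (show Q x ≤ c - 3 * δ from hx3) (by linarith)
      · exact Or.inr ⟨hx1, hxN⟩
    · exact Or.inl ⟨le_trans (show Q x ≤ c from hx1) (by linarith), fun hx3 => hx2 (hb.1 hx3)⟩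
  set D := volume (symmDiff (hpdRegion (post z) (p z) a) (waldRegion (m z) (V z) c)) with hD
  have hD1 : ENNReal.ofReal κ * D ≤ ENNReal.ofReal (3 * d) := by
    calc ENNReal.ofReal κ * D ≤ ENNReal.ofReal κ * (volume R +
          volume (hpdRegion (post z) (p z) a \ N z)) :=
          mul_le_mul_right ((measure_mono hsub).trans (measure_union_le _ _)) _
      _ ≤ ENNReal.ofReal (2 * d) + ENNReal.ofReal d := by
          rw [mul_add]; exact add_le_add hR1 hO
      _ = _ := by rw [← ENNReal.ofReal_add (by positivity) hd0.le]; congr 1; ring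
  have hκne : ENNReal.ofReal κ ≠ 0 := (ENNReal.ofReal_pos.2 hκ0).ne'
  have hφne : ENNReal.ofReal φ ≠ 0 := (ENNReal.ofReal_pos.2 hφ).ne'
  calc D ≤ ENNReal.ofReal (3 * d / κ) := by
        rw [ENNReal.ofReal_div_of_pos hκ0, ENNReal.le_div_iff_mul_le (Or.inl hκne)
          (Or.inl ENNReal.ofReal_ne_top), mul_comm]
        exact hD1
    _ < ENNReal.ofReal (e * ((1 - a) / φ)) := by
        refine (ENNReal.ofReal_lt_ofReal_iff (by positivity)).2 ?_
        rw [div_lt_iff₀ hκ0, hκ]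
        have h1 : e * ((1 - a) / φ) * (φ * Real.exp (-(1 / 2) * (c + 3 * c))) = 4 * d := by
          rw [hd]; field_simp
        rw [h1]; linarith
    _ = e * ENNReal.ofReal ((1 - a) / φ) := by
        rw [ENNReal.ofReal_mul he'.le, ENNReal.ofReal_coe_nnreal]
    _ ≤ ε * volume (waldRegion (m z) (V z) c) := by
        refine mul_le_mul' heε.le ?_
        rw [ENNReal.ofReal_div_of_pos hφ, ENNReal.div_le_iff_le_mul (Or.inl hφne)
          (Or.inl ENNReal.ofReal_ne_top), mul_comm]
        exact hW

end AsympNormalPosterior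

end Posterior

/-! ### The posterior of the parameter -/

section Linearized

variable {α : Type*} {l : Filter α} {q k : ℕ} {n : α → ℕ} {r : ℕ → ℝ} {U : α → Par q k → Par q k}
  {Z : Set (Par q k)} {ζ₀ : Par q k} {m : α → Par q k} {G : Par q k →L[ℝ] Par q k} {κ : ℝ}

/-- A set of points at distance of order `n^{-1/2}` lies within the radius `r n`. -/
lemma eventually_le_radius (hr' : Tendsto (fun n : ℕ => r n * √n) atTop atTop) {C b : ℝ}
    (hC : 0 < C) (hb : 0 < b) (s : ℝ) :
    ∀ᶠ n : ℕ in atTop, ∀ y : ℝ, 0 ≤ y → (n : ℝ) * (C * y ^ 2) ≤ s → y ≤ b * r n := by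
  have h1 : Tendsto (fun n : ℕ => C * b ^ 2 * (r n * √n) ^ 2) atTop atTop :=
    ((tendsto_pow_atTop (by norm_num)).comp hr').const_mul_atTop (by positivity)
  filter_upwards [h1.eventually_gt_atTop s, eventually_radius_pos hr'] with n hn hrn y hy0 hy
  by_contra! hcon
  rw [mul_pow, Real.sq_sqrt (Nat.cast_nonneg n)] at hn
  have h2 : (b * r n) ^ 2 ≤ y ^ 2 := pow_le_pow_left₀ (by positivity) hcon.le 2
  have h3 : (n : ℝ) * (C * (b * r n) ^ 2) ≤ n * (C * y ^ 2) := by gcongr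
  nlinarith

/-- Along the filter `l`, the equations `U ζ = 0` are nearly linear, with the non-singular
derivative `G`, in the ball around `ζ₀` with radius `r n`; they have the solution `m` close to the
centre, and all values up to the order `r n` are attained in the ball. -/
structure Linearized (l : Filter α) (n : α → ℕ) (r : ℕ → ℝ) (U : α → Par q k → Par q k)
    (Z : Set (Par q k)) (ζ₀ : Par q k) (m : α → Par q k) (G : Par q k →L[ℝ] Par q k) (κ : ℝ) :
    Prop where
  det_ne : G.det ≠ 0
  index : Tendsto n l atTop
  radius : Tendsto (fun n : ℕ => r n * √n) atTop atTop
  subset : ∀ᶠ z in l, Metric.ball ζ₀ (r (n z)) ⊆ Z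
  contDiffOn : ∀ᶠ z in l, ContDiffOn ℝ 1 (U z) (Metric.ball ζ₀ (r (n z)))
  injOn : ∀ᶠ z in l, Set.InjOn (U z) (Metric.ball ζ₀ (r (n z)))
  jacobian : ∀ ε : ℝ, 0 < ε → ∀ᶠ z in l,
    ∀ ζ ∈ Metric.ball ζ₀ (r (n z)), ‖fderiv ℝ (U z) ζ - G‖ < ε
  linear : ∀ c : NNReal, 0 < c → ∀ᶠ z in l,
    ApproximatesLinearOn (U z) G (Metric.ball ζ₀ (r (n z))) c
  pos : 0 < κ
  image : ∀ᶠ z in l, Metric.closedBall 0 (κ * r (n z)) ⊆ U z '' Metric.ball ζ₀ (r (n z))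
  zero : ∀ᶠ z in l, U z (m z) = 0
  close : ∀ ρ : ℝ, 0 < ρ → ∀ᶠ z in l, ‖m z - ζ₀‖ ≤ ρ * r (n z)

namespace Linearized

variable {S₀ : Matrix (Fin q ⊕ Fin k) (Fin q ⊕ Fin k) ℝ}
  {T : α → Matrix (Fin q ⊕ Fin k) (Fin q ⊕ Fin k) ℝ}

lemma eventually_radius_pos (h : Linearized l n r U Z ζ₀ m G κ) : ∀ᶠ z in l, 0 < r (n z) :=
  h.index.eventually (BayesPS.eventually_radius_pos h.radius)

lemma eventually_index_pos (h : Linearized l n r U Z ζ₀ m G κ) : ∀ᶠ z in l, 0 < (n z : ℝ) := by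
  filter_upwards [h.index.eventually (eventually_gt_atTop 0)] with z hz
  exact_mod_cast hz

/-- Normal laws with variance of the order `1 / n` are concentrated on balls with radius of the
order `r n`. -/
lemma eventually_le_measureReal_closedBall (h : Linearized l n r U Z ζ₀ m G κ) (hS₀ : S₀.PosDef)
    (hT : Tendsto T l (𝓝 S₀)) (hsymm : ∀ᶠ z in l, (T z).IsSymm) {b ε : ℝ} (hb : 0 < b)
    (hε : 0 < ε) :
    ∀ᶠ z in l, 1 - ε ≤
      (multivariateGaussian 0 ((n z : ℝ)⁻¹ • T z)).real (Metric.closedBall 0 (b * r (n z))) := by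
  obtain ⟨s, hs0, hs⟩ := AsympNormalPosterior.exists_lt_chiSqCDF (q := q) (k := k) hε
  obtain ⟨C, hC, hCle⟩ := exists_le_quadForm hS₀.inv
  filter_upwards [hsymm, hT.eventually (eventually_posDef hS₀),
    hT.eventually (eventually_abs_quadForm_inv_sub_le hS₀ (show (0 : ℝ) < 1 / 2 by norm_num)),
    h.index.eventually (eventually_le_radius h.radius (half_pos hC) hb s),
    h.eventually_index_pos] with z h1 h2 h3 h4 h5
  have hpd := h2 h1
  have hpd' : ((n z : ℝ)⁻¹ • T z).PosDef := hpd.smul (inv_pos.2 h5)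
  refine hs.le.trans ?_
  rw [← multivariateGaussian_quadForm_le hpd' 0 s]
  refine measureReal_mono fun x hx => ?_
  rw [mem_closedBall_zero_iff]
  refine h4 _ (norm_nonneg x) ?_
  have h6 : quadForm ((n z : ℝ)⁻¹ • T z)⁻¹ (x - 0) ≤ s := hx
  rw [sub_zero, quadForm_smul_inv hpd.det_pos.ne' (inv_pos.2 h5).ne', inv_inv] at h6
  refine le_trans (mul_le_mul_of_nonneg_left ?_ h5.le) h6
  have h7 := (abs_le.1 (h3 x)).1
  have h8 := hCle x
  linarith

lemma eventually_mem_nhd (h : Linearized l n r U Z ζ₀ m G κ) :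
    ∀ᶠ z in l, m z ∈ Metric.ball ζ₀ (r (n z)) := by
  filter_upwards [h.close (1 / 2) (by norm_num), h.eventually_radius_pos] with z h1 h2
  rw [mem_ball_iff_norm]
  linarith

/-- The posterior of `ζ` obtained by solving `U ζ = η*` for a normally distributed `η*` is
asymptotically normal. -/
lemma asympNormalPosterior (h : Linearized l n r U Z ζ₀ m G κ) (hS₀ : S₀.PosDef)
    (hT : Tendsto T l (𝓝 S₀)) (hsymm : ∀ᶠ z in l, (T z).IsSymm)
    {V : α → Matrix (Fin q ⊕ Fin k) (Fin q ⊕ Fin k) ℝ} (hV : ∀ᶠ z in l, (V z).PosDef)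
    (hVq : ∀ᶠ z in l, ∀ x, quadForm (V z)⁻¹ x = n z * quadForm S₀⁻¹ (G x))
    (hVd : ∀ᶠ z in l, normalDensity (m z) (V z) (m z) =
      |G.det| * normalDensity 0 ((n z : ℝ)⁻¹ • S₀) 0)
    {solve : α → Par q k → Par q k}
    (hsolve : ∀ᶠ z in l, IsSolver (U z) Z (Metric.ball ζ₀ (r (n z)))
      (multivariateGaussian 0 ((n z : ℝ)⁻¹ • T z)) (solve z))
    {post : α → Measure (Par q k)}
    (hpost : ∀ z, post z = twoStep (U z) Z (multivariateGaussian 0 ((n z : ℝ)⁻¹ • T z)) (solve z))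
    {p : α → Par q k → ℝ}
    (hp : ∀ᶠ z in l, IsDensity (post z) (Metric.ball ζ₀ (r (n z))) (p z)) :
    AsympNormalPosterior l m V (fun z => Metric.ball ζ₀ (r (n z))) post p := by
  -- the law of the draw charges the set of values of `U`
  have himage : ∀ ε : ℝ, 0 < ε → ∀ᶠ z in l,
      1 - ε ≤ (multivariateGaussian 0 ((n z : ℝ)⁻¹ • T z)).real (U z '' Z) := by
    intro ε hε
    filter_upwards [h.eventually_le_measureReal_closedBall hS₀ hT hsymm h.pos hε, h.image,
      h.subset] with z h1 h2 h3
    exact h1.trans (measureReal_mono (h2.trans (Set.image_mono h3)))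
  have hne : ∀ᶠ z in l, multivariateGaussian 0 ((n z : ℝ)⁻¹ • T z) (U z '' Z) ≠ 0 := by
    filter_upwards [himage (1 / 2) (by norm_num)] with z hz h0
    rw [measureReal_def, h0] at hz
    norm_num at hz
  have hprob : ∀ᶠ z in l, IsProbabilityMeasure (post z) := by
    filter_upwards [hsolve, hne] with z h1 h2
    rw [hpost]
    exact isProbabilityMeasure_twoStep h1 h2
  set g : α → Par q k → ℝ := fun z ζ => normalDensity 0 ((n z : ℝ)⁻¹ • T z) (U z ζ) *
    |(fderiv ℝ (U z) ζ).det| / (multivariateGaussian 0 ((n z : ℝ)⁻¹ • T z)).real (U z '' Z)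
    with hg
  have hTpd : ∀ᶠ z in l, (T z).PosDef := by
    filter_upwards [hsymm, hT.eventually (eventually_posDef hS₀)] with z h1 h2 using h2 h1
  have happly : ∀ᶠ z in l, ∀ B, MeasurableSet B → B ⊆ Metric.ball ζ₀ (r (n z)) →
      post z B = ∫⁻ x in B, ENNReal.ofReal (g z x) := by
    filter_upwards [hsolve, hne, h.subset, h.injOn, h.contDiffOn, hTpd, h.eventually_index_pos]
      with z h1 h2 h3 h4 h5 h6 h7 B hB hBN
    rw [hpost]
    refine twoStep_apply_eq_lintegral h1 h3 h4 (fun ζ hζ => ?_)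
      (multivariateGaussian_eq_withDensity (h6.smul (inv_pos.2 h7)) 0) h2 hB hBN
    exact (h5.contDiffAt (Metric.isOpen_ball.mem_nhds hζ)).differentiableAt one_ne_zero
  have hpg : ∀ᶠ z in l, Set.EqOn (p z) (g z) (Metric.ball ζ₀ (r (n z))) := by
    filter_upwards [happly, hp, hprob, h.contDiffOn] with z h1 h2 h3 h4
    refine h2.eqOn Metric.isOpen_ball ?_ (fun ζ _ => ?_) h1
    · have hU := h4.continuousOn
      have hD := h4.continuousOn_fderiv_of_isOpen Metric.isOpen_ball le_rfl
      have hdet := (ContinuousLinearMap.continuous_det (E := Par q k)).comp_continuousOn hD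
      exact (((continuous_normalDensity _ _).comp_continuousOn hU).mul hdet.abs).div_const _
    · have := normalDensity_nonneg 0 ((n z : ℝ)⁻¹ • T z) (U z ζ)
      positivity
  refine ⟨hV, hprob, hp, ?_, fun ε hε => ?_, fun s => ?_⟩
  · filter_upwards [happly, hpg] with z h1 h2 B hB hBN
    rw [h1 B hB hBN]
    refine setLIntegral_congr_fun hB fun x hx => ?_
    rw [h2 (hBN hx)]
  · -- the three factors of the density that tend to one
    set δ : ℝ := min (ε / 3) 1 with hδ
    have hδ0 : 0 < δ := by positivity
    have hexp1 : Real.exp (-(ε / 3)) < 1 := by simpa using hε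
    have hexp2 : 1 < Real.exp (ε / 3) := by simpa using hε
    have hdet0 := hS₀.det_pos
    have hdetG := abs_pos.2 h.det_ne
    have hf1 : ∀ᶠ z in l, Real.exp (-(ε / 3)) < √S₀.det / √(T z).det ∧
        √S₀.det / √(T z).det < Real.exp (ε / 3) := by
      have h1 : Tendsto (fun z => √(T z).det) l (𝓝 √S₀.det) :=
        (((Continuous.matrix_det continuous_id).sqrt).tendsto S₀).comp hT
      have h2 := (Real.sqrt_pos.2 hdet0).ne'
      have h3 := (tendsto_const_nhds (x := √S₀.det)).div h1 h2
      rw [div_self h2] at h3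
      exact (h3.eventually (lt_mem_nhds hexp1)).and (h3.eventually (gt_mem_nhds hexp2))
    have hf2 : ∀ᶠ z in l, ∀ ζ ∈ Metric.ball ζ₀ (r (n z)),
        Real.exp (-(ε / 3)) < |(fderiv ℝ (U z) ζ).det| / |G.det| ∧
        |(fderiv ℝ (U z) ζ).det| / |G.det| < Real.exp (ε / 3) := by
      have h1 : Tendsto (fun D : Par q k →L[ℝ] Par q k => |D.det| / |G.det|) (𝓝 G) (𝓝 1) := by
        have h2 : Continuous fun D : Par q k →L[ℝ] Par q k => |D.det| / |G.det| :=
          ContinuousLinearMap.continuous_det.abs.div_const _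
        simpa [hdetG.ne'] using h2.tendsto G
      obtain ⟨η, hη, hball⟩ := Metric.eventually_nhds_iff_ball.1
        ((h1.eventually (lt_mem_nhds hexp1)).and (h1.eventually (gt_mem_nhds hexp2)))
      filter_upwards [h.jacobian η hη] with z hz ζ hζ
      exact hball _ (mem_ball_iff_norm.2 (hz ζ hζ))
    have hf3 : ∀ᶠ z in l,
        Real.exp (-(ε / 3)) <
          ((multivariateGaussian 0 ((n z : ℝ)⁻¹ • T z)).real (U z '' Z))⁻¹ ∧
        ((multivariateGaussian 0 ((n z : ℝ)⁻¹ • T z)).real (U z '' Z))⁻¹ <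
          Real.exp (ε / 3) := by
      have hpos : 0 < (1 - Real.exp (-(ε / 3))) / 2 := by linarith
      filter_upwards [himage _ hpos] with z hz
      have h1 : (multivariateGaussian 0 ((n z : ℝ)⁻¹ • T z)).real (U z '' Z) ≤ 1 :=
        measureReal_le_one
      have h2 : Real.exp (-(ε / 3)) <
          (multivariateGaussian 0 ((n z : ℝ)⁻¹ • T z)).real (U z '' Z) := by linarith
      have h3 := (Real.exp_pos (-(ε / 3))).trans h2
      refine ⟨hexp1.trans_le ((one_le_inv₀ h3).2 h1), ?_⟩
      rw [show Real.exp (ε / 3) = (Real.exp (-(ε / 3)))⁻¹ by rw [Real.exp_neg, inv_inv]]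
      exact inv_strictAnti₀ (Real.exp_pos _) h2
    obtain ⟨c, hc, hcq⟩ := exists_abs_quadForm_sub_le hS₀.inv h.det_ne hδ0
    filter_upwards [hf1, hf2, hf3, hpg, h.linear c hc, h.zero, h.eventually_mem_nhd,
      hT.eventually (eventually_abs_quadForm_inv_sub_le hS₀ hδ0), hTpd, h.eventually_index_pos,
      hVq, hVd] with z hf1 hf2 hf3 hpg hlin hzero hmem hTq hTpd hn hVq hVd x hx
    have hn' : (n z : ℝ)⁻¹ ≠ 0 := (inv_pos.2 hn).ne'
    have hlinx := hlin x hx (m z) hmem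
    rw [hzero, sub_zero] at hlinx
    have hq1 := abs_le.1 (hcq _ _ hlinx)
    have hq2 := abs_le.1 (hTq (U z x))
    have hq3 : 0 ≤ quadForm S₀⁻¹ (G (x - m z)) := quadForm_nonneg hS₀.inv.posSemidef _
    have hnd := normalDensity_self_mul_sqrt_det hTpd.det_pos hdet0 (inv_pos.2 hn) 0 0
    have hndpos := normalDensity_pos (hS₀.smul (inv_pos.2 hn)) 0 0
    have hsqT := Real.sqrt_pos.2 hTpd.det_pos
    rw [hpg hx, hVd, hVq]
    set ℓ := (multivariateGaussian 0 ((n z : ℝ)⁻¹ • T z)).real (U z '' Z)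
    set e := quadForm (T z)⁻¹ (U z x)
    set b := quadForm S₀⁻¹ (U z x)
    set t := quadForm S₀⁻¹ (G (x - m z))
    set D := |(fderiv ℝ (U z) x).det|
    set φ := normalDensity 0 ((n z : ℝ)⁻¹ • S₀) 0
    have hgx : g z x = |G.det| * φ * ((√S₀.det / √(T z).det) * (D / |G.det|) * ℓ⁻¹ *
        Real.exp (-(1 / 2) * (n z * e))) := by
      have h1 : normalDensity 0 ((n z : ℝ)⁻¹ • T z) 0 = φ * (√S₀.det / √(T z).det) := by
        rw [mul_div_assoc', ← hnd]
        field_simp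
      simp only [hg]
      rw [normalDensity_eq, h1, sub_zero, quadForm_smul_inv hTpd.det_pos.ne' hn', inv_inv]
      change φ * (√S₀.det / √(T z).det) * Real.exp (-(1 / 2) * (n z * e)) * D / ℓ = _
      have h2 : D = |G.det| * (D / |G.det|) := by field_simp
      rw [div_eq_mul_inv]
      nth_rewrite 1 [h2]
      ring
    -- the quadratic forms in the exponents agree up to a relative error `3 δ ≤ ε`
    have hδ1 : δ ≤ 1 := min_le_right _ _
    have hδε : δ ≤ ε / 3 := min_le_left _ _
    have he1 : e ≤ t + ε * t := by nlinarith
    have he2 : t - ε * t ≤ e := by nlinarith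
    have he3 : n z * e ≤ n z * t + ε * (n z * t) := by
      have := mul_le_mul_of_nonneg_left he1 hn.le
      linarith
    have he4 : n z * t - ε * (n z * t) ≤ n z * e := by
      have := mul_le_mul_of_nonneg_left he2 hn.le
      linarith
    have hnt : 0 ≤ ε * (n z * t) := by positivity
    have hD0 : 0 ≤ D / |G.det| := by positivity
    have hℓ0 : 0 ≤ ℓ⁻¹ := inv_nonneg.2 measureReal_nonneg
    obtain ⟨hf2a, hf2b⟩ := hf2 x hx
    rw [hgx]
    constructor
    · refine mul_le_mul_of_nonneg_left ?_ (by positivity)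
      calc Real.exp (-(1 / 2) * (n z * t) - ε * (1 + n z * t))
          = Real.exp (-(ε / 3)) * Real.exp (-(ε / 3)) * Real.exp (-(ε / 3)) *
            Real.exp (-(1 / 2) * (n z * t) - ε * (n z * t)) := by
            rw [← Real.exp_add, ← Real.exp_add, ← Real.exp_add]; congr 1; ring
        _ ≤ _ := by
            refine mul_le_mul (mul_le_mul (mul_le_mul hf1.1.le hf2a.le (Real.exp_pos _).le
              (by positivity)) hf3.1.le (Real.exp_pos _).le (by positivity))
              (Real.exp_le_exp.2 (by linarith)) (Real.exp_pos _).le (by positivity)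
    · refine mul_le_mul_of_nonneg_left ?_ (by positivity)
      calc _ ≤ Real.exp (ε / 3) * Real.exp (ε / 3) * Real.exp (ε / 3) *
            Real.exp (-(1 / 2) * (n z * t) + ε * (n z * t)) := by
            refine mul_le_mul (mul_le_mul (mul_le_mul hf1.2.le hf2b.le hD0
              (Real.exp_pos _).le) hf3.2.le hℓ0 (by positivity))
              (Real.exp_le_exp.2 (by linarith)) (Real.exp_pos _).le (by positivity)
        _ = Real.exp (-(1 / 2) * (n z * t) + ε * (1 + n z * t)) := by
            rw [← Real.exp_add, ← Real.exp_add, ← Real.exp_add]; congr 1; ring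
  · obtain ⟨C, hC, hCle⟩ := exists_le_quadForm hS₀.inv
    obtain ⟨a, ha, haG⟩ : ∃ a : ℝ, 0 < a ∧ ∀ t, a * ‖t‖ ≤ ‖G t‖ := exists_le_norm h.det_ne
    filter_upwards [hVq, h.index.eventually (eventually_le_radius h.radius
      (show 0 < C * a ^ 2 by positivity) (show (0 : ℝ) < 1 / 4 by norm_num) s),
      h.close (1 / 4) (by norm_num), h.eventually_radius_pos] with z h1 h2 h3 h4 x hx
    rw [h1] at hx
    have h5 : C * a ^ 2 * ‖x - m z‖ ^ 2 ≤ quadForm S₀⁻¹ (G (x - m z)) := by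
      refine le_trans ?_ (hCle _)
      have := pow_le_pow_left₀ (by positivity) (haG (x - m z)) 2
      nlinarith
    have h6 := h2 ‖x - m z‖ (norm_nonneg _)
      ((mul_le_mul_of_nonneg_left h5 (Nat.cast_nonneg _)).trans hx)
    rw [mem_ball_iff_norm]
    calc ‖x - ζ₀‖ ≤ ‖x - m z‖ + ‖m z - ζ₀‖ := norm_sub_le_norm_sub_add_norm_sub _ _ _
      _ < r (n z) := by linarith

end Linearized

end Linearized

/-! ### The posterior of the mean function -/

section EtaPosterior

variable {q k : ℕ}

lemma normalDensity_comm {ι : Type*} [Fintype ι] [DecidableEq ι] (m x : EuclideanSpace ℝ ι)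
    (S : Matrix ι ι ℝ) : normalDensity m S x = normalDensity x S m := by
  rw [normalDensity, normalDensity, ← neg_sub, quadForm_neg]

open scoped MatrixOrder in
lemma integral_norm_multivariateGaussian_le {ι : Type*} [Fintype ι] [DecidableEq ι]
    {S : Matrix ι ι ℝ} (hS : S.PosDef) {κ : ℝ} (hκ : 0 < κ)
    (h : ∀ x, κ * ‖x‖ ^ 2 ≤ quadForm S⁻¹ x) :
    ∫ x, ‖x‖ ∂multivariateGaussian 0 S ≤
      (√κ)⁻¹ * ∫ x : EuclideanSpace ℝ ι, ‖x‖ ∂stdGaussian _ := by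
  have hint : Integrable (fun x : EuclideanSpace ℝ ι => ‖x‖) (stdGaussian _) :=
    IsGaussian.integrable_fun_id.norm
  rw [multivariateGaussian, integral_map (by fun_prop) (by fun_prop), ← integral_const_mul]
  refine integral_mono_of_nonneg (Eventually.of_forall fun _ => norm_nonneg _)
    (hint.const_mul _) (Eventually.of_forall fun x => ?_)
  simp only [zero_add]
  have h1 := h (Matrix.toEuclideanCLM (𝕜 := ℝ) (CFC.sqrt S) x)
  rw [quadForm_inv_sqrt hS] at h1
  have h2 := Real.sqrt_le_sqrt h1
  rw [Real.sqrt_mul hκ.le, Real.sqrt_sq (norm_nonneg _), Real.sqrt_sq (norm_nonneg _)] at h2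
  rwa [inv_mul_eq_div, le_div_iff₀ (Real.sqrt_pos.2 hκ), mul_comm]

variable {S : Matrix (Fin q ⊕ Fin k) (Fin q ⊕ Fin k) ℝ} {prior : Par q k → ℝ} {H : Set (Par q k)}
  {n : ℕ}

lemma etaPosterior_ac : etaPosterior S prior H n ≪ volume :=
  Measure.AbsolutelyContinuous.smul_left
    ((withDensity_absolutelyContinuous _ _).trans Measure.restrict_le_self.absolutelyContinuous) _

/-- The unnormalized posterior of `η` has the density `prior` with respect to the normal
distribution. -/
lemma withDensity_prior_eq (hH : PriorRegular prior H) (hS : ((n : ℝ)⁻¹ • S).PosDef) :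
    (volume.restrict H).withDensity
      (fun e => ENNReal.ofReal (normalDensity e ((n : ℝ)⁻¹ • S) 0 * prior e)) =
    ((multivariateGaussian 0 ((n : ℝ)⁻¹ • S)).restrict H).withDensity
      (fun e => ENNReal.ofReal (prior e)) := by
  obtain ⟨hHm, -, -, K, hK⟩ := hH
  have hm : AEMeasurable (fun e => ENNReal.ofReal (prior e)) (volume.restrict H) :=
    (hK.continuousOn.aemeasurable hHm).ennreal_ofReal
  rw [multivariateGaussian_eq_withDensity hS, restrict_withDensity hHm,
    ← withDensity_mul₀ (by fun_prop) hm]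
  congr 1
  ext e
  rw [Pi.mul_apply, ← ENNReal.ofReal_mul (normalDensity_nonneg _ _ _), normalDensity_comm]

/-- If the likelihood is concentrated near `0`, where the prior density is nearly constant, then
the posterior of `η` is close to the normalized likelihood. -/
lemma etaPosterior_tvLe (hH : PriorRegular prior H) {K : NNReal} (hK : LipschitzOnWith K prior H)
    (hS : ((n : ℝ)⁻¹ • S).PosDef) {d : ℝ}
    (hd : K * ∫ x, ‖x‖ ∂multivariateGaussian 0 ((n : ℝ)⁻¹ • S) +
      prior 0 * (multivariateGaussian 0 ((n : ℝ)⁻¹ • S)).real Hᶜ ≤ d)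
    (hd2 : d ≤ prior 0 / 2) :
    IsProbabilityMeasure (etaPosterior S prior H n) ∧
    TVLe (etaPosterior S prior H n) (multivariateGaussian 0 ((n : ℝ)⁻¹ • S))
      (4 * d / prior 0) := by
  have hHm := hH.1
  have h0H : (0 : Par q k) ∈ H := mem_of_mem_nhds hH.2.1
  have hpos := hH.2.2.1
  have ha := hpos 0 h0H
  have heq := withDensity_prior_eq hH hS
  set a := prior 0 with haDef
  set γ := multivariateGaussian 0 ((n : ℝ)⁻¹ • S) with hγ
  set μ : Measure (Par q k) := (γ.restrict H).withDensity (fun e => ENNReal.ofReal (prior e))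
    with hμ
  have hpm : AEMeasurable prior (γ.restrict H) := hK.continuousOn.aemeasurable hHm
  have hnorm : Integrable (fun x : Par q k => ‖x‖) γ := IsGaussian.integrable_fun_id.norm
  have hlip : ∀ e ∈ H, |prior e - a| ≤ K * ‖e‖ := fun e he => by
    simpa [Real.dist_eq] using hK.dist_le_mul e he 0 h0H
  have hdiff : Integrable (fun e => prior e - a) (γ.restrict H) := by
    refine ((hnorm.const_mul K).restrict (s := H)).mono' (hpm.sub_const a).aestronglyMeasurable ?_
    filter_upwards [ae_restrict_mem hHm] with e he using hlip e he
  have hpi : Integrable prior (γ.restrict H) :=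
    (hdiff.add (integrable_const a)).congr (Eventually.of_forall fun e => by simp)
  have key : ∀ B, MeasurableSet B → |μ.real B - a * γ.real B| ≤ d := by
    intro B hB
    have hBH : MeasurableSet (B ∩ H) := hB.inter hHm
    have h1 : μ.real B = ∫ e in B ∩ H, prior e ∂γ := by
      rw [measureReal_def, hμ, withDensity_apply _ hB, Measure.restrict_restrict hB,
        integral_eq_lintegral_of_nonneg_ae]
      · filter_upwards [ae_restrict_mem hBH] with e he using (hpos e he.2).le
      · exact (hpm.mono_measure (Measure.restrict_mono_set _
          Set.inter_subset_right)).aestronglyMeasurable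
    have h2 : ∫ e in B ∩ H, (prior e - a) ∂γ = μ.real B - a * γ.real (B ∩ H) := by
      rw [integral_sub (hpi.mono_measure (Measure.restrict_mono_set _ Set.inter_subset_right))
        (integrable_const a), ← h1, setIntegral_const, smul_eq_mul, mul_comm]
    have h3 : |∫ e in B ∩ H, (prior e - a) ∂γ| ≤ K * ∫ x, ‖x‖ ∂γ := by
      rw [← integral_const_mul, ← Real.norm_eq_abs]
      refine (norm_integral_le_of_norm_le ((hnorm.const_mul K).restrict (s := B ∩ H)) ?_).trans
        (setIntegral_le_integral (hnorm.const_mul K) (Eventually.of_forall fun x => by positivity))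
      filter_upwards [ae_restrict_mem hBH] with e he using hlip e he.2
    have h4 := measureReal_inter_add_sdiff (μ := γ) (s := B) hHm
    have h5 : γ.real (B \ H) ≤ γ.real Hᶜ := measureReal_mono fun x hx => hx.2
    have h6 : 0 ≤ γ.real (B \ H) := measureReal_nonneg
    rw [h2] at h3
    have h7 := abs_le.1 h3
    have h8 : a * γ.real (B \ H) ≤ a * γ.real Hᶜ := by gcongr
    have h9 : 0 ≤ a * γ.real (B \ H) := by positivity
    have h10 : a * γ.real B = a * γ.real (B ∩ H) + a * γ.real (B \ H) := by rw [← h4]; ring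
    have h11 : 0 ≤ a * γ.real Hᶜ := by positivity
    have h12 : 0 ≤ K * ∫ x, ‖x‖ ∂γ := (abs_nonneg _).trans h3
    rw [abs_le]
    constructor <;> linarith
  have htot := abs_le.1 (key Set.univ MeasurableSet.univ)
  rw [probReal_univ (μ := γ), mul_one] at htot
  have hM : a / 2 ≤ μ.real Set.univ := by linarith
  have hM0 : 0 < μ.real Set.univ := by linarith
  have hne : μ Set.univ ≠ 0 ∧ μ Set.univ ≠ ∞ := by
    constructor <;> intro h <;> simp [measureReal_def, h] at hM0
  have hpost : etaPosterior S prior H n = (μ Set.univ)⁻¹ • μ := by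
    simp only [etaPosterior]
    rw [heq]
  have hpostB : ∀ B, (etaPosterior S prior H n).real B = (μ.real Set.univ)⁻¹ * μ.real B :=
    fun B => by
    rw [hpost, measureReal_def, Measure.smul_apply, smul_eq_mul, ENNReal.toReal_mul,
      ENNReal.toReal_inv]
    rfl
  refine ⟨⟨?_⟩, fun B hB => ?_⟩
  · rw [hpost, Measure.smul_apply, smul_eq_mul, ENNReal.inv_mul_cancel hne.1 hne.2]
  · rw [hpostB]
    have h1 := abs_le.1 (key B hB)
    have h2 : γ.real B ≤ 1 := measureReal_le_one
    have h3 : 0 ≤ γ.real B := measureReal_nonneg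
    set M := μ.real Set.univ
    have hd0 : 0 ≤ d := (abs_nonneg _).trans (key B hB)
    have h4 : M⁻¹ * μ.real B - γ.real B = (μ.real B - M * γ.real B) / M := by field_simp
    have h5 : |μ.real B - M * γ.real B| ≤ 2 * d := by
      rw [abs_le]
      constructor <;> nlinarith
    rw [h4, abs_div, abs_of_pos hM0, div_le_div_iff₀ hM0 ha]
    nlinarith

variable {α : Type*} {l : Filter α} {N : α → ℕ} {r : ℕ → ℝ} {U : α → Par q k → Par q k}
  {Z : Set (Par q k)} {ζ₀ : Par q k} {m : α → Par q k} {G : Par q k →L[ℝ] Par q k} {κ : ℝ}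
  {S₀ : Matrix (Fin q ⊕ Fin k) (Fin q ⊕ Fin k) ℝ}
  {T T' : α → Matrix (Fin q ⊕ Fin k) (Fin q ⊕ Fin k) ℝ}

namespace Linearized

/-- The posterior of `η` is asymptotically the normalized likelihood. -/
lemma eventually_etaPosterior_tvLe (h : Linearized l N r U Z ζ₀ m G κ)
    (hr : Tendsto r atTop (𝓝 0)) (hS₀ : S₀.PosDef)
    (hT : Tendsto T l (𝓝 S₀)) (hsymm : ∀ᶠ z in l, (T z).IsSymm) (hH : PriorRegular prior H)
    {d : ℝ} (hd : 0 < d) :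
    ∀ᶠ z in l, IsProbabilityMeasure (etaPosterior (T z) prior H (N z)) ∧
      TVLe (etaPosterior (T z) prior H (N z)) (multivariateGaussian 0 ((N z : ℝ)⁻¹ • T z)) d := by
  obtain ⟨K, hK⟩ := hH.2.2.2
  have ha : 0 < prior 0 := hH.2.2.1 0 (mem_of_mem_nhds hH.2.1)
  obtain ⟨C, hC, hCle⟩ := exists_le_quadForm hS₀.inv
  obtain ⟨ρ, hρ, hρH⟩ := Metric.mem_nhds_iff.1 hH.2.1
  set J := ∫ x : Par q k, ‖x‖ ∂stdGaussian _
  have hJ : Tendsto (fun z => K * ((√(N z * (C / 2)))⁻¹ * J)) l (𝓝 0) := by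
    have h1 : Tendsto (fun z => √(N z * (C / 2))) l atTop :=
      Real.tendsto_sqrt_atTop.comp
        ((tendsto_natCast_atTop_atTop.comp h.index).atTop_mul_const (half_pos hC))
    have h2 := (h1.inv_tendsto_atTop.mul_const J).const_mul (K : ℝ)
    simpa using h2
  set b := min (prior 0 / 2) (d * prior 0 / 4) with hb
  have hb0 : 0 < b := by positivity
  have hε : 0 < b / (2 * prior 0) := by positivity
  filter_upwards [hT.eventually (eventually_posDef hS₀), hsymm,
    hT.eventually (eventually_abs_quadForm_inv_sub_le hS₀ (show (0 : ℝ) < 1 / 2 by norm_num)),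
    h.eventually_index_pos, hJ.eventually (gt_mem_nhds (half_pos hb0)),
    h.eventually_le_measureReal_closedBall hS₀ hT hsymm one_pos hε,
    h.index.eventually (hr.eventually (gt_mem_nhds hρ))] with z h1 h2 h3 h4 h5 h6 h7
  have hpd := h1 h2
  have hpd' : ((N z : ℝ)⁻¹ • T z).PosDef := hpd.smul (inv_pos.2 h4)
  have hint := integral_norm_multivariateGaussian_le hpd' (κ := N z * (C / 2)) (by positivity)
    fun x => by
      rw [quadForm_smul_inv hpd.det_pos.ne' (inv_pos.2 h4).ne', inv_inv, mul_assoc]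
      refine mul_le_mul_of_nonneg_left ?_ h4.le
      have h8 := (abs_le.1 (h3 x)).1
      have h9 := hCle x
      linarith
  set γ := multivariateGaussian 0 ((N z : ℝ)⁻¹ • T z) with hγ
  have hHc : γ.real Hᶜ ≤ b / (2 * prior 0) := by
    have h8 : Metric.closedBall (0 : Par q k) (1 * r (N z)) ⊆ H :=
      (Metric.closedBall_subset_ball (by linarith)).trans hρH
    have h9 := measureReal_mono (μ := γ) h8
    rw [probReal_compl_eq_one_sub hH.1]
    linarith
  have htot : K * ∫ x, ‖x‖ ∂γ + prior 0 * γ.real Hᶜ ≤ b := by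
    have h8 : K * ∫ x, ‖x‖ ∂γ ≤ K * ((√(N z * (C / 2)))⁻¹ * J) := by gcongr
    have h9 : prior 0 * γ.real Hᶜ ≤ prior 0 * (b / (2 * prior 0)) := by gcongr
    have h10 : prior 0 * (b / (2 * prior 0)) = b / 2 := by field_simp
    linarith
  obtain ⟨h8, h9⟩ := etaPosterior_tvLe hH hK hpd' htot (min_le_left _ _)
  refine ⟨h8, h9.mono ?_⟩
  rw [div_le_iff₀ ha]
  have : b ≤ d * prior 0 / 4 := min_le_right _ _
  linarith

/-- Normal laws with variances `T / n` and `T' / n` are close if `T` and `T'` have the same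
limit. -/
lemma eventually_tvLe (h : Linearized l N r U Z ζ₀ m G κ) (hS₀ : S₀.PosDef)
    (hT : Tendsto T l (𝓝 S₀)) (hsymm : ∀ᶠ z in l, (T z).IsSymm)
    (hT' : Tendsto T' l (𝓝 S₀)) (hsymm' : ∀ᶠ z in l, (T' z).IsSymm) {d : ℝ} (hd : 0 < d) :
    ∀ᶠ z in l, TVLe (multivariateGaussian 0 ((N z : ℝ)⁻¹ • T z))
      (multivariateGaussian 0 ((N z : ℝ)⁻¹ • T' z)) d := by
  filter_upwards [hT.eventually (eventually_tvLe_multivariateGaussian hS₀ (half_pos hd)), hsymm,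
    hT'.eventually (eventually_tvLe_multivariateGaussian hS₀ (half_pos hd)), hsymm',
    h.eventually_index_pos] with z h1 h2 h3 h4 h5
  exact ((h1 h2 _ (inv_pos.2 h5)).trans (h3 h4 _ (inv_pos.2 h5)).symm).mono (by linarith)

/-- Replacing the law of `η*` by one that is close to it, and absolutely continuous, changes the
law of `ζ*` little. -/
lemma eventually_twoStep_tvLe (h : Linearized l N r U Z ζ₀ m G κ) (hS₀ : S₀.PosDef)
    (hT : Tendsto T l (𝓝 S₀)) (hsymm : ∀ᶠ z in l, (T z).IsSymm)
    {V : α → Matrix (Fin q ⊕ Fin k) (Fin q ⊕ Fin k) ℝ} {solve : α → Par q k → Par q k}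
    (hsolve : ∀ᶠ z in l, IsSolver (U z) Z (Metric.ball ζ₀ (r (N z)))
      (multivariateGaussian 0 ((N z : ℝ)⁻¹ • T z)) (solve z))
    {post : α → Measure (Par q k)}
    (hpost : ∀ z, post z = twoStep (U z) Z (multivariateGaussian 0 ((N z : ℝ)⁻¹ • T z)) (solve z))
    {p : α → Par q k → ℝ}
    (hnormal : AsympNormalPosterior l m V (fun z => Metric.ball ζ₀ (r (N z))) post p)
    {law' : α → Measure (Par q k)} (hac : ∀ z, law' z ≪ volume)
    (hlaw' : ∀ d : ℝ, 0 < d → ∀ᶠ z in l, IsProbabilityMeasure (law' z) ∧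
      TVLe (law' z) (multivariateGaussian 0 ((N z : ℝ)⁻¹ • T z)) d) {d : ℝ} (hd : 0 < d) :
    ∀ᶠ z in l, TVLe (twoStep (U z) Z (law' z) (solve z)) (post z) d := by
  set b := min (1 / 4) (d / 28) with hb
  have hb0 : 0 < b := by positivity
  have hb1 : b ≤ 1 / 4 := min_le_left _ _
  have hb2 : b ≤ d / 28 := min_le_right _ _
  filter_upwards [hsolve, hlaw' b hb0, h.eventually_le_measureReal_closedBall hS₀ hT hsymm h.pos
    hb0, h.image, h.subset, h.injOn, h.contDiffOn, hnormal.prob,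
    hnormal.measureReal_compl_nhd_le (half_pos hd), hsymm,
    hT.eventually (eventually_posDef hS₀), h.eventually_index_pos]
    with z hsol hlaw hball himg hsub hinj hC1 hprob hout hsymm hpd hn
  have hpd' : ((N z : ℝ)⁻¹ • T z).PosDef := (hpd hsymm).smul (inv_pos.2 hn)
  obtain ⟨hlawp, hTV⟩ := hlaw
  set law := multivariateGaussian 0 ((N z : ℝ)⁻¹ • T z) with hlawdef
  have hac' : law' z ≪ law := by
    refine (hac z).trans ?_
    rw [hlawdef, multivariateGaussian_eq_withDensity hpd']
    exact withDensity_absolutelyContinuous' (by fun_prop) (Eventually.of_forall fun x =>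
      (ENNReal.ofReal_pos.2 (normalDensity_pos hpd' 0 x)).ne')
  have hsol' := hsol.of_ac hac'
  have hballS : Metric.closedBall 0 (κ * r (N z)) ⊆ U z '' Z := himg.trans (Set.image_mono hsub)
  have hs : 1 - b ≤ law.real (U z '' Z) := hball.trans (measureReal_mono hballS)
  have hs' : 1 - 2 * b ≤ (law' z).real (U z '' Z) := by
    refine le_trans ?_ (measureReal_mono hballS)
    have := (abs_le.1 (hTV _ (Metric.isClosed_closedBall.measurableSet
      (s := Metric.closedBall 0 (κ * r (N z)))))).1
    linarith
  have hne' : law' z (U z '' Z) ≠ 0 := fun h0 => by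
    rw [measureReal_def, h0] at hs'
    norm_num at hs'
    linarith
  have hprob' := isProbabilityMeasure_twoStep hsol' hne'
  refine (TVLe.of_subset (d := d / 4) (e := d / 2) (C := Metric.ball ζ₀ (r (N z)))
    Metric.isOpen_ball.measurableSet ?_ ?_).mono (by linarith)
  · intro B hB hBN
    have hmeas : MeasurableSet (U z '' B) :=
      hB.image_of_continuousOn_injOn (hC1.continuousOn.mono hBN) (hinj.mono hBN)
    rw [hpost z, measureReal_def, measureReal_def, twoStep_apply hsol' hsub hinj hB hBN,
      twoStep_apply hsol hsub hinj hB hBN, ENNReal.toReal_mul, ENNReal.toReal_mul,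
      ENNReal.toReal_inv, ENNReal.toReal_inv]
    simp only [← measureReal_def]
    have h1 := abs_le.1 (hTV _ hmeas)
    have h2 : law.real (U z '' B) ≤ 1 := measureReal_le_one
    have h3 : (law' z).real (U z '' B) ≤ 1 := measureReal_le_one
    have h4 : 0 ≤ law.real (U z '' B) := measureReal_nonneg
    have h5 : 0 ≤ (law' z).real (U z '' B) := measureReal_nonneg
    have h6 : law.real (U z '' Z) ≤ 1 := measureReal_le_one
    have h7 : (law' z).real (U z '' Z) ≤ 1 := measureReal_le_one
    set x := law.real (U z '' B)
    set x' := (law' z).real (U z '' B)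
    set s := law.real (U z '' Z)
    set s' := (law' z).real (U z '' Z)
    have hinv : ∀ t y : ℝ, 1 - 2 * b ≤ t → t ≤ 1 → 0 ≤ y → y ≤ 1 →
        y ≤ t⁻¹ * y ∧ t⁻¹ * y ≤ y + 4 * b := by
      intro t y ht ht1 hy hy1
      have ht0 : 0 < t := by linarith
      have h8 : t⁻¹ ≤ 1 + 4 * b := by
        rw [inv_le_iff_one_le_mul₀ ht0]
        nlinarith
      have h9 : 1 ≤ t⁻¹ := (one_le_inv₀ ht0).2 ht1
      constructor <;> nlinarith
    have h8 := hinv s x (by linarith) h6 h4 h2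
    have h9 := hinv s' x' hs' h7 h5 h3
    rw [abs_le]
    constructor <;> linarith
  · rw [probReal_compl_eq_one_sub Metric.isOpen_ball.measurableSet] at hout
    linarith

end Linearized

end EtaPosterior

/-! ### Coverage of the regions -/

section Coverage

variable {Ω : Type*} [MeasurableSpace Ω] {P : Measure Ω} {q k : ℕ}

/-- If the events `A n` are squeezed, with probability tending to one, between sublevel sets of
`X n` with levels close to `s`, then the limit of their probabilities is the value at `s` of the
continuous limiting distribution function of `X n`. -/
lemma tendsto_measure_of_squeeze [IsProbabilityMeasure P] {X : ℕ → Ω → ℝ} {F : ℝ → ℝ}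
    (hF : Continuous F)
    (hX : ∀ t, Tendsto (fun n => P {ω | X n ω ≤ t}) atTop (𝓝 (ENNReal.ofReal (F t)))) {s : ℝ}
    {A : ℕ → Ω → Prop}
    (h : ∀ δ : ℝ, 0 < δ → ∀ᶠ z in inProb P,
      (X z.1 z.2 ≤ s - δ → A z.1 z.2) ∧ (A z.1 z.2 → X z.1 z.2 ≤ s + δ)) :
    Tendsto (fun n => P {ω | A n ω}) atTop (𝓝 (ENNReal.ofReal (F s))) := by
  have hcont1 : Tendsto (fun δ : ℝ => ENNReal.ofReal (F (s - δ))) (𝓝[>] 0)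
      (𝓝 (ENNReal.ofReal (F s))) := by
    have : Continuous fun δ : ℝ => ENNReal.ofReal (F (s - δ)) :=
      ENNReal.continuous_ofReal.comp (by fun_prop)
    simpa using (this.tendsto 0).mono_left nhdsWithin_le_nhds
  have hcont2 : Tendsto (fun δ : ℝ => ENNReal.ofReal (F (s + δ))) (𝓝[>] 0)
      (𝓝 (ENNReal.ofReal (F s))) := by
    have : Continuous fun δ : ℝ => ENNReal.ofReal (F (s + δ)) :=
      ENNReal.continuous_ofReal.comp (by fun_prop)
    simpa using (this.tendsto 0).mono_left nhdsWithin_le_nhds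
  refine tendsto_order.2 ⟨fun a ha => ?_, fun a ha => ?_⟩
  · obtain ⟨δ, hδa, hδ⟩ := ((hcont1.eventually (lt_mem_nhds ha)).and self_mem_nhdsWithin).exists
    have h1 := ENNReal.Tendsto.sub (hX (s - δ)) (eventually_inProb.1 (h δ hδ))
      (Or.inr ENNReal.zero_ne_top)
    rw [tsub_zero] at h1
    filter_upwards [h1.eventually (lt_mem_nhds hδa)] with n hn
    refine hn.trans_le (tsub_le_iff_right.2 ((measure_mono fun ω hω => ?_).trans
      (measure_union_le _ _)))
    by_cases hgood : (X n ω ≤ s - δ → A n ω) ∧ (A n ω → X n ω ≤ s + δ)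
    · exact Or.inl (hgood.1 hω)
    · exact Or.inr hgood
  · obtain ⟨δ, hδa, hδ⟩ := ((hcont2.eventually (gt_mem_nhds ha)).and self_mem_nhdsWithin).exists
    have h1 := (hX (s + δ)).add (eventually_inProb.1 (h δ hδ))
    rw [add_zero] at h1
    filter_upwards [h1.eventually (gt_mem_nhds hδa)] with n hn
    refine ((measure_mono fun ω hω => ?_).trans (measure_union_le _ _)).trans_lt hn
    by_cases hgood : (X n ω ≤ s - δ → A n ω) ∧ (A n ω → X n ω ≤ s + δ)
    · exact Or.inl (hgood.2 hω)
    · exact Or.inr hgood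

/-- For asymptotically normal `X`, the quadratic form `X' S⁻¹ X` is asymptotically chi-square. -/
lemma tendsto_measure_quadForm_le [IsProbabilityMeasure P] (hdim : 0 < q + k)
    {S : Matrix (Fin q ⊕ Fin k) (Fin q ⊕ Fin k) ℝ} (hS : S.PosDef) {X : ℕ → Ω → Par q k}
    (hX : TendstoInDistribution X atTop id (fun _ => P) (multivariateGaussian 0 S)) (t : ℝ) :
    Tendsto (fun n => P {ω | quadForm S⁻¹ (X n ω) ≤ t}) atTop
      (𝓝 (ENNReal.ofReal (chiSqCDF (Fin q ⊕ Fin k) t))) := by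
  have hne : Nonempty (Fin q ⊕ Fin k) := by
    rw [← Fintype.card_pos_iff]
    simpa using hdim
  have hclosed : IsClosed {x : Par q k | quadForm S⁻¹ x ≤ t} :=
    isClosed_le (by fun_prop) continuous_const
  have hnull : multivariateGaussian 0 S {x : Par q k | quadForm S⁻¹ x = t} = 0 := by
    rw [multivariateGaussian, Measure.map_apply (by fun_prop)
      (isClosed_eq (by fun_prop) continuous_const).measurableSet]
    convert stdGaussian_norm_sq_eq (ι := Fin q ⊕ Fin k) t using 2
    ext x
    simp [quadForm_inv_sqrt hS]
  have hfront : frontier {x : Par q k | quadForm S⁻¹ x ≤ t} ⊆ {x | quadForm S⁻¹ x = t} :=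
    frontier_le_subset_eq (by fun_prop) continuous_const
  have h1 := ProbabilityMeasure.tendsto_measure_of_null_frontier_of_tendsto' hX.tendsto
    (E := {x : Par q k | quadForm S⁻¹ x ≤ t}) (by
      simpa using measure_mono_null hfront hnull)
  have h2 := multivariateGaussian_quadForm_le hS 0 t
  simp only [sub_zero] at h2
  rw [← h2, ofReal_measureReal]
  simp only [ProbabilityMeasure.coe_mk, Measure.map_id] at h1
  refine h1.congr fun n => ?_
  rw [Measure.map_apply_of_aemeasurable (hX.forall_aemeasurable n) hclosed.measurableSet]
  rfl

variable {α : Type*} {l : Filter α} {n : α → ℕ} {r : ℕ → ℝ} {U : α → Par q k → Par q k}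
  {Z : Set (Par q k)} {ζ₀ : Par q k} {m : α → Par q k} {G : Par q k →L[ℝ] Par q k} {κ : ℝ}
  {S : Matrix (Fin q ⊕ Fin k) (Fin q ⊕ Fin k) ℝ}

/-- The Wald statistic at `ζ₀` is asymptotically equivalent to the quadratic form of `√n U ζ₀`. -/
lemma Linearized.eventually_quadForm_le (h : Linearized l n r U Z ζ₀ m G κ) (hS : S.PosDef)
    {V : α → Matrix (Fin q ⊕ Fin k) (Fin q ⊕ Fin k) ℝ}
    (hVq : ∀ᶠ z in l, ∀ x, quadForm (V z)⁻¹ x = n z * quadForm S⁻¹ (G x)) {s t : ℝ}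
    (hst : s < t) (ht : 0 ≤ t) :
    ∀ᶠ z in l,
      (quadForm S⁻¹ (√(n z) • U z ζ₀) ≤ s → quadForm (V z)⁻¹ (ζ₀ - m z) ≤ t) ∧
      (quadForm (V z)⁻¹ (ζ₀ - m z) ≤ s → quadForm S⁻¹ (√(n z) • U z ζ₀) ≤ t) := by
  set δ := min (1 / 2) ((t - s) / (t + 1)) with hδ
  have hts : 0 < t - s := sub_pos.2 hst
  have hδ0 : 0 < δ := by positivity
  have hδ1 : δ ≤ 1 / 2 := min_le_left _ _
  have hδ2 : δ * t ≤ t - s := by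
    calc δ * t ≤ (t - s) / (t + 1) * (t + 1) := by
          gcongr
          · exact min_le_right _ _
          · linarith
      _ = t - s := by field_simp
  obtain ⟨c, hc, hcle⟩ := exists_abs_quadForm_sub_le hS.inv h.det_ne hδ0
  filter_upwards [hVq, h.linear c hc, h.eventually_mem_nhd, h.eventually_radius_pos, h.zero,
    h.eventually_index_pos] with z hz hlin hm hr hzero hn
  have h1 : ‖U z ζ₀ - G (ζ₀ - m z)‖ ≤ c * ‖ζ₀ - m z‖ := by
    have h2 := hlin ζ₀ (Metric.mem_ball_self hr) (m z) hm
    rwa [hzero, sub_zero] at h2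
  have h2 := hcle _ _ h1
  have h3 : 0 ≤ quadForm S⁻¹ (G (ζ₀ - m z)) := quadForm_nonneg hS.inv.posSemidef _
  rw [hz, quadForm_smul_right, Real.sq_sqrt hn.le]
  obtain ⟨h4, h5⟩ := abs_le.1 h2
  set a := quadForm S⁻¹ (U z ζ₀)
  set b := quadForm S⁻¹ (G (ζ₀ - m z))
  have h6 : n z * a - n z * b ≤ δ * (n z * b) := by nlinarith
  have h7 : -(δ * (n z * b)) ≤ n z * a - n z * b := by nlinarith
  constructor
  · intro h8
    by_contra! h9
    nlinarith
  · intro h8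
    nlinarith

end Coverage

/-! ### Verification for the propensity score model -/

section Verification

variable {𝒳 𝒴 Ω : Type*} [MeasurableSpace 𝒳] [MeasurableSpace 𝒴] [MeasurableSpace Ω] {q k : ℕ}
  {P : Measure Ω} {M : Model 𝒳 𝒴 q k} {W : ℕ → Ω → 𝒳 × 𝒴 × Bool} {ζ₀ : Par q k} {r : ℕ → ℝ}
  {G : Par q k →L[ℝ] Par q k}

lemma Model.toEuclideanCLM_A (hG : HasFDerivAt (M.eta P W) G ζ₀) :
    Matrix.toEuclideanCLM (𝕜 := ℝ) (M.A P W ζ₀) = G := by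
  refine ContinuousLinearMap.coe_injective
    ((EuclideanSpace.basisFun (Fin q ⊕ Fin k) ℝ).toBasis.ext fun b => ?_)
  ext a
  simp [Model.A, hG.fderiv]

lemma Model.posDef_varHat (hS : (M.Sig P W ζ₀).PosDef) (hG : HasFDerivAt (M.eta P W) G ζ₀)
    (hdet : G.det ≠ 0) {n : ℕ} (hn : 0 < (n : ℝ)) : (M.varHat P W ζ₀ n).PosDef := by
  rw [← Model.toEuclideanCLM_A hG, det_toEuclideanCLM] at hdet
  exact (sandwich_posDef hS hdet).smul (inv_pos.2 hn)

lemma Model.quadForm_varHat_inv (hS : (M.Sig P W ζ₀).PosDef)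
    (hG : HasFDerivAt (M.eta P W) G ζ₀) (hdet : G.det ≠ 0) {n : ℕ} (hn : 0 < (n : ℝ))
    (x : Par q k) :
    quadForm (M.varHat P W ζ₀ n)⁻¹ x = n * quadForm (M.Sig P W ζ₀)⁻¹ (G x) := by
  have hG' := Model.toEuclideanCLM_A hG
  rw [← hG', det_toEuclideanCLM] at hdet
  rw [Model.varHat, quadForm_smul_inv (sandwich_posDef hS hdet).det_pos.ne' (inv_pos.2 hn).ne',
    inv_inv, quadForm_sandwich_inv hdet, ← hG']
  rfl

lemma Model.normalDensity_varHat (hS : (M.Sig P W ζ₀).PosDef)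
    (hG : HasFDerivAt (M.eta P W) G ζ₀) (hdet : G.det ≠ 0) {n : ℕ} (hn : 0 < (n : ℝ))
    (m : Par q k) :
    normalDensity m (M.varHat P W ζ₀ n) m =
      |G.det| * normalDensity 0 ((n : ℝ)⁻¹ • M.Sig P W ζ₀) 0 := by
  rw [← Model.toEuclideanCLM_A hG, det_toEuclideanCLM] at hdet ⊢
  have hpd := sandwich_posDef hS hdet
  have h1 := normalDensity_self_mul_sqrt_det hpd.det_pos hS.det_pos (inv_pos.2 hn) m 0
  rw [← sqrt_det_sandwich (S := M.Sig P W ζ₀) hdet] at h1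
  have h2 : √((M.A P W ζ₀)⁻¹ * M.Sig P W ζ₀ * (M.A P W ζ₀)ᵀ⁻¹).det ≠ 0 :=
    (Real.sqrt_pos.2 hpd.det_pos).ne'
  refine mul_right_cancel₀ h2 ?_
  rw [Model.varHat, h1]
  ring

variable [IsProbabilityMeasure P] {ζhat : ℕ → Ω → Par q k}

/-- The estimating equations are asymptotically linear, with the derivative of `η` at `ζ₀`. -/
lemma Model.exists_linearized (hdim : 0 < q + k) (hW : M.Sampling P W ζ₀)
    (hint : M.space ∈ 𝓝 ζ₀) (hr : Tendsto r atTop (𝓝 0))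
    (hr' : Tendsto (fun n : ℕ => r n * √n) atTop atTop)
    (h2 : UniqueEstimate P (M.Un W) M.space ζhat) (h3 : UniqueRoot (M.eta P W) M.space ζ₀)
    (h4 : SmoothEquations P (M.Un W) (fun n => Metric.ball ζ₀ (r n)))
    (h5 : M.AsympNormal P W (fun n => Metric.ball ζ₀ (r n)))
    (h8 : LipschitzVariance (M.Sig P W) (fun n => Metric.ball ζ₀ (r n)))
    (h9 : OneToOne P (M.Un W) (M.eta P W) (fun n => Metric.ball ζ₀ (r n))) :
    ∃ G κ, HasFDerivAt (M.eta P W) G ζ₀ ∧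
      Linearized (inProb P) Prod.fst r (fun z => M.Un W z.1 z.2) M.space ζ₀
        (fun z => ζhat z.1 z.2) G κ := by
  have hr0 := eventually_radius_pos hr'
  obtain ⟨n₁, hn₁, hn₁r⟩ := (h5.and hr0).exists
  have hmem₀ := (hn₁ ζ₀ (Metric.mem_ball_self hn₁r)).1
  have heta : M.eta P W ζ₀ = 0 := (h3.2 ζ₀ h3.1).2 rfl
  obtain ⟨G, hdet, hG⟩ := h4.exists_limit hr hr0
  have hlin : ∀ c : NNReal, 0 < c → ∀ᶠ z in inProb P,
      ApproximatesLinearOn (M.Un W z.1 z.2) G (Metric.ball ζ₀ (r z.1)) c :=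
    fun c hc => eventually_approximatesLinearOn h4 hG hc
  obtain ⟨κ, hκ, himg⟩ := exists_closedBall_subset_image hdim hdet hlin
    (fun ε hε => Model.eventually_norm_Un_le hW h3.1 heta hmem₀ hr' hε) hr0
  have hSig := h8.tendsto (h5.mono fun n hn ζ hζ => (hn ζ hζ).2.1) hr0
  have hderiv := Model.hasFDerivAt_eta hW hint hr hr'
    (h5.mono fun n hn ζ hζ => (hn ζ hζ).1) hSig hlin
  have hsub : ∀ᶠ z in inProb P, Metric.ball ζ₀ (r z.1) ⊆ M.space := by
    obtain ⟨ρ, hρ, hρM⟩ := Metric.mem_nhds_iff.1 hint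
    filter_upwards [tendsto_fst_inProb.eventually (hr.eventually (gt_mem_nhds hρ))] with z hz
    exact (Metric.ball_subset_ball hz.le).trans hρM
  have hr0' := (tendsto_fst_inProb (P := P)).eventually hr0
  have hclose : ∀ ρ : ℝ, 0 < ρ → ρ < 1 → ∀ᶠ z in inProb P,
      ‖ζhat z.1 z.2 - ζ₀‖ ≤ ρ * r z.1 := by
    intro ρ hρ hρ1
    filter_upwards [himg ρ hρ hρ1, hr0', hsub, withProbToOne_iff.1 h2] with z h h' h'' huniq
    obtain ⟨ζ, hζ, hζ0⟩ := h (Metric.mem_closedBall_self (by positivity))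
    have hζM : ζ ∈ M.space := h'' (Metric.closedBall_subset_ball (by nlinarith) hζ)
    rw [← huniq.2.2.2 ζ hζM hζ0]
    exact mem_closedBall_iff_norm.1 hζ
  refine ⟨G, κ * (1 / 2), hderiv, ?_⟩
  exact
    { det_ne := hdet
      index := tendsto_fst_inProb
      radius := hr'
      subset := hsub
      contDiffOn := withProbToOne_iff.1 h4.1
      injOn := withProbToOne_iff.1 h9.1
      jacobian := hG
      linear := hlin
      pos := by positivity
      image := by
        filter_upwards [himg (1 / 2) (by norm_num) (by norm_num), hr0'] with z h h'
        exact h.trans (Set.image_mono (Metric.closedBall_subset_ball (by linarith)))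
      zero := (withProbToOne_iff.1 h2).mono fun z hz => hz.2.2.1
      close := fun ρ hρ => by
        filter_upwards [hclose (min ρ (1 / 2)) (by positivity)
          ((min_le_right _ _).trans_lt (by norm_num)), hr0'] with z h h'
        exact h.trans (mul_le_mul_of_nonneg_right (min_le_left _ _) h'.le) }

end Verification

end BayesPS

open BayesPS in
theorem theorem1 {𝒳 𝒴 Ω : Type*} [MeasurableSpace 𝒳] [MeasurableSpace 𝒴] [MeasurableSpace Ω]
    {q k : ℕ} (hdim : 0 < q + k)
    (P : Measure Ω) [IsProbabilityMeasure P]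
    (M : BayesPS.Model 𝒳 𝒴 q k) (W : ℕ → Ω → 𝒳 × 𝒴 × Bool) (ζ₀ : BayesPS.Par q k)
    (hsampling : M.Sampling P W ζ₀)
    -- the shrinking neighbourhoods `N_n(ζ₀)`, the balls with centre `ζ₀` and radius `r n`
    (hint : M.space ∈ 𝓝 ζ₀)
    (r : ℕ → ℝ) (hr : Tendsto r atTop (𝓝 0))
    (hr' : Tendsto (fun n : ℕ => r n * Real.sqrt n) atTop atTop)
    -- the estimator, the variance estimator and the prior of `η`
    (ζhat : ℕ → Ω → BayesPS.Par q k)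
    (Shat : ℕ → Ω → BayesPS.Par q k → Matrix (Fin q ⊕ Fin k) (Fin q ⊕ Fin k) ℝ)
    (prior : BayesPS.Par q k → ℝ) (H : Set (BayesPS.Par q k))
    -- regularity conditions
    (hmean : ∀ ζ ∈ M.space, Integrable (fun ω => M.unitFun ζ (W 0 ω)) P)
    (h1 : BayesPS.UniformLimit P (M.Un W) (M.eta P W) M.space)
    (h2 : BayesPS.UniqueEstimate P (M.Un W) M.space ζhat)
    (h3 : BayesPS.UniqueRoot (M.eta P W) M.space ζ₀)
    (h4 : BayesPS.SmoothEquations P (M.Un W) (fun n => Metric.ball ζ₀ (r n)))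
    (h5 : M.AsympNormal P W (fun n => Metric.ball ζ₀ (r n)))
    (h6 : BayesPS.PriorRegular prior H)
    (h7 : BayesPS.ConsistentVariance P (M.Sig P W) Shat (fun n => Metric.ball ζ₀ (r n)))
    (h8 : BayesPS.LipschitzVariance (M.Sig P W) (fun n => Metric.ball ζ₀ (r n)))
    (h9 : BayesPS.OneToOne P (M.Un W) (M.eta P W) (fun n => Metric.ball ζ₀ (r n)))
    -- the two-step method and the resulting approximate posterior `post n ω` with density `p n ω`
    (solve : ℕ → Ω → BayesPS.Par q k → BayesPS.Par q k)
    (hsolve : BayesPS.WithProbToOne P (fun n ω =>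
      BayesPS.IsSolver (M.Un W n ω) M.space (Metric.ball ζ₀ (r n))
        (BayesPS.drawLaw (Shat n ω (ζhat n ω)) n) (solve n ω)))
    (post : ℕ → Ω → Measure (BayesPS.Par q k))
    (hpost : ∀ n ω, post n ω = BayesPS.twoStep (M.Un W n ω) M.space
      (BayesPS.drawLaw (Shat n ω (ζhat n ω)) n) (solve n ω))
    (p : ℕ → Ω → BayesPS.Par q k → ℝ)
    (hp : BayesPS.WithProbToOne P (fun n ω =>
      BayesPS.IsDensity (post n ω) (Metric.ball ζ₀ (r n)) (p n ω))) :
    -- the law `N(0, Σ̂ / n)` of the first step approximates the posterior of `η` given `U_n = 0`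
    (∀ ε : ℝ≥0∞, 0 < ε → BayesPS.WithProbToOne P (fun n ω =>
      BayesPS.tvDist (BayesPS.etaPosterior (M.Sig P W (ζhat n ω)) prior H n)
        (BayesPS.drawLaw (Shat n ω (ζhat n ω)) n) < ε)) ∧
    -- convergence of the approximate posterior to the normal law: in total variation,
    (∀ ε : ℝ≥0∞, 0 < ε → BayesPS.WithProbToOne P (fun n ω =>
      BayesPS.tvDist (post n ω)
        (multivariateGaussian (ζhat n ω) (M.varHat P W ζ₀ n)) < ε)) ∧
    -- also if the first step draws from the posterior of `η` itself,
    (∀ ε : ℝ≥0∞, 0 < ε → BayesPS.WithProbToOne P (fun n ω =>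
      BayesPS.tvDist
        (BayesPS.twoStep (M.Un W n ω) M.space
          (BayesPS.etaPosterior (M.Sig P W (ζhat n ω)) prior H n) (solve n ω))
        (multivariateGaussian (ζhat n ω) (M.varHat P W ζ₀ n)) < ε)) ∧
    -- and for the densities, uniformly over `‖ζ - ζ̂‖ ≤ K / √n`
    (∀ K ε : ℝ, 0 < ε → BayesPS.WithProbToOne P (fun n ω =>
      ∀ ζ, ‖ζ - ζhat n ω‖ ≤ K / Real.sqrt n →
        |p n ω ζ / BayesPS.normalDensity (ζhat n ω) (M.varHat P W ζ₀ n) ζ - 1| < ε)) ∧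
    -- posterior consistency
    BayesPS.TendsInProb P (fun n ω => ∫ ζ in Metric.ball ζ₀ (r n),
      BayesPS.normalDensity (ζhat n ω) (M.varHat P W ζ₀ n) ζ) 1 ∧
    -- Bayesian credible regions and frequentist confidence regions match
    (∀ α ∈ Set.Ioo (0 : ℝ) 1, ∀ c : ℝ, BayesPS.IsChiSqQuantile q k α c →
      Tendsto (fun n => P {ω | ζ₀ ∈ BayesPS.waldRegion (ζhat n ω) (M.varHat P W ζ₀ n) c}) atTop
        (𝓝 (ENNReal.ofReal (1 - α))) ∧
      BayesPS.TendsInProb P (fun n ω =>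
        (post n ω).real (BayesPS.waldRegion (ζhat n ω) (M.varHat P W ζ₀ n) c)) (1 - α) ∧
      Tendsto (fun n => P {ω | ζ₀ ∈ BayesPS.hpdRegion (post n ω) (p n ω) α}) atTop
        (𝓝 (ENNReal.ofReal (1 - α))) ∧
      BayesPS.TendsInProb P (fun n ω =>
        (post n ω).real (BayesPS.hpdRegion (post n ω) (p n ω) α)) (1 - α) ∧
      ∀ ε : ℝ≥0∞, 0 < ε → BayesPS.WithProbToOne P (fun n ω =>
        volume (symmDiff (BayesPS.hpdRegion (post n ω) (p n ω) α)
            (BayesPS.waldRegion (ζhat n ω) (M.varHat P W ζ₀ n) c))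
          < ε * volume (BayesPS.waldRegion (ζhat n ω) (M.varHat P W ζ₀ n) c))) := by
  have hr0 := eventually_radius_pos hr'
  obtain ⟨n₁, hn₁, hn₁r⟩ := (h5.and hr0).exists
  have hat₀ := hn₁ ζ₀ (Metric.mem_ball_self hn₁r)
  have hS₀ := hat₀.2.1
  have heta : M.eta P W ζ₀ = 0 := (h3.2 ζ₀ h3.1).2 rfl
  obtain ⟨G, κ, hderiv, hL⟩ :=
    Model.exists_linearized hdim hsampling hint hr hr' h2 h3 h4 h5 h8 h9
  have hdet := hL.det_ne
  have hnpos := hL.eventually_index_pos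
  have hnhd := hL.eventually_mem_nhd
  have hV : ∀ᶠ z in inProb P, (M.varHat P W ζ₀ z.1).PosDef :=
    hnpos.mono fun z hz => Model.posDef_varHat hS₀ hderiv hdet hz
  have hVq : ∀ᶠ z in inProb P, ∀ x, quadForm (M.varHat P W ζ₀ z.1)⁻¹ x =
      z.1 * quadForm (M.Sig P W ζ₀)⁻¹ (G x) :=
    hnpos.mono fun z hz => Model.quadForm_varHat_inv hS₀ hderiv hdet hz
  have hVd : ∀ᶠ z in inProb P,
      normalDensity (ζhat z.1 z.2) (M.varHat P W ζ₀ z.1) (ζhat z.1 z.2) =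
        |G.det| * normalDensity 0 ((z.1 : ℝ)⁻¹ • M.Sig P W ζ₀) 0 :=
    hnpos.mono fun z hz => Model.normalDensity_varHat hS₀ hderiv hdet hz _
  -- consistency of the estimators
  have hζ : Tendsto (fun z : ℕ × Ω => ζhat z.1 z.2) (inProb P) (𝓝 ζ₀) := by
    rw [Metric.tendsto_nhds]
    intro ε hε
    filter_upwards [hnhd, tendsto_fst_inProb.eventually (hr.eventually (gt_mem_nhds hε))]
      with z h h'
    exact (Metric.mem_ball.1 h).trans h'
  have hSig : Tendsto (fun z : ℕ × Ω => M.Sig P W (ζhat z.1 z.2)) (inProb P)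
      (𝓝 (M.Sig P W ζ₀)) :=
    (h8.tendsto (h5.mono fun n hn ζ hζ => (hn ζ hζ).2.1) hr0).comp hζ
  have hSigsymm : ∀ᶠ z in inProb P, (M.Sig P W (ζhat z.1 z.2)).IsSymm := by
    filter_upwards [tendsto_fst_inProb.eventually h5, hnhd] with z h h'
    exact (h _ h').2.1.isHermitian
  have hShat : Tendsto (fun z : ℕ × Ω => Shat z.1 z.2 (ζhat z.1 z.2)) (inProb P)
      (𝓝 (M.Sig P W ζ₀)) := by
    refine tendsto_pi_nhds.2 fun a => tendsto_pi_nhds.2 fun b => ?_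
    have hab : Tendsto (fun z : ℕ × Ω => M.Sig P W (ζhat z.1 z.2) a b) (inProb P)
        (𝓝 (M.Sig P W ζ₀ a b)) := tendsto_pi_nhds.1 (tendsto_pi_nhds.1 hSig a) b
    have hdiff : Tendsto (fun z : ℕ × Ω => Shat z.1 z.2 (ζhat z.1 z.2) a b -
        M.Sig P W (ζhat z.1 z.2) a b) (inProb P) (𝓝 0) := by
      rw [Metric.tendsto_nhds]
      intro ε hε
      filter_upwards [withProbToOne_iff.1 (h7.2 ε hε), hnhd] with z h h'
      simpa [Real.dist_eq] using h _ h' a b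
    simpa using hdiff.add hab
  have hShatsymm : ∀ᶠ z in inProb P, (Shat z.1 z.2 (ζhat z.1 z.2)).IsSymm :=
    Eventually.of_forall fun z => h7.1 _ _ _
  have hsolve' := withProbToOne_iff.1 hsolve
  have hA := hL.asympNormalPosterior hS₀ hShat hShatsymm hV hVq hVd hsolve'
    (post := fun z => post z.1 z.2) (fun z => hpost z.1 z.2) (p := fun z => p z.1 z.2)
    (withProbToOne_iff.1 hp)
  -- the posterior of `η` is close to the law of the draw
  have heta_post : ∀ d : ℝ, 0 < d → ∀ᶠ z in inProb P,
      IsProbabilityMeasure (etaPosterior (M.Sig P W (ζhat z.1 z.2)) prior H z.1) ∧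
      TVLe (etaPosterior (M.Sig P W (ζhat z.1 z.2)) prior H z.1)
        (multivariateGaussian 0 ((z.1 : ℝ)⁻¹ • Shat z.1 z.2 (ζhat z.1 z.2))) d := by
    intro d hd
    filter_upwards [hL.eventually_etaPosterior_tvLe hr hS₀ hSig hSigsymm h6 (half_pos hd),
      hL.eventually_tvLe hS₀ hSig hSigsymm hShat hShatsymm (half_pos hd)] with z h h'
    exact ⟨h.1, (h.2.trans h').mono (by linarith)⟩
  refine ⟨fun ε hε => withProbToOne_iff.2
      (eventually_tvDist_lt (fun d hd => (heta_post d hd).mono fun z hz => hz.2) hε),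
    fun ε hε => withProbToOne_iff.2 (eventually_tvDist_lt (fun d hd => hA.tvLe hd) hε),
    fun ε hε => withProbToOne_iff.2 (eventually_tvDist_lt (fun d hd => ?_) hε),
    fun K ε hε => withProbToOne_iff.2 ?_, tendsInProb_iff.2 ?_, fun α hα c hc => ?_⟩
  · filter_upwards [hL.eventually_twoStep_tvLe hS₀ hShat hShatsymm hsolve'
      (fun z => hpost z.1 z.2) hA (fun z => etaPosterior_ac) heta_post (half_pos hd),
      hA.tvLe (half_pos hd)] with z h h'
    exact (h.trans h').mono (by linarith)
  · -- a ball of radius `K / √n` lies in a fixed ellipsoid of the normal law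
    set C := ∑ a, ∑ b, |(M.Sig P W ζ₀)⁻¹ a b| with hC
    have hC0 : 0 ≤ C := Finset.sum_nonneg fun _ _ => Finset.sum_nonneg fun _ _ => abs_nonneg _
    filter_upwards [hA.abs_div_sub_one_lt (C * (‖G‖ * K) ^ 2) hε, hVq, hnpos]
      with z h hq hn ζ hζK
    refine h ζ ?_
    rw [hq]
    have h1 : ‖G (ζ - ζhat z.1 z.2)‖ ≤ ‖G‖ * (K / √z.1) :=
      (G.le_opNorm _).trans (by gcongr)
    calc (z.1 : ℝ) * quadForm (M.Sig P W ζ₀)⁻¹ (G (ζ - ζhat z.1 z.2))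
        ≤ z.1 * (C * (‖G‖ * (K / √z.1)) ^ 2) := by
          gcongr
          exact (le_abs_self _).trans ((abs_quadForm_le _ _).trans (by gcongr))
      _ = C * (‖G‖ * K) ^ 2 := by
          rw [mul_pow, mul_pow, div_pow, Real.sq_sqrt hn.le]
          field_simp
  · refine hA.tendsto_normal_nhd.congr' ?_
    filter_upwards [hV] with z hz
    exact multivariateGaussian_real_apply hz _ _ Metric.isOpen_ball.measurableSet
  have hne : Nonempty (Fin q ⊕ Fin k) := by
    rw [← Fintype.card_pos_iff]
    simpa using hdim
  have hcF : chiSqCDF (Fin q ⊕ Fin k) c = 1 - α := hc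
  have hc0 : 0 < c := by
    by_contra! hcon
    have h := chiSqCDF_mono (ι := Fin q ⊕ Fin k) hcon
    rw [hcF, chiSqCDF_zero] at h
    linarith [hα.2]
  have hclt : TendstoInDistribution (fun (n : ℕ) ω => √n • M.Un W n ω ζ₀) atTop id (fun _ => P)
      (multivariateGaussian 0 (M.Sig P W ζ₀)) := by
    simpa [heta] using hat₀.2.2
  have hchi := tendsto_measure_quadForm_le hdim hS₀ hclt
  have hFc := continuous_chiSqCDF (ι := Fin q ⊕ Fin k)
  rw [← hcF]
  refine ⟨tendsto_measure_of_squeeze hFc hchi fun δ hδ => ?_, tendsInProb_iff.2 ?_,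
    tendsto_measure_of_squeeze hFc hchi fun δ hδ => ?_, tendsInProb_iff.2 ?_,
    fun ε hε => withProbToOne_iff.2 (hA.volume_symmDiff_lt hdim (by linarith [hα.2]) hc0 hcF hε)⟩
  · filter_upwards [hL.eventually_quadForm_le hS₀ hVq (sub_lt_self c hδ) hc0.le,
      hL.eventually_quadForm_le hS₀ hVq (lt_add_of_pos_right c hδ) (by positivity)] with z h h'
    exact ⟨h.1, h'.2⟩
  · rw [Metric.tendsto_nhds]
    intro ε hε
    filter_upwards [hA.abs_ellipsoid_sub_le (half_pos hε)] with z hz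
    exact (hz c).trans_lt (half_lt_self hε)
  · set δ' := min (δ / 6) (c / 6) with hδ'
    have h0 : 0 < δ' := by positivity
    have h1 : δ' ≤ δ / 6 := min_le_left _ _
    have h2 : δ' ≤ c / 6 := min_le_right _ _
    filter_upwards [hA.hpdRegion_bounds hdim hcF h0 (by linarith),
      hL.eventually_quadForm_le hS₀ hVq (s := c - δ) (t := c - 3 * δ') (by linarith)
        (by linarith),
      hL.eventually_quadForm_le hS₀ hVq (s := c + 3 * δ') (t := c + δ) (by linarith)
        (by linarith), hL.eventually_radius_pos] with z hb h h' hrz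
    exact ⟨fun hX => hb.1 (h.1 hX), fun hX => h'.2 (hb.2.1 ⟨hX, Metric.mem_ball_self hrz⟩)⟩
  · rw [hcF]
    exact hA.tendsto_hpdRegion hdim hc0 hcF
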